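/- **Theorem (classification of global dynamics).** Let $\alpha>0$, $d_1,d_2,d_3\in\mathbb R$, and consider $$\dot x_1=x_1(\alpha-\alpha x_1^2-(2\alpha+d_1)x_2^2+d_2x_3^2),\quad \dot x_2=x_2(\alpha+d_1x_1^2-\alpha x_2^2-(2\alpha+d_3)x_3^2),\quad \dot x_3=x_3(\alpha-(2\alpha+d_2)x_1^2+d_3x_2^2-\alpha x_3^2)$$ on $\mathbb R^3_+=\{x: x_i\ge 0\}$, with $\partial\mathbb R^3_+$ the set of points of $\mathbb R^3_+$ with a zero coordinate and $\mathrm{Int}\,\mathbb R^3_+=\mathbb R^3_+\setminus\partial\mathbb R^3_+$. Write $m_i=\alpha+d_i$, $O$ for the origin, $\mathbf e_i$ for the unit coordinate vectors, $\mathbb S^2_+=\{x\in\mathbb R^3_+:|x|=1\}$, $\mathrm{Int}\,\mathbb S^2_+=\mathbb S^2_+\cap\mathrm{Int}\,\mathbb R^3_+$, $\partial\mathbb S^2_+=\mathbb S^2_+\cap\partial\mathbb R^3_+$, $\Gamma_{ij}=\{x\in\mathbb R^3_+: x_i^2+x_j^2=1,\ x_k=0 \text{ for } k\ne i,j\}$,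 $\mathcal L(y)=\{sy:s>0\}$, and $\omega_d(x)$ for the $\omega$-limit set of the solution starting at $x$. A heteroclinic orbit from $P$ to $Q$ is the orbit of a solution on $\mathbb R$ which tends to the equilibrium $P$ as $t\to-\infty$ and to the equilibrium $Q\neq P$ as $t\to+\infty$. Two systems of this family are *topologically equivalent* if there is a homeomorphism of $\mathbb S^2_+$ that sends the orbits of one on $\mathbb S^2_+$ onto the orbits of the other and preserves the direction of time on all orbits or reverses it on all orbits. For all parameters, every $x\in\mathbb R^3_+$ has a unique solution on $[0,\infty)$, which stays in $\mathbb R^3_+$; every $x\in\mathbb S^2_+$ has a unique solution on $\mathbb R$, which stays in $\mathbb S^2_+$. The compact invariant set $\mathbb S^2_+$ is the global attractor: it attracts every compact subset of $\mathbb R^3_+\setminus\{O\}$ uniformly, $\emptyset\ne\omega_d(x)\subseteq\mathbb S^2_+$ for $x\in\mathbb R^3_+\setminus\{O\}$, and $\omega_d(O)=\{O\}$. There are exactly 6 topological equivalence classes. Each corresponds to one of the following classes of signs, which are all non-empty, mutually exclusive and exhaustive: all $m_i$ non-zero and of the same sign; all $m_i$ non-zero but of different signs; exactly one $m_i$ zero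 and the other two of the same sign; exactly one $m_i$ zero and the other two of opposite signs; exactly two $m_i$ zero; all $m_i$ zero. Cases (i)–(v) below are representatives of these six classes, in this order. (i) Let $m_1,m_2,m_3>0$ and $M=m_1+m_2+m_3=3\alpha+d_1+d_2+d_3$. Let $Q^*$ have coordinates $q^*_i=\sqrt{m_{4-i}/M}$, let $H_1(x)=|x|^2\prod_{i} x_i^{-2m_{4-i}/M}$, $h^*=\prod_i (m_{4-i}/M)^{-m_{4-i}/M}$, $\Lambda_1(h)=\{x\in\mathrm{Int}\,\mathbb R^3_+:H_1(x)=h\}$ and $\Gamma(h)=\mathbb S^2_+\cap\Lambda_1(h)$. The equilibria in $\mathbb R^3_+$ are $O,\mathbf e_1,\mathbf e_2,\mathbf e_3,Q^*$. The sphere $\mathbb S^2_+$ is the union of the curves $\Gamma(h)$, $h\in(h^*,\infty)$, the point $Q^*$ and $\partial\mathbb S^2_+$. Each such $\Gamma(h)$ is a non-constant periodic orbit that separates $Q^*$ from $\partial\mathbb S^2_+$ in $\mathbb S^2_+$; $Q^*$ is a center on $\mathbb S^2_+$; and $\partial\mathbb S^2_+$ is the heteroclinic polycycle formed by $\mathbf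 e_1,\mathbf e_2,\mathbf e_3$ and the open arcs of $\Gamma_{12},\Gamma_{23},\Gamma_{13}$ (without end points), which are heteroclinic orbits from $\mathbf e_1$ to $\mathbf e_2$, from $\mathbf e_2$ to $\mathbf e_3$ and from $\mathbf e_3$ to $\mathbf e_1$. Moreover $\mathrm{Int}\,\mathbb R^3_+=\mathcal L(Q^*)\cup\bigcup_{h>h^*}\Lambda_1(h)$; $\omega_d(x)=\Gamma(h)$ for $x\in\Lambda_1(h)$, $h>h^*$; $\omega_d(x)=\{Q^*\}$ for $x\in\mathcal L(Q^*)$; and $\omega_d(x)$ is one of $\{\mathbf e_1\},\{\mathbf e_2\},\{\mathbf e_3\}$ for $x\in\partial\mathbb R^3_+\setminus\{O\}$. (ii) Let $m_1<0$, $m_2>0$, $m_3<0$. The equilibria in $\mathbb R^3_+$ are $O,\mathbf e_1,\mathbf e_2,\mathbf e_3$. On $\mathbb S^2_+$, $\mathbf e_1$ is a stable node, $\mathbf e_2$ a saddle and $\mathbf e_3$ an unstable node (the eigenvalues of the linearization on the sphere are real and both negative, of opposite signs, and both positive, respectively). The open arcs of $\Gamma_{23}$ and $\Gamma_{12}$ are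 heteroclinic orbits from $\mathbf e_3$ to $\mathbf e_2$ and from $\mathbf e_2$ to $\mathbf e_1$; every point of $\mathbb S^2_+\setminus(\Gamma_{12}\cup\Gamma_{23})$ lies on a heteroclinic orbit in $\mathbb S^2_+$ from $\mathbf e_3$ to $\mathbf e_1$. Moreover $\omega_d(x)=\{\mathbf e_1\}$ for $x\in\mathrm{Int}\,\mathbb R^3_+$, and $\omega_d(x)$ is one of $\{\mathbf e_1\},\{\mathbf e_2\},\{\mathbf e_3\}$ for $x\in\partial\mathbb R^3_+\setminus\{O\}$. (iii.a) Let $m_1=0$, $m_2>0$, $m_3>0$, and $\Gamma_{12}^{-}$, $\Gamma_{12}^{+}$ the parts of $\Gamma_{12}$ with $x_1<\bar q_1$, $x_1>\bar q_1$, where $\bar q_1=\sqrt{m_3/(m_2+m_3)}$. The equilibria in $\mathbb R^3_+$ are $O$, $\mathbf e_3$ and all points of $\Gamma_{12}$. $\mathrm{Int}\,\mathbb S^2_+$ is filled with infinitely many heteroclinic orbits, each from a point of $\Gamma_{12}^-$ to a point of $\Gamma_{12}^+$; the open arcs of $\Gamma_{23}$ and $\Gamma_{13}$ are heteroclinic orbits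 from $\mathbf e_2$ to $\mathbf e_3$ and from $\mathbf e_3$ to $\mathbf e_1$. Moreover $\omega_d(x)=\{Q\}$ for some $Q\in\Gamma_{12}^+$ if $x\in\mathrm{Int}\,\mathbb R^3_+$, and $\omega_d(x)=\{Q\}$ for some $Q\in\{\mathbf e_3\}\cup\Gamma_{12}$ if $x\in\partial\mathbb R^3_+\setminus\{O\}$. (iii.b) Let $m_1>0$, $m_2=0$, $m_3<0$. The equilibria in $\mathbb R^3_+$ are $O$, $\mathbf e_2$ and all points of $\Gamma_{13}$. On $\mathbb S^2_+$, $\mathbf e_2$ is a stable node, $\omega_d(x)=\{\mathbf e_2\}$ for all $x\in\mathbb S^2_+\setminus\Gamma_{13}$, and every $x\in\mathbb S^2_+\setminus(\Gamma_{13}\cup\{\mathbf e_2\})$ lies on a heteroclinic orbit in $\mathbb S^2_+$ from a point of $\Gamma_{13}$ to $\mathbf e_2$. Moreover $\omega_d(x)=\{\mathbf e_2\}$ if $x\in\mathrm{Int}\,\mathbb R^3_+$, and $\omega_d(x)=\{Q\}$ for some $Q\in\{\mathbf e_2\}\cup\Gamma_{13}$ if $x\in\partial\mathbb R^3_+\setminus\{O\}$.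 (iv) Let $m_1=m_2=0$, $m_3<0$. The equilibria in $\mathbb R^3_+$ are $O$ and all points of $\Gamma_{12}\cup\Gamma_{13}$. $\mathrm{Int}\,\mathbb S^2_+$ is filled with heteroclinic orbits, each from a point of $\Gamma_{13}$ to a point of $\Gamma_{12}$; the open arc of $\Gamma_{23}$ is a heteroclinic orbit from $\mathbf e_3$ to $\mathbf e_2$. Moreover $\omega_d(x)=\{Q\}$ for some $Q\in\Gamma_{12}$ if $x\in\mathrm{Int}\,\mathbb R^3_+$, and for some $Q\in\Gamma_{12}\cup\Gamma_{13}$ if $x\in\partial\mathbb R^3_+\setminus\{O\}$. (v) Let $m_1=m_2=m_3=0$. The equilibria in $\mathbb R^3_+$ are $O$ and all points of $\mathbb S^2_+$, and for $x\in\mathbb R^3_+\setminus\{O\}$ one has $\omega_d(x)=\{Q_x\}$, where $\{Q_x\}=\mathcal L(x)\cap\mathbb S^2_+$. -/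

import Mathlib

open Set Filter Topology

noncomputable section

namespace Kolmogorov

/-- The phase space `ℝ³` with its Euclidean norm. Coordinates are indexed by `0, 1, 2`. -/
abbrev E : Type := EuclideanSpace ℝ (Fin 3)

/-- The parameters `α > 0` and `d₁, d₂, d₃ ∈ ℝ` (here `d 0, d 1, d 2`). -/
structure Params where
  α : ℝ
  d : Fin 3 → ℝ
  α_pos : 0 < α

/-- The numbers `mᵢ = α + dᵢ`, whose signs decide the dynamics. -/
def Params.m (p : Params) (i : Fin 3) : ℝ := p.α + p.d i

/-- The vector field of the cubic Kolmogorov system. -/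
def field (p : Params) (x : E) : E :=
  !₂[x 0 * (p.α - p.α * x 0 ^ 2 - (2 * p.α + p.d 0) * x 1 ^ 2 + p.d 1 * x 2 ^ 2),
     x 1 * (p.α + p.d 0 * x 0 ^ 2 - p.α * x 1 ^ 2 - (2 * p.α + p.d 2) * x 2 ^ 2),
     x 2 * (p.α - (2 * p.α + p.d 1) * x 0 ^ 2 + p.d 2 * x 1 ^ 2 - p.α * x 2 ^ 2)]

/-! ### Sets in phase space -/

/-- The closed octant `ℝ³₊`. -/
def octant : Set E := {x | ∀ i, 0 ≤ x i}

/-- The interior `Int ℝ³₊` of the octant. -/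
def intOctant : Set E := {x | ∀ i, 0 < x i}

/-- The boundary `∂ℝ³₊` of the octant. -/
def bdOctant : Set E := {x | x ∈ octant ∧ ∃ i, x i = 0}

/-- The part `S²₊` of the unit sphere in the octant. -/
def sphere : Set E := {x | x ∈ octant ∧ x 0 ^ 2 + x 1 ^ 2 + x 2 ^ 2 = 1}

/-- `Int S²₊`. -/
def intSphere : Set E := sphere ∩ intOctant

/-- `∂S²₊`. -/
def bdSphere : Set E := sphere ∩ bdOctant

/-- The unit coordinate vectors. -/
def e (i : Fin 3) : E := EuclideanSpace.single i 1

/-- The closed quarter circle `Γᵢⱼ` joining `e i` and `e j` (for `i ≠ j`). -/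
def arc (i j : Fin 3) : Set E :=
  {x | x ∈ octant ∧ x i ^ 2 + x j ^ 2 = 1 ∧ ∀ k, k ≠ i → k ≠ j → x k = 0}

/-- `Γᵢⱼ` without its two end points. -/
def openArc (i j : Fin 3) : Set E := {x | x ∈ arc i j ∧ 0 < x i ∧ 0 < x j}

/-- The open ray `{s • y : s > 0}`. -/
def ray (y : E) : Set E := {x | ∃ s : ℝ, 0 < s ∧ x = s • y}

/-! ### Solutions, orbits, limit sets -/

/-- A solution on the whole time axis. -/
def IsTrajectory (p : Params) (γ : ℝ → E) : Prop :=
  ∀ t, HasDerivAt γ (field p (γ t)) t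

/-- A solution on `[0, ∞)` (the values at negative times are irrelevant). -/
def IsForwardSolution (p : Params) (γ : ℝ → E) : Prop :=
  ∀ t, 0 ≤ t → HasDerivWithinAt γ (field p (γ t)) (Ici 0) t

/-- The `ω`-limit set of the solution that starts at `x`. -/
def omega (p : Params) (x : E) : Set E :=
  {y | ∃ γ : ℝ → E, IsForwardSolution p γ ∧ γ 0 = x ∧
    ∃ t : ℕ → ℝ, Tendsto t atTop atTop ∧ Tendsto (fun k => γ (t k)) atTop (𝓝 y)}

/-- The equilibria in the octant. -/
def equilibria (p : Params) : Set E := {x | x ∈ octant ∧ field p x = 0}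

/-- `C` is a non-constant periodic orbit (`T` is its minimal period). -/
def IsPeriodicOrbit (p : Params) (C : Set E) : Prop :=
  ∃ (γ : ℝ → E) (T : ℝ), IsTrajectory p γ ∧ 0 < T ∧ (∀ t, γ (t + T) = γ t) ∧
    InjOn γ (Ico 0 T) ∧ C = range γ

/-- `C` is a heteroclinic orbit from the equilibrium `P` to the equilibrium `Q ≠ P`. -/
def IsHeteroclinicOrbit (p : Params) (C : Set E) (P Q : E) : Prop :=
  P ≠ Q ∧ field p P = 0 ∧ field p Q = 0 ∧
    ∃ γ : ℝ → E, IsTrajectory p γ ∧ C = range γ ∧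
      Tendsto γ atBot (𝓝 P) ∧ Tendsto γ atTop (𝓝 Q)

/-- `Q` is a center of the flow on `S²₊`: an equilibrium such that every sufficiently close other
point of `S²₊` lies on a periodic orbit, and these orbits are as close to `Q` as one wants. -/
def IsCenterOnSphere (p : Params) (Q : E) : Prop :=
  Q ∈ sphere ∧ field p Q = 0 ∧
    ∀ U ∈ 𝓝 Q, ∃ V ∈ 𝓝 Q, ∀ x ∈ V ∩ sphere, x ≠ Q →
      ∃ C, x ∈ C ∧ C ⊆ U ∩ sphere ∧ IsPeriodicOrbit p C

/-- `C ⊆ S²₊` separates the point `Q` from `∂S²₊` inside `S²₊`, that is, `C` goes around `Q`. -/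
def Surrounds (C : Set E) (Q : E) : Prop :=
  ∃ U V : Set E, IsOpen U ∧ IsOpen V ∧ Disjoint (U ∩ sphere) (V ∩ sphere) ∧
    sphere \ C = (U ∪ V) ∩ sphere ∧ Q ∈ U ∧ bdSphere ⊆ V

/-- `S²₊` is a compact invariant set which attracts every compact subset of `ℝ³₊ \ {O}`
uniformly. -/
def SphereIsGlobalAttractor (p : Params) : Prop :=
  IsCompact sphere ∧
  (∀ x ∈ sphere, ∃ γ : ℝ → E, IsTrajectory p γ ∧ γ 0 = x ∧ ∀ t, γ t ∈ sphere) ∧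
  (∀ K : Set E, IsCompact K → K ⊆ octant \ {0} → ∀ ε : ℝ, 0 < ε → ∃ T : ℝ, 0 ≤ T ∧
    ∀ γ : ℝ → E, IsForwardSolution p γ → γ 0 ∈ K →
      ∀ t, T ≤ t → Metric.infDist (γ t) sphere < ε)

/-! ### Nodes and saddles on the sphere -/

/-- The linearization at `Q` of the vector field on the unit sphere: the derivative in directions
tangent to the sphere, projected to the tangent plane `Q^⊥`. -/
def tangentLinearization (p : Params) (Q : E) : Module.End ℝ (Submodule.span ℝ {Q})ᗮ :=
  ((Submodule.span ℝ {Q})ᗮ.orthogonalProjectionOnto ∘L fderiv ℝ (field p) Q ∘L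
    (Submodule.span ℝ {Q})ᗮ.subtypeL).toLinearMap

/-- `Q ∈ S²₊` is an equilibrium and the two eigenvalues (with multiplicity) of the linearization
on the sphere are `a` and `b`. -/
def HasTangentEigenvalues (p : Params) (Q : E) (a b : ℝ) : Prop :=
  Q ∈ sphere ∧ field p Q = 0 ∧
    (tangentLinearization p Q).charpoly =
      (Polynomial.X - Polynomial.C a) * (Polynomial.X - Polynomial.C b)

/-- Stable node on `S²₊`. -/
def IsStableNode (p : Params) (Q : E) : Prop :=
  ∃ a b : ℝ, a < 0 ∧ b < 0 ∧ HasTangentEigenvalues p Q a b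

/-- Unstable node on `S²₊`. -/
def IsUnstableNode (p : Params) (Q : E) : Prop :=
  ∃ a b : ℝ, 0 < a ∧ 0 < b ∧ HasTangentEigenvalues p Q a b

/-- Saddle on `S²₊`. -/
def IsSaddle (p : Params) (Q : E) : Prop :=
  ∃ a b : ℝ, a < 0 ∧ 0 < b ∧ HasTangentEigenvalues p Q a b

/-! ### The first integral, the positive equilibrium, the curves `Γ(h)` -/

/-- The exponent `(α + d_{4-i}) / (3α + d₁ + d₂ + d₃)` (`Fin.rev` exchanges the first and the
last index). -/
def weight (p : Params) (i : Fin 3) : ℝ := p.m (Fin.rev i) / (3 * p.α + p.d 0 + p.d 1 + p.d 2)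

/-- The positive equilibrium `Q*`. -/
def Qstar (p : Params) : E := WithLp.toLp 2 fun i => Real.sqrt (weight p i)

/-- The first integral `H₁(x) = ∏ xᵢ ^ (-2 (α + d_{4-i}) / (3α + d₁ + d₂ + d₃)) ‖x‖²`. -/
def H (p : Params) (x : E) : ℝ := (∏ i, x i ^ (-(2 * weight p i))) * ‖x‖ ^ 2

/-- The critical level `h*`. -/
def hstar (p : Params) : ℝ := ∏ i, weight p i ^ (-weight p i)

/-- The level set (a cone) `Λ₁(h)` of `H₁` in `Int ℝ³₊`. -/
def cone (p : Params) (h : ℝ) : Set E := {x | x ∈ intOctant ∧ H p x = h}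

/-- The curve `Γ(h) = S²₊ ∩ Λ₁(h)`. -/
def Gam (p : Params) (h : ℝ) : Set E := sphere ∩ cone p h

/-- The first coordinate of the point of `Γ₁₂` that divides it into `Γ₁₂⁻` and `Γ₁₂⁺`
in the case `α + d₁ = 0`, `α + d₂ > 0`, `α + d₃ > 0`. -/
def qbar (p : Params) : ℝ := Real.sqrt (p.m 2 / (p.m 1 + p.m 2))

/-- `Γ₁₂⁻`. -/
def arcMinus (p : Params) : Set E := {x | x ∈ arc 0 1 ∧ x 0 < qbar p}

/-- `Γ₁₂⁺`. -/
def arcPlus (p : Params) : Set E := {x | x ∈ arc 0 1 ∧ qbar p < x 0}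

/-! ### Topological classification -/

/-- Topological equivalence of the dynamics on `S²₊`: a homeomorphism of `S²₊` which sends every
orbit of `p` onto an orbit of `q` and either preserves the direction of time on all orbits
(`ε = 1`) or reverses it on all orbits (`ε = -1`). -/
def TopEquiv (p q : Params) : Prop :=
  ∃ (φ : sphere ≃ₜ sphere) (ε : ℝ), (ε = 1 ∨ ε = -1) ∧
    ∀ γ : ℝ → sphere, IsTrajectory p (fun t => (γ t : E)) →
      ∃ τ : ℝ ≃o ℝ, IsTrajectory q (fun t => (φ (γ (ε * τ t)) : E))

/-- The six listed sign conditions. -/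
def ListedCase (p : Params) : Fin 6 → Prop :=
  ![0 < p.m 0 ∧ 0 < p.m 1 ∧ 0 < p.m 2,
    p.m 0 < 0 ∧ 0 < p.m 1 ∧ p.m 2 < 0,
    p.m 0 = 0 ∧ 0 < p.m 1 ∧ 0 < p.m 2,
    0 < p.m 0 ∧ p.m 1 = 0 ∧ p.m 2 < 0,
    p.m 0 = 0 ∧ p.m 1 = 0 ∧ p.m 2 < 0,
    p.m 0 = 0 ∧ p.m 1 = 0 ∧ p.m 2 = 0]

/-- The six classes of sign patterns of `(α + d₁, α + d₂, α + d₃)`: all of the same strict sign;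
no zero and mixed signs; exactly one zero and the others of the same sign; exactly one zero and the
others of opposite signs; exactly two zeros; three zeros. -/
def SignClass (p : Params) : Fin 6 → Prop :=
  ![(∀ i, 0 < p.m i) ∨ (∀ i, p.m i < 0),
    (∀ i, p.m i ≠ 0) ∧ ∃ i j, p.m i * p.m j < 0,
    ∃ i j k, i ≠ j ∧ i ≠ k ∧ j ≠ k ∧ p.m i = 0 ∧ 0 < p.m j * p.m k,
    ∃ i j k, i ≠ j ∧ i ≠ k ∧ j ≠ k ∧ p.m i = 0 ∧ p.m j * p.m k < 0,
    ∃ i j k, i ≠ j ∧ i ≠ k ∧ j ≠ k ∧ p.m i = 0 ∧ p.m j = 0 ∧ p.m k ≠ 0,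
    ∀ i, p.m i = 0]

end Kolmogorov

end

/-!
The dynamics is first reduced to the sphere. On the unit sphere the equations read
`xᵢ' = xᵢ * rate m (sq x) i`, where `rate m` is a linear function of the squares `sq x` that depends
on the parameters only through `m`. Outside the origin, every solution is a solution `u` on the
sphere, run with a changed clock and multiplied by the solution of the logistic equation for the
norm (`IsSphereCurve.isForwardSolution`). The norm tends to `1`, uniformly for compact sets of
initial values; therefore the sphere is the global attractor, and `ω`-limit sets are those of the
radial projection (`omega_smul`).

On the sphere the three edges are invariant, and `m i` gives the direction of the flow on one of
them. If all `m i` are positive, then `centerLevel`, the weighted geometric mean of the squares, is a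
first integral. It decreases strictly along straight rays from the inner equilibrium in the simplex
of the squares (`strictAntiOn_centerLevel`), so that `centerMap` maps the sphere homeomorphically onto
the unit disc and the levels onto circles, on which the angle increases with a speed bounded below
(`IsSphereCurve.exists_rotation`). In all other listed cases two of the squares are monotone along
solutions. Hence all solutions converge in both time directions to equilibria
(`IsSphereCurve.exists_tendsto`), and these are identified by monotonicity and, for the signs
`(0, +, +)`, by a first integral `saddleLevel`.

A permutation of the coordinates together with a reversal of time, `WeakEquiv.swap`, reduces each
class of signs to its listed case (`SignClass.exists_listedCase`). If two of the `m i` vanish, then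
two systems in the same listed case differ by a constant change of speed. In the other cases they
are equivalent by explicit coordinates: for each system there is an embedding of the sphere in the
plane, whose image and whose oriented orbits do not depend on the system
(`OrbitEquiv.of_coordinates`, `IsModel.orbitEquiv`). With a center this is `centerMap`; otherwise an
orbit is described by a constant label and a coordinate that increases strictly between limits that
are the same for all systems, which yields the change of time.

Conversely, the classes are distinguished by properties that an equivalence preserves (`Portrait`).
There are four or three equilibria on the sphere in the first two classes and infinitely many in the
others, which are separated by whether all points are equilibria, whether some point is a limit of
nonconstant solutions both in forward and in backward time (`HasTransit`), and whether all
nonconstant solutions share a limit (`HasFocus`).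
-/

open Set Filter Topology

noncomputable section

namespace Kolmogorov

/-! ### Solutions on the sphere -/

theorem hasDerivWithinAt_coord {γ : ℝ → E} {v : E} {s : Set ℝ} {t : ℝ} :
    HasDerivWithinAt γ v s t ↔ ∀ i, HasDerivWithinAt (fun r => γ r i) (v i) s t := by
  rw [hasDerivWithinAt_iff_hasFDerivWithinAt, hasFDerivWithinAt_euclidean]
  refine forall_congr' fun i => ?_
  rw [hasDerivWithinAt_iff_hasFDerivWithinAt]
  refine iff_of_eq ?_
  congr 1

theorem hasDerivAt_coord {γ : ℝ → E} {v : E} {t : ℝ} :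
    HasDerivAt γ v t ↔ ∀ i, HasDerivAt (fun r => γ r i) (v i) t := by
  simp only [← hasDerivWithinAt_univ, hasDerivWithinAt_coord]

/-- A bounded, globally Lipschitz vector field has a global integral curve through every point. -/
theorem exists_integralCurve {v : E → E} {K L : NNReal} (hK : LipschitzWith K v)
    (hL : ∀ x, ‖v x‖ ≤ L) (x : E) : ∃ γ : ℝ → E, γ 0 = x ∧ ∀ t, HasDerivAt γ (v (γ t)) t := by
  have key : ∀ n : ℕ, ∃ γ : ℝ → E, γ 0 = x ∧
      ∀ t ∈ Ioo (-(n + 1 : ℝ)) (n + 1), HasDerivAt γ (v (γ t)) t := by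
    intro n
    have hn : (0 : ℝ) ∈ Icc (-(n + 1 : ℝ)) (n + 1) := by
      constructor <;> linarith [n.cast_nonneg (α := ℝ)]
    have hP : IsPicardLindelof (fun _ => v) (⟨0, hn⟩ : Icc (-(n + 1 : ℝ)) (n + 1)) x
        (L * (n + 1)) 0 L K :=
      .of_time_independent (fun y _ => hL y) hK.lipschitzOnWith (by simp)
    obtain ⟨γ, h0, h⟩ := hP.exists_eq_forall_mem_Icc_hasDerivWithinAt₀
    exact ⟨γ, h0, fun t ht => (h t (Ioo_subset_Icc_self ht)).hasDerivAt (Icc_mem_nhds ht.1 ht.2)⟩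
  choose γ h0 hγ using key
  have agree : ∀ n k : ℕ, n ≤ k → EqOn (γ n) (γ k) (Ioo (-(n + 1 : ℝ)) (n + 1)) := by
    intro n k hnk
    have hc : (n : ℝ) ≤ k := by exact_mod_cast hnk
    refine ODE_solution_unique_of_mem_Ioo (v := fun _ => v) (s := fun _ => univ) (K := K) (t₀ := 0)
      (fun _ _ => hK.lipschitzOnWith) ?_ (fun t ht => ⟨hγ n t ht, trivial⟩)
      (fun t ht => ⟨hγ k t ⟨by linarith [ht.1], by linarith [ht.2]⟩, trivial⟩) (by rw [h0, h0])
    constructor <;> linarith [n.cast_nonneg (α := ℝ)]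
  -- The local solutions on the intervals `(-(n + 1), n + 1)` are glued.
  refine ⟨fun t => γ ⌊|t|⌋₊ t, h0 _, fun t => ?_⟩
  have ht : t ∈ Ioo (-((⌊|t|⌋₊ : ℝ) + 1)) ((⌊|t|⌋₊ : ℝ) + 1) := abs_lt.1 (Nat.lt_floor_add_one _)
  refine (hγ _ t ht).congr_of_eventuallyEq ?_
  filter_upwards [Ioo_mem_nhds ht.1 ht.2] with s hs
  have hs' : s ∈ Ioo (-((⌊|s|⌋₊ : ℝ) + 1)) ((⌊|s|⌋₊ : ℝ) + 1) := abs_lt.1 (Nat.lt_floor_add_one _)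
  rcases le_total ⌊|s|⌋₊ ⌊|t|⌋₊ with h | h
  · exact agree _ _ h hs'
  · exact (agree _ _ h hs).symm

theorem normSq_eq (x : E) : ‖x‖ ^ 2 = x 0 ^ 2 + x 1 ^ 2 + x 2 ^ 2 := by
  rw [EuclideanSpace.norm_sq_eq]; simp [Fin.sum_univ_three]

/-- The squares of the coordinates, the natural coordinates of the flow on `S²₊`. -/
def sq (x : E) : Fin 3 → ℝ := fun i => x i ^ 2

/-- On the unit sphere the coordinate `xᵢ` grows with the relative rate `rate m (sq x) i`, where
`m = p.m`; the dynamics on `S²₊` depends on the parameters only through `m`. -/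
def rate (m y : Fin 3 → ℝ) : Fin 3 → ℝ :=
  ![m 1 * y 2 - m 0 * y 1, m 0 * y 0 - m 2 * y 2, m 2 * y 1 - m 1 * y 0]

theorem field_apply (p : Params) (x : E) (i : Fin 3) :
    field p x i = x i * (p.α * (1 - ‖x‖ ^ 2) + rate p.m (sq x) i) := by
  rw [normSq_eq]
  fin_cases i <;> simp only [field, rate, Params.m, sq] <;> simp <;> left <;> ring

theorem mem_sphere_iff {x : E} : x ∈ sphere ↔ x ∈ octant ∧ ‖x‖ = 1 := by
  have : x ∈ sphere ↔ x ∈ octant ∧ x 0 ^ 2 + x 1 ^ 2 + x 2 ^ 2 = 1 := Iff.rfl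
  rw [this, ← normSq_eq, pow_eq_one_iff_of_nonneg (norm_nonneg _) two_ne_zero]

theorem isClosed_octant : IsClosed octant := by
  simp only [octant, ofPred_forall]
  exact isClosed_iInter fun i => isClosed_le continuous_const (by fun_prop)

theorem isCompact_sphere : IsCompact sphere := by
  have : sphere = Metric.sphere (0 : E) 1 ∩ octant := by
    ext x; rw [mem_sphere_iff]; simp [and_comm]
  rw [this]
  exact (_root_.isCompact_sphere _ _).inter_right isClosed_octant

theorem contDiff_field (p : Params) : ContDiff ℝ 1 (field p) := by
  rw [contDiff_euclidean]
  intro i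
  fin_cases i <;> simp [field] <;> fun_prop

/-- The vector field whose restriction to the unit sphere is that of the system. -/
def sphereField (m : Fin 3 → ℝ) (x : E) : E := WithLp.toLp 2 fun i => x i * rate m (sq x) i

theorem contDiff_sphereField (m : Fin 3 → ℝ) : ContDiff ℝ 1 (sphereField m) := by
  rw [contDiff_euclidean]
  intro i
  fin_cases i <;> simp [sphereField, rate, sq] <;> fun_prop

/-- A solution of the linear equation `f' = f k` is `f 0` times a positive factor. -/
theorem eq_mul_exp_integral {f k : ℝ → ℝ} (hk : Continuous k)
    (hf : ∀ t, HasDerivAt f (f t * k t) t) (t : ℝ) :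
    f t = f 0 * Real.exp (∫ s in (0 : ℝ)..t, k s) := by
  have hI : ∀ t, HasDerivAt (fun t => ∫ s in (0 : ℝ)..t, k s) (k t) t := fun t =>
    intervalIntegral.integral_hasDerivAt_right (hk.intervalIntegrable _ _)
      (hk.stronglyMeasurableAtFilter _ _) hk.continuousAt
  have hg : ∀ t, HasDerivAt (fun t => f t * Real.exp (-∫ s in (0 : ℝ)..t, k s)) 0 t := by
    intro t
    exact ((hf t).mul (hI t).neg.exp).congr_deriv (by ring)
  have := is_const_of_deriv_eq_zero (fun t => (hg t).differentiableAt) (fun t => (hg t).deriv) t 0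
  simp only [intervalIntegral.integral_same, neg_zero, Real.exp_zero, mul_one] at this
  rw [← this, mul_assoc, ← Real.exp_add]
  simp

/-- `γ` is a complete solution on `S²₊` for all systems with the given `m`. -/
structure IsSphereCurve (m : Fin 3 → ℝ) (γ : ℝ → E) : Prop where
  mem : ∀ t, γ t ∈ sphere
  deriv : ∀ t i, HasDerivAt (fun s => γ s i) (γ t i * rate m (sq (γ t)) i) t

theorem isSphereCurve_iff {p : Params} {γ : ℝ → E} :
    IsSphereCurve p.m γ ↔ IsTrajectory p γ ∧ ∀ t, γ t ∈ sphere := by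
  have key : ∀ x ∈ sphere, ∀ i, field p x i = x i * rate p.m (sq x) i := fun x hx i => by
    rw [field_apply, (mem_sphere_iff.1 hx).2]; ring
  constructor
  · refine fun h => ⟨fun t => hasDerivAt_coord.2 fun i => ?_, h.mem⟩
    rw [key _ (h.mem t)]; exact h.deriv t i
  · refine fun h => ⟨h.2, fun t i => ?_⟩
    rw [← key _ (h.2 t)]; exact hasDerivAt_coord.1 (h.1 t) i

theorem continuous_rate (m : Fin 3 → ℝ) (i : Fin 3) : Continuous fun x : E => rate m (sq x) i := by
  fin_cases i <;> simp only [rate, sq] <;> simp <;> fun_prop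

theorem inner_sphereField (m : Fin 3 → ℝ) (x : E) : x 0 * sphereField m x 0 +
    x 1 * sphereField m x 1 + x 2 * sphereField m x 2 = 0 := by
  simp [sphereField, rate, sq]; ring

theorem exists_isSphereCurve (m : Fin 3 → ℝ) {x : E} (hx : x ∈ sphere) :
    ∃ γ, IsSphereCurve m γ ∧ γ 0 = x := by
  -- The field is cut off far from the sphere; it stays tangent to all spheres centred at `0`.
  let χ : ContDiffBump (0 : E) := ⟨1, 2, one_pos, one_lt_two⟩
  have hcd : ContDiff ℝ 1 fun x => χ x • sphereField m x := χ.contDiff.smul (contDiff_sphereField m)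
  have hcs : HasCompactSupport fun x => χ x • sphereField m x := χ.hasCompactSupport.smul_right
  obtain ⟨K, hK⟩ := ContDiff.lipschitzWith_of_hasCompactSupport hcs hcd one_ne_zero
  obtain ⟨L, hL⟩ := hcs.exists_bound_of_continuous hcd.continuous
  obtain ⟨γ, h0, hγ⟩ := exists_integralCurve hK (L := L.toNNReal)
    (fun x => (hL x).trans (Real.le_coe_toNNReal L)) x
  have hγc : Continuous γ := continuous_iff_continuousAt.2 fun t => (hγ t).continuousAt
  have hd : ∀ t i, HasDerivAt (fun s => γ s i) (γ t i * (χ (γ t) * rate m (sq (γ t)) i)) t := by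
    intro t i
    convert hasDerivAt_coord.1 (hγ t) i using 1
    simp [sphereField]; ring
  have hn : ∀ t, γ t 0 ^ 2 + γ t 1 ^ 2 + γ t 2 ^ 2 = 1 := by
    have hg : ∀ t, HasDerivAt (fun t => γ t 0 ^ 2 + γ t 1 ^ 2 + γ t 2 ^ 2) 0 t := by
      intro t
      refine ((((hd t 0).pow 2).add ((hd t 1).pow 2)).add ((hd t 2).pow 2)).congr_deriv ?_
      have := inner_sphereField m (γ t)
      simp only [sphereField] at this
      push_cast
      linear_combination (2 * χ (γ t)) * this
    intro t
    rw [is_const_of_deriv_eq_zero (fun t => (hg t).differentiableAt) (fun t => (hg t).deriv) t 0,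
      h0]
    exact hx.2
  have hχ : ∀ t, χ (γ t) = 1 := fun t => χ.one_of_mem_closedBall <| by
    rw [mem_closedBall_zero_iff, ← abs_of_nonneg (norm_nonneg (γ t)), ← sq_le_sq₀ (by positivity)
      (by exact zero_le_one), sq_abs, normSq_eq, hn]
    exact (one_pow 2).ge
  refine ⟨γ, ⟨fun t => ⟨fun i => ?_, hn t⟩, fun t i => by simpa [hχ] using hd t i⟩, h0⟩
  rw [eq_mul_exp_integral (χ.continuous.comp hγc |>.mul ((continuous_rate m i).comp hγc))
    (fun t => hd t i) t, h0]
  exact mul_nonneg (hx.1 i) (Real.exp_pos _).le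

theorem exists_lipschitzOnWith_field (p : Params) (R : ℝ) :
    ∃ K, LipschitzOnWith K (field p) (Metric.closedBall 0 R) :=
  (contDiff_field p).contDiffOn.exists_lipschitzOnWith one_ne_zero (convex_closedBall _ _)
    (isCompact_closedBall _ _)

theorem IsForwardSolution.eqOn {p : Params} {γ δ : ℝ → E} (hγ : IsForwardSolution p γ)
    (hδ : IsForwardSolution p δ) (h0 : γ 0 = δ 0) : EqOn γ δ (Ici 0) := by
  intro T hT
  have hγc : ContinuousOn γ (Icc 0 T) := fun t ht =>
    (hγ t ht.1).continuousWithinAt.mono Icc_subset_Ici_self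
  have hδc : ContinuousOn δ (Icc 0 T) := fun t ht =>
    (hδ t ht.1).continuousWithinAt.mono Icc_subset_Ici_self
  obtain ⟨A, hA⟩ := isCompact_Icc.exists_bound_of_continuousOn hγc
  obtain ⟨B, hB⟩ := isCompact_Icc.exists_bound_of_continuousOn hδc
  obtain ⟨K, hK⟩ := exists_lipschitzOnWith_field p (max A B)
  refine ODE_solution_unique_of_mem_Icc_right (v := fun _ => field p)
    (s := fun _ => Metric.closedBall 0 (max A B)) (fun _ _ => hK) hγc
    (fun t ht => (hγ t ht.1).mono (Ici_subset_Ici.2 ht.1)) (fun t ht => ?_) hδc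
    (fun t ht => (hδ t ht.1).mono (Ici_subset_Ici.2 ht.1)) (fun t ht => ?_) h0 ⟨hT, le_rfl⟩
  · simpa using Or.inl (hA t (Ico_subset_Icc_self ht))
  · simpa using Or.inr (hB t (Ico_subset_Icc_self ht))

theorem IsTrajectory.eq_of_eq {p : Params} {γ δ : ℝ → E} (hγ : IsTrajectory p γ)
    (hδ : IsTrajectory p δ) {s : ℝ} (h : γ s = δ s) : γ = δ := by
  have hc : ∀ {γ : ℝ → E}, IsTrajectory p γ → Continuous γ := fun h =>
    continuous_iff_continuousAt.2 fun t => (h t).continuousAt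
  ext1 t
  set T := max |s| |t| + 1
  have hs : s ∈ Ioo (-T) T := abs_lt.1 (by linarith [le_max_left |s| |t|])
  have ht : t ∈ Ioo (-T) T := abs_lt.1 (by linarith [le_max_right |s| |t|])
  obtain ⟨A, hA⟩ := isCompact_Icc.exists_bound_of_continuousOn
    (hc hγ).continuousOn (s := Icc (-T) T)
  obtain ⟨B, hB⟩ := isCompact_Icc.exists_bound_of_continuousOn
    (hc hδ).continuousOn (s := Icc (-T) T)
  obtain ⟨K, hK⟩ := exists_lipschitzOnWith_field p (max A B)
  refine ODE_solution_unique_of_mem_Ioo (v := fun _ => field p)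
    (s := fun _ => Metric.closedBall 0 (max A B)) (fun _ _ => hK) hs
    (fun t ht => ⟨hγ t, ?_⟩) (fun t ht => ⟨hδ t, ?_⟩) h ht
  · simpa using Or.inl (hA t (Ioo_subset_Icc_self ht))
  · simpa using Or.inr (hB t (Ioo_subset_Icc_self ht))

/-- Every vector `m` belongs to some system. -/
theorem exists_params (m : Fin 3 → ℝ) : ∃ p : Params, p.m = m :=
  ⟨⟨1, fun i => m i - 1, one_pos⟩, by ext i; simp [Params.m]⟩

namespace IsSphereCurve

variable {m : Fin 3 → ℝ} {γ δ : ℝ → E}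

theorem eq_of_eq (hγ : IsSphereCurve m γ) (hδ : IsSphereCurve m δ) {s : ℝ} (h : γ s = δ s) :
    γ = δ := by
  obtain ⟨p, rfl⟩ := exists_params m
  exact (isSphereCurve_iff.1 hγ).1.eq_of_eq (isSphereCurve_iff.1 hδ).1 h

theorem continuous (hγ : IsSphereCurve m γ) : Continuous γ := by
  obtain ⟨p, rfl⟩ := exists_params m
  exact continuous_iff_continuousAt.2 fun t => ((isSphereCurve_iff.1 hγ).1 t).continuousAt

/-- Time shift and scaling; `c < 0` reverses time. -/
theorem comp_affine (hγ : IsSphereCurve m γ) (c s : ℝ) :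
    IsSphereCurve (fun i => c * m i) (fun t => γ (c * t + s)) := by
  refine ⟨fun t => hγ.mem _, fun t i => ?_⟩
  have h1 : HasDerivAt (fun t => c * t + s) c t := by
    simpa using ((hasDerivAt_id t).const_mul c).add_const s
  refine ((hγ.deriv (c * t + s) i).comp t h1).congr_deriv ?_
  fin_cases i <;> simp [rate] <;> ring

theorem shift (hγ : IsSphereCurve m γ) (s : ℝ) : IsSphereCurve m (fun t => γ (t + s)) := by
  simpa using hγ.comp_affine 1 s

theorem reverse (hγ : IsSphereCurve m γ) : IsSphereCurve (fun i => - m i) (fun t => γ (-t)) := by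
  simpa using hγ.comp_affine (-1) 0

/-- Since `rate m` is linear, the squares of the coordinates have a solution formula in terms of
their integrals. -/
theorem exists_integrals (hγ : IsSphereCurve m γ) : ∃ I : ℝ → Fin 3 → ℝ,
    (∀ t i, HasDerivAt (fun s => I s i) (sq (γ t) i) t) ∧ (∀ i, I 0 i = 0) ∧
      ∀ t i, sq (γ t) i = sq (γ 0) i * Real.exp (2 * rate m (I t) i) := by
  have hs : ∀ i, Continuous fun t => sq (γ t) i := fun i => by
    have := hγ.continuous
    simp only [sq]; fun_prop
  have hI : ∀ t i, HasDerivAt (fun t => ∫ s in (0 : ℝ)..t, sq (γ s) i) (sq (γ t) i) t :=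
    fun t i => intervalIntegral.integral_hasDerivAt_right ((hs i).intervalIntegrable _ _)
      ((hs i).stronglyMeasurableAtFilter _ _) (hs i).continuousAt
  refine ⟨fun t i => ∫ s in (0 : ℝ)..t, sq (γ s) i, hI, by simp, fun t i => ?_⟩
  have h0 : rate m (fun i => ∫ s in (0 : ℝ)..0, sq (γ s) i) i = 0 := by
    fin_cases i <;> simp [rate]
  have hr : ∀ t, HasDerivAt (fun t => rate m (fun i => ∫ s in (0 : ℝ)..t, sq (γ s) i) i)
      (rate m (sq (γ t)) i) t := by
    intro t
    fin_cases i
    · exact ((hI t 2).const_mul (m 1)).sub ((hI t 1).const_mul (m 0))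
    · exact ((hI t 0).const_mul (m 0)).sub ((hI t 2).const_mul (m 2))
    · exact ((hI t 1).const_mul (m 2)).sub ((hI t 0).const_mul (m 1))
  have hg : ∀ t, HasDerivAt (fun t => γ t i *
      Real.exp (-rate m (fun i => ∫ s in (0 : ℝ)..t, sq (γ s) i) i)) 0 t := by
    intro t
    exact ((hγ.deriv t i).mul (hr t).neg.exp).congr_deriv (by ring)
  have := is_const_of_deriv_eq_zero (fun t => (hg t).differentiableAt) (fun t => (hg t).deriv) t 0
  simp only [h0, neg_zero, Real.exp_zero, mul_one] at this
  rw [sq, sq, ← this, mul_pow, ← Real.exp_nat_mul, mul_assoc, ← Real.exp_add]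
  simp

end IsSphereCurve

/-! ### Reduction to the flow on the sphere -/

/-- The denominator of the logistic solution for `‖x‖²`. -/
def logisticDen (α r t : ℝ) : ℝ := 1 + r ^ 2 * (Real.exp (2 * α * t) - 1)

/-- The norm, at time `t`, of the solution that starts at distance `r` from the origin. -/
def radius (α r t : ℝ) : ℝ := r * Real.exp (α * t) / √(logisticDen α r t)

/-- The time that the radial projection of a solution has run on the sphere up to time `t`. -/
def sphereTime (α r t : ℝ) : ℝ := Real.log (logisticDen α r t) / (2 * α)

section Radial

variable {α r t : ℝ}

theorem logisticDen_zero : logisticDen α r 0 = 1 := by simp [logisticDen]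

theorem logisticDen_pos (hα : 0 < α) (ht : 0 ≤ t) : 0 < logisticDen α r t := by
  have : 1 ≤ Real.exp (2 * α * t) := Real.one_le_exp (by positivity)
  have := mul_nonneg (sq_nonneg r) (sub_nonneg.2 this)
  simp only [logisticDen]; linarith

theorem hasDerivAt_logisticDen :
    HasDerivAt (logisticDen α r) (2 * α * (r ^ 2 * Real.exp (2 * α * t))) t := by
  have h1 : HasDerivAt (fun t => 2 * α * t) (2 * α) t := by
    simpa using (hasDerivAt_id t).const_mul (2 * α)
  exact (((h1.exp.sub_const 1).const_mul (r ^ 2)).const_add 1).congr_deriv (by ring)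

theorem tendsto_logisticDen (hα : 0 < α) (hr : 0 < r) :
    Tendsto (logisticDen α r) atTop atTop := by
  refine tendsto_atTop_add_const_left _ _ (Tendsto.const_mul_atTop (by positivity) ?_)
  refine tendsto_atTop_add_const_right _ _ (Real.tendsto_exp_atTop.comp ?_)
  exact tendsto_id.const_mul_atTop (by positivity)

theorem radius_sq (hα : 0 < α) (ht : 0 ≤ t) :
    radius α r t ^ 2 = r ^ 2 * Real.exp (2 * α * t) / logisticDen α r t := by
  rw [radius, div_pow, Real.sq_sqrt (logisticDen_pos hα ht).le, mul_pow, ← Real.exp_nat_mul]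
  push_cast; ring_nf

theorem radius_pos (hα : 0 < α) (hr : 0 < r) (ht : 0 ≤ t) : 0 < radius α r t :=
  div_pos (mul_pos hr (Real.exp_pos _)) (Real.sqrt_pos.2 (logisticDen_pos hα ht))

theorem radius_sq_sub_one (hα : 0 < α) (ht : 0 ≤ t) :
    radius α r t ^ 2 - 1 = (r ^ 2 - 1) / logisticDen α r t := by
  have := logisticDen_pos (r := r) hα ht
  rw [radius_sq hα ht]
  field_simp
  simp only [logisticDen]; ring

theorem abs_radius_sub_one_le (hα : 0 < α) (hr : 0 < r) (ht : 0 ≤ t) :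
    |radius α r t - 1| ≤ |r ^ 2 - 1| / logisticDen α r t := by
  have h1 := radius_pos hα hr ht
  have h2 := radius_sq_sub_one (r := r) hα ht
  rw [← abs_of_pos (logisticDen_pos (r := r) hα ht), ← abs_div, ← h2,
    show radius α r t ^ 2 - 1 = (radius α r t - 1) * (radius α r t + 1) by ring, abs_mul]
  refine le_mul_of_one_le_right (abs_nonneg _) ?_
  rw [abs_of_pos (by linarith)]; linarith

theorem tendsto_radius (hα : 0 < α) (hr : 0 < r) : Tendsto (radius α r) atTop (𝓝 1) := by
  rw [tendsto_iff_norm_sub_tendsto_zero]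
  refine squeeze_zero' (Eventually.of_forall fun t => norm_nonneg _)
    ((eventually_ge_atTop 0).mono fun t ht => abs_radius_sub_one_le hα hr ht) ?_
  exact (tendsto_logisticDen hα hr).const_div_atTop _

theorem hasDerivAt_radius (hα : 0 < α) (ht : 0 ≤ t) :
    HasDerivAt (radius α r) (α * (1 - radius α r t ^ 2) * radius α r t) t := by
  have hD := logisticDen_pos (r := r) hα ht
  have h1 : HasDerivAt (fun t => α * t) α t := by simpa using (hasDerivAt_id t).const_mul α
  refine ((h1.exp.const_mul r).div (hasDerivAt_logisticDen.sqrt hD.ne')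
    (Real.sqrt_pos.2 hD).ne').congr_deriv ?_
  have hs := Real.sq_sqrt hD.le
  have hs0 := Real.sqrt_pos.2 hD
  rw [radius_sq hα ht, radius]
  rw [← hs]
  rw [Real.sqrt_sq hs0.le]
  field_simp

theorem hasDerivAt_sphereTime (hα : 0 < α) (ht : 0 ≤ t) :
    HasDerivAt (sphereTime α r) (radius α r t ^ 2) t := by
  have hD := logisticDen_pos (r := r) hα ht
  refine ((hasDerivAt_logisticDen.log hD.ne').div_const (2 * α)).congr_deriv ?_
  rw [radius_sq hα ht]; field_simp

theorem tendsto_sphereTime (hα : 0 < α) (hr : 0 < r) :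
    Tendsto (sphereTime α r) atTop atTop :=
  (Real.tendsto_log_atTop.comp (tendsto_logisticDen hα hr)).atTop_div_const (by positivity)

/-- Every sequence of times on the sphere that tends to infinity comes, up to finitely many terms,
from a sequence of times in the octant; `sphereTime` is inverted explicitly. -/
theorem exists_seq_sphereTime (hα : 0 < α) (hr : 0 < r) {τ : ℕ → ℝ} (hτ : Tendsto τ atTop atTop) :
    ∃ t : ℕ → ℝ, Tendsto t atTop atTop ∧ ∀ᶠ k in atTop, sphereTime α r (t k) = τ k := by
  refine ⟨fun k => Real.log ((Real.exp (2 * α * τ k) - 1) / r ^ 2 + 1) / (2 * α), ?_, ?_⟩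
  · refine (Real.tendsto_log_atTop.comp ?_).atTop_div_const (by positivity)
    refine tendsto_atTop_add_const_right _ _ (Tendsto.atTop_div_const (by positivity) ?_)
    refine tendsto_atTop_add_const_right _ _ (Real.tendsto_exp_atTop.comp ?_)
    exact hτ.const_mul_atTop (by positivity)
  · filter_upwards [hτ.eventually_ge_atTop 0] with k hk
    have h1 : 1 ≤ Real.exp (2 * α * τ k) := Real.one_le_exp (by positivity)
    have h2 : 0 ≤ (Real.exp (2 * α * τ k) - 1) / r ^ 2 := div_nonneg (by linarith) (by positivity)
    rw [sphereTime, logisticDen, mul_div_cancel₀ _ (by positivity), Real.exp_log (by linarith),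
      add_sub_cancel_right, mul_div_cancel₀ _ (by positivity), add_sub_cancel, Real.log_exp,
      mul_div_cancel_left₀ _ (by positivity)]

end Radial

theorem norm_smul_sphere {x : E} (hx : x ∈ sphere) {r : ℝ} (hr : 0 ≤ r) : ‖r • x‖ = r := by
  rw [norm_smul, (mem_sphere_iff.1 hx).2, mul_one, Real.norm_of_nonneg hr]

theorem rate_smul (m : Fin 3 → ℝ) (x : E) (r : ℝ) (i : Fin 3) :
    rate m (sq (r • x)) i = r ^ 2 * rate m (sq x) i := by
  fin_cases i <;> simp [rate, sq] <;> ring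

/-- Every solution is a solution on the sphere, run with a changed speed and multiplied by the
solution of the logistic equation for the norm. -/
theorem IsSphereCurve.isForwardSolution {p : Params} {u : ℝ → E} (hu : IsSphereCurve p.m u)
    {r : ℝ} (hr : 0 < r) :
    IsForwardSolution p fun t => radius p.α r t • u (sphereTime p.α r t) := by
  intro t ht
  refine HasDerivAt.hasDerivWithinAt (hasDerivAt_coord.2 fun i => ?_)
  have h := (hasDerivAt_radius (r := r) p.α_pos ht).mul
    ((hu.deriv (sphereTime p.α r t) i).comp t (hasDerivAt_sphereTime p.α_pos ht))
  refine h.congr_deriv ?_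
  rw [field_apply, norm_smul_sphere (hu.mem _) (radius_pos p.α_pos hr ht).le, rate_smul]
  simp; ring

theorem forwardSolution_zero {α r : ℝ} (u : ℝ → E) :
    radius α r 0 • u (sphereTime α r 0) = r • u 0 := by
  simp [radius, sphereTime, logisticDen_zero]

theorem normalize_mem_sphere {x : E} (hx : x ∈ octant \ {0}) : ‖x‖⁻¹ • x ∈ sphere := by
  have h0 : 0 < ‖x‖ := norm_pos_iff.2 hx.2
  refine mem_sphere_iff.2 ⟨fun i => ?_, ?_⟩
  · simpa using mul_nonneg (inv_nonneg.2 h0.le) (hx.1 i)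
  · rw [norm_smul, norm_inv, norm_norm, inv_mul_cancel₀ h0.ne']

/-- Points of the octant other than the origin in polar form. -/
theorem exists_polar (m : Fin 3 → ℝ) {x : E} (hx : x ∈ octant \ {0}) :
    ∃ u, IsSphereCurve m u ∧ 0 < ‖x‖ ∧ x = ‖x‖ • u 0 ∧ u 0 = ‖x‖⁻¹ • x := by
  have h0 : 0 < ‖x‖ := norm_pos_iff.2 hx.2
  obtain ⟨u, hu, hu0⟩ := exists_isSphereCurve m (normalize_mem_sphere hx)
  exact ⟨u, hu, h0, by rw [hu0, smul_inv_smul₀ h0.ne'], hu0⟩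

theorem smul_mem_octant {x : E} (hx : x ∈ octant) {r : ℝ} (hr : 0 ≤ r) : r • x ∈ octant :=
  fun i => by simpa using mul_nonneg hr (hx i)

theorem field_zero (p : Params) : field p 0 = 0 := by
  ext i; rw [field_apply]; simp

theorem isForwardSolution_zero (p : Params) : IsForwardSolution p fun _ => 0 := fun t _ => by
  rw [field_zero]; exact hasDerivWithinAt_const _ _ _

theorem exists_forwardSolution (p : Params) {x : E} (hx : x ∈ octant) :
    ∃ γ : ℝ → E, IsForwardSolution p γ ∧ γ 0 = x ∧ (∀ t, 0 ≤ t → γ t ∈ octant) ∧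
      ∀ γ' : ℝ → E, IsForwardSolution p γ' → γ' 0 = x → EqOn γ' γ (Ici 0) := by
  suffices ∃ γ : ℝ → E, IsForwardSolution p γ ∧ γ 0 = x ∧ (∀ t, 0 ≤ t → γ t ∈ octant) by
    obtain ⟨γ, h, h0, h1⟩ := this
    exact ⟨γ, h, h0, h1, fun δ hδ hδ0 => hδ.eqOn h (hδ0.trans h0.symm)⟩
  by_cases hx0 : x = 0
  · exact ⟨fun _ => 0, isForwardSolution_zero p, hx0.symm, fun _ _ i => le_rfl⟩
  · obtain ⟨u, hu, hr, hxu, -⟩ := exists_polar p.m ⟨hx, hx0⟩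
    exact ⟨_, hu.isForwardSolution hr, by rw [forwardSolution_zero, ← hxu],
      fun t ht => smul_mem_octant (hu.mem _).1 (radius_pos p.α_pos hr ht).le⟩

theorem omega_zero (p : Params) : omega p 0 = {0} := by
  refine Subset.antisymm ?_ (singleton_subset_iff.2 ⟨fun _ => 0, isForwardSolution_zero p, rfl,
    fun k => k, tendsto_natCast_atTop_atTop, tendsto_const_nhds⟩)
  rintro y ⟨γ, hγ, h0, t, ht, hty⟩
  have h := hγ.eqOn (isForwardSolution_zero p) h0
  refine tendsto_nhds_unique hty (tendsto_const_nhds.congr' ?_)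
  filter_upwards [ht.eventually_ge_atTop 0] with k hk using (h hk).symm

/-- The `ω`-limit set of a point is that of its radial projection under the flow on the sphere. -/
theorem omega_smul {p : Params} {u : ℝ → E} (hu : IsSphereCurve p.m u) {r : ℝ} (hr : 0 < r) :
    omega p (r • u 0) = {y | ∃ t : ℕ → ℝ, Tendsto t atTop atTop ∧
      Tendsto (fun k => u (t k)) atTop (𝓝 y)} := by
  have hsol := hu.isForwardSolution hr
  ext y
  constructor
  · rintro ⟨γ, hγ, h0, t, ht, hty⟩
    have heq := hγ.eqOn hsol (h0.trans (forwardSolution_zero u).symm)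
    refine ⟨fun k => sphereTime p.α r (t k), (tendsto_sphereTime p.α_pos hr).comp ht, ?_⟩
    have h1 : Tendsto (fun k => (radius p.α r (t k))⁻¹ • γ (t k)) atTop (𝓝 ((1 : ℝ)⁻¹ • y)) :=
      ((tendsto_radius p.α_pos hr).comp ht |>.inv₀ one_ne_zero).smul hty
    rw [inv_one, one_smul] at h1
    refine h1.congr' ?_
    filter_upwards [ht.eventually_ge_atTop 0] with k hk
    rw [heq hk, inv_smul_smul₀ (radius_pos p.α_pos hr hk).ne']
  · rintro ⟨τ, hτ, hy⟩
    obtain ⟨t, ht, hst⟩ := exists_seq_sphereTime p.α_pos hr hτ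
    refine ⟨_, hsol, forwardSolution_zero u, t, ht, ?_⟩
    have h1 : Tendsto (fun k => radius p.α r (t k) • u (τ k)) atTop (𝓝 ((1 : ℝ) • y)) :=
      ((tendsto_radius p.α_pos hr).comp ht).smul hy
    rw [one_smul] at h1
    refine h1.congr' ?_
    filter_upwards [hst] with k hk
    rw [hk]

theorem omega_eq_singleton {p : Params} {u : ℝ → E} (hu : IsSphereCurve p.m u) {r : ℝ}
    (hr : 0 < r) {Q : E} (h : Tendsto u atTop (𝓝 Q)) : omega p (r • u 0) = {Q} := by
  rw [omega_smul hu hr]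
  refine Subset.antisymm ?_ (singleton_subset_iff.2
    ⟨fun k => k, tendsto_natCast_atTop_atTop, h.comp tendsto_natCast_atTop_atTop⟩)
  rintro y ⟨t, ht, hy⟩
  exact tendsto_nhds_unique hy (h.comp ht)

theorem omega_nonempty_subset (p : Params) {x : E} (hx : x ∈ octant \ {0}) :
    (omega p x).Nonempty ∧ omega p x ⊆ sphere := by
  obtain ⟨u, hu, hr, hxu, -⟩ := exists_polar p.m hx
  rw [hxu, omega_smul hu hr]
  constructor
  · obtain ⟨y, -, φ, hφ, hy⟩ := isCompact_sphere.tendsto_subseq (x := fun n : ℕ => u n)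
      fun n => hu.mem n
    exact ⟨y, fun k => φ k, tendsto_natCast_atTop_atTop.comp hφ.tendsto_atTop, hy⟩
  · rintro y ⟨t, ht, hy⟩
    exact isCompact_sphere.isClosed.mem_of_tendsto hy (Eventually.of_forall fun k => hu.mem _)

theorem sphereIsGlobalAttractor (p : Params) : SphereIsGlobalAttractor p := by
  refine ⟨isCompact_sphere, fun x hx => ?_, fun K hK hK0 ε hε => ?_⟩
  · obtain ⟨γ, hγ, h0⟩ := exists_isSphereCurve p.m hx
    exact ⟨γ, (isSphereCurve_iff.1 hγ).1, h0, hγ.mem⟩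
  · rcases K.eq_empty_or_nonempty with rfl | hne
    · exact ⟨0, le_rfl, fun γ _ h => h.elim⟩
    obtain ⟨a, haK, ha⟩ := hK.exists_isMinOn hne continuous_norm.continuousOn
    obtain ⟨b, hbK, hb⟩ := hK.exists_isMaxOn hne continuous_norm.continuousOn
    have ha0 : 0 < ‖a‖ := norm_pos_iff.2 (hK0 haK).2
    -- A bound for `|radius - 1|` that is uniform over the norms between `‖a‖` and `‖b‖`.
    have hlim : Tendsto (fun t => (‖b‖ ^ 2 + 1) / logisticDen p.α ‖a‖ t) atTop (𝓝 0) :=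
      (tendsto_logisticDen p.α_pos ha0).const_div_atTop _
    obtain ⟨T, hT⟩ := eventually_atTop.1 (hlim.eventually_lt_const hε)
    refine ⟨max T 0, le_max_right _ _, fun γ hγ hγK t ht => ?_⟩
    have ht0 : 0 ≤ t := (le_max_right _ _).trans ht
    obtain ⟨u, hu, hr, hxu, -⟩ := exists_polar p.m (hK0 hγK)
    have heq := hγ.eqOn (hu.isForwardSolution hr) (by rw [forwardSolution_zero, ← hxu]) ht0
    have h1 : ‖a‖ ≤ ‖γ 0‖ := ha hγK
    have h2 : ‖γ 0‖ ≤ ‖b‖ := hb hγK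
    refine lt_of_le_of_lt ?_ (hT t ((le_max_left _ _).trans ht))
    refine (Metric.infDist_le_dist_of_mem (hu.mem (sphereTime p.α ‖γ 0‖ t))).trans ?_
    rw [heq, dist_eq_norm]
    have h3 : radius p.α ‖γ 0‖ t • u (sphereTime p.α ‖γ 0‖ t) - u (sphereTime p.α ‖γ 0‖ t) =
      (radius p.α ‖γ 0‖ t - 1) • u (sphereTime p.α ‖γ 0‖ t) := by rw [sub_smul, one_smul]
    have h4 := (mem_sphere_iff.1 (hu.mem (sphereTime p.α ‖γ 0‖ t))).2
    simp only [h3, norm_smul, h4, mul_one]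
    refine (abs_radius_sub_one_le p.α_pos hr ht0).trans ?_
    have h5 : 1 ≤ Real.exp (2 * p.α * t) := Real.one_le_exp (by have := p.α_pos; positivity)
    have h6 := logisticDen_pos (r := ‖a‖) p.α_pos ht0
    refine div_le_div₀ (by positivity) ?_ h6 ?_
    · rw [abs_le]
      constructor <;> nlinarith [norm_nonneg b, sq_nonneg ‖γ 0‖]
    · simp only [logisticDen]
      have : ‖a‖ ^ 2 ≤ ‖γ 0‖ ^ 2 := by gcongr
      nlinarith

/-! ### Limits of solutions on the sphere -/

theorem sq_nonneg' (x : E) (i : Fin 3) : 0 ≤ sq x i := _root_.sq_nonneg _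

theorem sum_sq {x : E} (hx : x ∈ sphere) : sq x 0 + sq x 1 + sq x 2 = 1 := hx.2

theorem sq_le_one {x : E} (hx : x ∈ sphere) (i : Fin 3) : sq x i ≤ 1 := by
  have := sum_sq hx
  have h0 := sq_nonneg' x 0
  have h1 := sq_nonneg' x 1
  have h2 := sq_nonneg' x 2
  fin_cases i <;> simp <;> linarith

theorem sq_inj {x y : E} (hx : x ∈ octant) (hy : y ∈ octant) (h : ∀ i, sq x i = sq y i) :
    x = y := by
  ext i
  exact (pow_left_inj₀ (hx i) (hy i) two_ne_zero).1 (h i)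

theorem sq_pos_iff {x : E} (hx : x ∈ octant) (i : Fin 3) : 0 < sq x i ↔ 0 < x i :=
  ⟨fun h => (hx i).lt_of_ne fun h' => by simp [sq, ← h'] at h, fun h => pow_pos h 2⟩

theorem sq_eq_zero_iff' {x : E} {i : Fin 3} : sq x i = 0 ↔ x i = 0 := by simp [sq]

theorem continuous_sq (i : Fin 3) : Continuous fun x : E => sq x i := by
  simp only [sq]; fun_prop

/-- The point of the octant with given squares of the coordinates. -/
def ofSq (y : Fin 3 → ℝ) : E := WithLp.toLp 2 fun i => √(y i)

theorem sq_ofSq {y : Fin 3 → ℝ} (hy : ∀ i, 0 ≤ y i) (i : Fin 3) : sq (ofSq y) i = y i := by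
  simp [sq, ofSq, Real.sq_sqrt (hy i)]

theorem ofSq_mem_octant (y : Fin 3 → ℝ) : ofSq y ∈ octant := fun _ => Real.sqrt_nonneg _

theorem ofSq_mem_sphere {y : Fin 3 → ℝ} (hy : ∀ i, 0 ≤ y i) (h : y 0 + y 1 + y 2 = 1) :
    ofSq y ∈ sphere := by
  refine ⟨ofSq_mem_octant y, ?_⟩
  have := sq_ofSq hy
  simp only [sq] at this
  rw [this, this, this, h]

theorem e_apply (i j : Fin 3) : e i j = if j = i then 1 else 0 := by
  simp [e]

theorem sq_e (i j : Fin 3) : sq (e i) j = if j = i then 1 else 0 := by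
  rw [sq, e_apply]; split_ifs <;> simp

theorem e_mem_sphere (i : Fin 3) : e i ∈ sphere := by
  refine ⟨fun j => by rw [e_apply]; split_ifs <;> simp, ?_⟩
  fin_cases i <;> simp [e_apply]

theorem eq_e_of_sq {x : E} (hx : x ∈ sphere) {i : Fin 3} (h : sq x i = 1) : x = e i := by
  refine sq_inj hx.1 (e_mem_sphere i).1 fun j => ?_
  have := sum_sq hx
  have h0 := sq_nonneg' x 0
  have h1 := sq_nonneg' x 1
  have h2 := sq_nonneg' x 2
  rw [sq_e]
  fin_cases i <;> fin_cases j <;> simp at h ⊢ <;> linarith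

theorem e_injective : Function.Injective e := by
  intro i j h
  have := congrArg (fun x : E => x i) h
  simp only [e_apply] at this
  by_contra hij
  simp [hij] at this

theorem tendsto_of_sq {ι : Type*} {l : Filter ι} {γ : ι → E} (hγ : ∀ t, γ t ∈ octant) {Q : E}
    (hQ : Q ∈ octant) (h : ∀ i, Tendsto (fun t => sq (γ t) i) l (𝓝 (sq Q i))) :
    Tendsto γ l (𝓝 Q) := by
  have h1 : ∀ i, Tendsto (fun t => γ t i) l (𝓝 (Q i)) := fun i => by
    have := (Real.continuous_sqrt.tendsto _).comp (h i)
    simp only [sq, Function.comp_def, Real.sqrt_sq (hQ i)] at this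
    exact this.congr fun t => Real.sqrt_sq (hγ t i)
  have h2 : Tendsto (fun t => WithLp.ofLp (γ t)) l (𝓝 (WithLp.ofLp Q)) := tendsto_pi_nhds.2 h1
  exact (PiLp.continuous_toLp 2 (fun _ : Fin 3 => ℝ)).continuousAt.tendsto.comp h2

/-- If `W` converges along a curve in the sphere, some limit point of the curve is a zero of the
derivative `D` of `W` along the curve. -/
theorem exists_limitPoint {γ : ℝ → E} (hγ : ∀ t, γ t ∈ sphere) {W D : E → ℝ} (hWc : Continuous W)
    (hDc : Continuous D) (hd : ∀ t, HasDerivAt (fun s => W (γ s)) (D (γ t)) t) {L : ℝ}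
    (hL : Tendsto (fun t => W (γ t)) atTop (𝓝 L)) :
    ∃ y ∈ sphere, ∃ ξ : ℕ → ℝ, Tendsto ξ atTop atTop ∧ Tendsto (fun k => γ (ξ k)) atTop (𝓝 y) ∧
      D y = 0 ∧ W y = L := by
  -- The mean value theorem gives times at which `D` is the increment of `W`, which tends to `0`.
  have hmv : ∀ n : ℕ, ∃ c ∈ Ioo (n : ℝ) (n + 1),
      D (γ c) = (W (γ (n + 1)) - W (γ n)) / ((n : ℝ) + 1 - n) := fun n =>
    exists_hasDerivAt_eq_slope (fun t => W (γ t)) (fun t => D (γ t)) (by linarith)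
      (fun t _ => (hd t).continuousAt.continuousWithinAt) fun t _ => hd t
  choose c hc hcD using hmv
  have hct : Tendsto c atTop atTop :=
    tendsto_atTop_mono (fun n => (hc n).1.le) tendsto_natCast_atTop_atTop
  obtain ⟨y, hy, φ, hφ, hyl⟩ := isCompact_sphere.tendsto_subseq (x := fun n => γ (c n))
    fun n => hγ _
  refine ⟨y, hy, fun k => c (φ k), hct.comp hφ.tendsto_atTop, hyl, ?_, ?_⟩
  · have h1 : Tendsto (fun n : ℕ => D (γ (c n))) atTop (𝓝 0) := by
      have h2 : Tendsto (fun n : ℕ => W (γ ((n : ℝ) + 1)) - W (γ n)) atTop (𝓝 (L - L)) :=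
        (hL.comp (tendsto_atTop_add_const_right _ _ tendsto_natCast_atTop_atTop)).sub
          (hL.comp tendsto_natCast_atTop_atTop)
      rw [sub_self] at h2
      refine h2.congr fun n => ?_
      rw [hcD]; simp
    exact tendsto_nhds_unique ((hDc.tendsto y).comp hyl) (h1.comp hφ.tendsto_atTop)
  · exact tendsto_nhds_unique ((hWc.tendsto y).comp hyl) (hL.comp (hct.comp hφ.tendsto_atTop))

/-- `x` is an equilibrium of the flow on the sphere. -/
def IsEq (m : Fin 3 → ℝ) (x : E) : Prop := ∀ i, sq x i * rate m (sq x) i = 0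

theorem isEq_iff_field {p : Params} {x : E} (hx : x ∈ sphere) : IsEq p.m x ↔ field p x = 0 := by
  have : field p x = 0 ↔ ∀ i, field p x i = 0 := by
    constructor
    · intro h i; rw [h]; rfl
    · intro h; ext i; exact h i
  rw [this]
  refine forall_congr' fun i => ?_
  rw [field_apply, (mem_sphere_iff.1 hx).2]
  simp [sq_eq_zero_iff']

theorem isEq_e (m : Fin 3 → ℝ) (i : Fin 3) : IsEq m (e i) := by
  intro j
  fin_cases i <;> fin_cases j <;> simp [sq_e, rate]

theorem isEq_neg {m : Fin 3 → ℝ} {x : E} : IsEq (fun i => -m i) x ↔ IsEq m x := by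
  refine forall_congr' fun i => ?_
  have : rate (fun i => -m i) (sq x) i = - rate m (sq x) i := by
    fin_cases i <;> simp [rate] <;> ring
  rw [this, mul_neg, neg_eq_zero]

/-- `f` is monotone or antitone. -/
def MonoOrAnti (f : ℝ → ℝ) : Prop := Monotone f ∨ Antitone f

namespace IsSphereCurve

variable {m : Fin 3 → ℝ} {γ : ℝ → E}

theorem hasDerivAt_sq (hγ : IsSphereCurve m γ) (t : ℝ) (i : Fin 3) :
    HasDerivAt (fun s => sq (γ s) i) (2 * (sq (γ t) i * rate m (sq (γ t)) i)) t := by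
  refine ((hγ.deriv t i).pow 2).congr_deriv ?_
  simp only [sq]; push_cast; ring

theorem sq_pos_iff_sq_pos (hγ : IsSphereCurve m γ) (s t : ℝ) (i : Fin 3) :
    0 < sq (γ t) i ↔ 0 < sq (γ s) i := by
  obtain ⟨I, -, -, h⟩ := hγ.exists_integrals
  rw [h t, h s]
  simp [Real.exp_pos]

theorem sq_pos (hγ : IsSphereCurve m γ) {s : ℝ} {i : Fin 3} (h : 0 < sq (γ s) i) (t : ℝ) :
    0 < sq (γ t) i := (hγ.sq_pos_iff_sq_pos s t i).2 h

theorem sq_zero (hγ : IsSphereCurve m γ) {s : ℝ} {i : Fin 3} (h : sq (γ s) i = 0) (t : ℝ) :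
    sq (γ t) i = 0 := by
  have := hγ.sq_pos_iff_sq_pos s t i
  rw [h, lt_self_iff_false, iff_false, not_lt] at this
  exact le_antisymm this (sq_nonneg' _ _)

theorem isEq_of_tendsto_atTop (hγ : IsSphereCurve m γ) {Q : E} (hQ : Tendsto γ atTop (𝓝 Q)) :
    Q ∈ sphere ∧ IsEq m Q := by
  refine ⟨isCompact_sphere.isClosed.mem_of_tendsto hQ (Eventually.of_forall hγ.mem), fun i => ?_⟩
  obtain ⟨y, -, ξ, hξ, hy, hD, -⟩ := exists_limitPoint hγ.mem (continuous_sq i)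
    (((continuous_sq i).mul (continuous_rate m i)).const_mul 2) (fun t => hγ.hasDerivAt_sq t i)
    (((continuous_sq i).tendsto Q).comp hQ)
  rw [tendsto_nhds_unique (hQ.comp hξ) hy]
  simpa using hD

theorem isEq_of_tendsto_atBot (hγ : IsSphereCurve m γ) {Q : E} (hQ : Tendsto γ atBot (𝓝 Q)) :
    Q ∈ sphere ∧ IsEq m Q := by
  have := hγ.reverse.isEq_of_tendsto_atTop (hQ.comp tendsto_neg_atTop_atBot)
  rwa [isEq_neg] at this

theorem of_isEq {x : E} (hx : x ∈ sphere) (h : IsEq m x) : IsSphereCurve m fun _ => x := by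
  refine ⟨fun _ => hx, fun t i => ?_⟩
  have : x i * rate m (sq x) i = 0 := by simpa [sq_eq_zero_iff'] using h i
  rw [this]; exact hasDerivAt_const _ _

theorem eq_const (hγ : IsSphereCurve m γ) {s : ℝ} (h : IsEq m (γ s)) (t : ℝ) : γ t = γ s :=
  congrFun (hγ.eq_of_eq (of_isEq (hγ.mem s) h) (s := s) rfl) t

theorem isEq_of_const (hγ : IsSphereCurve m γ) (h : ∀ t, γ t = γ 0) : IsEq m (γ 0) :=
  (hγ.isEq_of_tendsto_atTop (tendsto_const_nhds.congr fun t => (h t).symm)).2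

theorem not_isEq (hγ : IsSphereCurve m γ) {s : ℝ} (h : ¬ IsEq m (γ s)) (t : ℝ) :
    ¬ IsEq m (γ t) := fun ht => h (by rwa [hγ.eq_const ht s])

/-- If two of the squared coordinates are monotone, then the solution converges in both time
directions. -/
theorem exists_tendsto (hγ : IsSphereCurve m γ) {i j : Fin 3} (hij : i ≠ j)
    (hi : MonoOrAnti fun t => sq (γ t) i) (hj : MonoOrAnti fun t => sq (γ t) j) :
    ∃ P Q : E, (P ∈ sphere ∧ IsEq m P ∧ Tendsto γ atBot (𝓝 P)) ∧
      (Q ∈ sphere ∧ IsEq m Q ∧ Tendsto γ atTop (𝓝 Q)) := by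
  have hb : ∀ i, BddAbove (range fun t => sq (γ t) i) := fun i =>
    ⟨1, by rintro _ ⟨t, rfl⟩; exact sq_le_one (hγ.mem t) i⟩
  have hb' : ∀ i, BddBelow (range fun t => sq (γ t) i) := fun i =>
    ⟨0, by rintro _ ⟨t, rfl⟩; exact sq_nonneg' _ i⟩
  have hT : ∀ i, MonoOrAnti (fun t => sq (γ t) i) →
      ∃ L, Tendsto (fun t => sq (γ t) i) atTop (𝓝 L) := by
    rintro i (h | h)
    · exact ⟨_, tendsto_atTop_ciSup h (hb i)⟩
    · exact ⟨_, tendsto_atTop_ciInf h (hb' i)⟩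
  have hB : ∀ i, MonoOrAnti (fun t => sq (γ t) i) →
      ∃ L, Tendsto (fun t => sq (γ t) i) atBot (𝓝 L) := by
    rintro i (h | h)
    · exact ⟨_, tendsto_atBot_ciInf h (hb' i)⟩
    · exact ⟨_, tendsto_atBot_ciSup h (hb i)⟩
  have key : ∀ l : Filter ℝ, l.NeBot → (∃ L, Tendsto (fun t => sq (γ t) i) l (𝓝 L)) →
      (∃ L, Tendsto (fun t => sq (γ t) j) l (𝓝 L)) → ∃ Q, Tendsto γ l (𝓝 Q) := by
    rintro l hl ⟨A, hA⟩ ⟨B, hB⟩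
    have h3 : ∀ k, ∃ L, Tendsto (fun t => sq (γ t) k) l (𝓝 L) := by
      intro k
      by_cases hki : k = i
      · exact ⟨A, hki ▸ hA⟩
      by_cases hkj : k = j
      · exact ⟨B, hkj ▸ hB⟩
      refine ⟨1 - A - B, ((tendsto_const_nhds.sub hA).sub hB).congr fun t => ?_⟩
      have := sum_sq (hγ.mem t)
      clear hA hB
      fin_cases i <;> fin_cases j <;> fin_cases k <;> simp at hij hki hkj ⊢ <;> linarith
    choose L hL using h3
    have hL0 : ∀ k, 0 ≤ L k := fun k =>
      ge_of_tendsto (hL k) (Eventually.of_forall fun t => sq_nonneg' _ _)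
    exact ⟨ofSq L, tendsto_of_sq (fun t => (hγ.mem t).1) (ofSq_mem_octant L)
      fun k => by rw [sq_ofSq hL0]; exact hL k⟩
  obtain ⟨P, hP⟩ := key atBot inferInstance (hB i hi) (hB j hj)
  obtain ⟨Q, hQ⟩ := key atTop inferInstance (hT i hi) (hT j hj)
  have h1 := hγ.isEq_of_tendsto_atBot hP
  have h2 := hγ.isEq_of_tendsto_atTop hQ
  exact ⟨P, Q, ⟨h1.1, h1.2, hP⟩, h2.1, h2.2, hQ⟩

theorem monotone_of_nonneg (hγ : IsSphereCurve m γ) {i : Fin 3}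
    (h : ∀ t, 0 ≤ rate m (sq (γ t)) i) : Monotone fun t => sq (γ t) i :=
  monotone_of_hasDerivAt_nonneg (fun t => hγ.hasDerivAt_sq t i)
    fun t => mul_nonneg zero_le_two (mul_nonneg (sq_nonneg' _ _) (h t))

theorem antitone_of_nonpos (hγ : IsSphereCurve m γ) {i : Fin 3}
    (h : ∀ t, rate m (sq (γ t)) i ≤ 0) : Antitone fun t => sq (γ t) i :=
  antitone_of_hasDerivAt_nonpos (fun t => hγ.hasDerivAt_sq t i)
    fun t => mul_nonpos_of_nonneg_of_nonpos zero_le_two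
      (mul_nonpos_of_nonneg_of_nonpos (sq_nonneg' _ _) (h t))

theorem strictMono_of_pos (hγ : IsSphereCurve m γ) {i : Fin 3} (h0 : 0 < sq (γ 0) i)
    (h : ∀ t, 0 < rate m (sq (γ t)) i) : StrictMono fun t => sq (γ t) i :=
  strictMono_of_hasDerivAt_pos (fun t => hγ.hasDerivAt_sq t i)
    fun t => mul_pos two_pos (mul_pos (hγ.sq_pos h0 t) (h t))

end IsSphereCurve

theorem tendsto_sq {ι : Type*} {l : Filter ι} {γ : ι → E} {Q : E} (h : Tendsto γ l (𝓝 Q))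
    (i : Fin 3) : Tendsto (fun t => sq (γ t) i) l (𝓝 (sq Q i)) :=
  ((continuous_sq i).tendsto Q).comp h

theorem heteroclinic_of_tendsto {p : Params} {γ : ℝ → E} (hγ : IsSphereCurve p.m γ) {P Q : E}
    (hPQ : P ≠ Q) (hP : Tendsto γ atBot (𝓝 P)) (hQ : Tendsto γ atTop (𝓝 Q)) :
    IsHeteroclinicOrbit p (range γ) P Q := by
  have h1 := hγ.isEq_of_tendsto_atBot hP
  have h2 := hγ.isEq_of_tendsto_atTop hQ
  exact ⟨hPQ, (isEq_iff_field h1.1).1 h1.2, (isEq_iff_field h2.1).1 h2.2, γ,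
    (isSphereCurve_iff.1 hγ).1, rfl, hP, hQ⟩

/-! ### The edges of the sphere -/

theorem mem_arc_iff {x : E} {i j k : Fin 3} (hij : i ≠ j) (hik : i ≠ k) (hjk : j ≠ k) :
    x ∈ arc i j ↔ x ∈ sphere ∧ sq x k = 0 := by
  have hx : x ∈ arc i j ↔ x ∈ octant ∧ x i ^ 2 + x j ^ 2 = 1 ∧ ∀ k, k ≠ i → k ≠ j → x k = 0 :=
    Iff.rfl
  have hs : x ∈ sphere ↔ x ∈ octant ∧ x 0 ^ 2 + x 1 ^ 2 + x 2 ^ 2 = 1 := Iff.rfl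
  rw [hx, hs, sq_eq_zero_iff']
  constructor
  · rintro ⟨h, h1, h2⟩
    have h3 := h2 k hik.symm hjk.symm
    refine ⟨⟨h, ?_⟩, h3⟩
    fin_cases i <;> fin_cases j <;> fin_cases k <;> simp at hij hik hjk h1 h3 ⊢ <;> rw [h3] <;>
      linarith
  · rintro ⟨⟨h, h1⟩, h3⟩
    refine ⟨h, ?_, fun l hl hl' => ?_⟩
    · fin_cases i <;> fin_cases j <;> fin_cases k <;> simp at hij hik hjk h3 ⊢ <;>
        rw [h3] at h1 <;> linarith
    · rwa [show l = k by omega]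

theorem mem_openArc_iff {x : E} {i j k : Fin 3} (hij : i ≠ j) (hik : i ≠ k) (hjk : j ≠ k) :
    x ∈ openArc i j ↔ x ∈ sphere ∧ sq x k = 0 ∧ 0 < sq x i ∧ 0 < sq x j := by
  have hx : x ∈ openArc i j ↔ x ∈ arc i j ∧ 0 < x i ∧ 0 < x j := Iff.rfl
  rw [hx, mem_arc_iff hij hik hjk]
  constructor
  · rintro ⟨⟨h, h1⟩, h2, h3⟩
    exact ⟨h, h1, (sq_pos_iff h.1 i).2 h2, (sq_pos_iff h.1 j).2 h3⟩
  · rintro ⟨h, h1, h2, h3⟩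
    exact ⟨⟨h, h1⟩, (sq_pos_iff h.1 i).1 h2, (sq_pos_iff h.1 j).1 h3⟩

theorem sum_sq_edge {x : E} (hx : x ∈ sphere) {i j k : Fin 3} (hij : i ≠ j) (hik : i ≠ k)
    (hjk : j ≠ k) (hk : sq x k = 0) : sq x i + sq x j = 1 := by
  have := sum_sq hx
  fin_cases i <;> fin_cases j <;> fin_cases k <;> simp at hij hik hjk hk ⊢ <;> linarith

/-- If `xᵢ` grows along the edge between `e i` and `e j`, then the open edge is a single orbit from
`e j` to `e i`. -/
theorem IsSphereCurve.edge {m : Fin 3 → ℝ} {γ : ℝ → E} (hγ : IsSphereCurve m γ) {i j k : Fin 3}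
    (hij : i ≠ j) (hik : i ≠ k) (hjk : j ≠ k) {κ : ℝ} (hκ : 0 < κ)
    (hr : ∀ y : Fin 3 → ℝ, y k = 0 → rate m y i = κ * y j) (h0 : γ 0 ∈ openArc i j) :
    StrictMono (fun t => sq (γ t) i) ∧ Tendsto γ atBot (𝓝 (e j)) ∧ Tendsto γ atTop (𝓝 (e i)) ∧
      range γ = openArc i j := by
  rw [mem_openArc_iff hij hik hjk] at h0
  obtain ⟨hs, hk0, hi, hj⟩ := h0
  have hk : ∀ t, sq (γ t) k = 0 := hγ.sq_zero hk0
  have hsum : ∀ t, sq (γ t) i + sq (γ t) j = 1 := fun t => sum_sq_edge (hγ.mem t) hij hik hjk (hk t)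
  have hmono : StrictMono fun t => sq (γ t) i := hγ.strictMono_of_pos hi fun t => by
    rw [hr _ (hk t)]; exact mul_pos hκ (hγ.sq_pos hj t)
  have hanti : Antitone fun t => sq (γ t) j := fun s t hst => by
    have h1 := hmono.monotone hst
    have h2 := hsum s
    have h3 := hsum t
    simp only at h1 ⊢; linarith
  obtain ⟨P, Q, ⟨hPs, hPe, hP⟩, hQs, hQe, hQ⟩ := hγ.exists_tendsto hij (.inl hmono.monotone)
    (.inr hanti)
  have hlim : ∀ l : Filter ℝ, l.NeBot → ∀ Q ∈ sphere, IsEq m Q → Tendsto γ l (𝓝 Q) →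
      Q = e i ∨ Q = e j := by
    intro l hl Q hQs hQe hQ
    have hQk : sq Q k = 0 := tendsto_nhds_unique (tendsto_sq hQ k) (by simp [hk])
    have h1 := sum_sq_edge hQs hij hik hjk hQk
    have h2 := hQe i
    rw [hr _ hQk] at h2
    rcases mul_eq_zero.1 h2 with h | h
    · exact .inr (eq_e_of_sq hQs (by linarith))
    · have : sq Q j = 0 := by simpa [hκ.ne'] using h
      exact .inl (eq_e_of_sq hQs (by linarith))
  have hPi : P = e j := by
    refine (hlim _ inferInstance P hPs hPe hP).resolve_left fun h => ?_
    have h1 := hmono.monotone.le_of_tendsto (tendsto_sq hP i) 0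
    have h2 := hsum 0
    rw [h, sq_e] at h1
    simp at h1; linarith
  have hQi : Q = e i := by
    refine (hlim _ inferInstance Q hQs hQe hQ).resolve_right fun h => ?_
    have h1 := hmono.monotone.ge_of_tendsto (tendsto_sq hQ i) 0
    rw [h, sq_e] at h1
    simp [hij] at h1; linarith
  subst hPi hQi
  refine ⟨hmono, hP, hQ, Subset.antisymm ?_ fun x hx => ?_⟩
  · rintro _ ⟨t, rfl⟩
    exact (mem_openArc_iff hij hik hjk).2 ⟨hγ.mem t, hk t, hγ.sq_pos hi t, hγ.sq_pos hj t⟩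
  · obtain ⟨hx, hxk, hxi, hxj⟩ := (mem_openArc_iff hij hik hjk).1 hx
    have hxs := sum_sq_edge hx hij hik hjk hxk
    have h1 := tendsto_sq hP i
    have h2 := tendsto_sq hQ i
    rw [sq_e] at h1 h2
    simp only [hij, if_false, if_true] at h1 h2
    obtain ⟨s, hs⟩ := (h1.eventually_lt_const hxi).exists
    obtain ⟨t, ht⟩ := (h2.eventually_const_lt (show sq x i < 1 by linarith)).exists
    obtain ⟨r, hr⟩ := mem_range_of_exists_le_of_exists_ge ((continuous_sq i).comp hγ.continuous)
      ⟨s, hs.le⟩ ⟨t, ht.le⟩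
    refine ⟨r, sq_inj (hγ.mem r).1 hx.1 fun l => ?_⟩
    have h3 := hsum r
    have h4 : sq (γ r) i = sq x i := hr
    rcases show l = i ∨ l = j ∨ l = k by omega with rfl | rfl | rfl
    · exact h4
    · linarith
    · rw [hk, hxk]

theorem openArc_nonempty {i j k : Fin 3} (hij : i ≠ j) (hik : i ≠ k) (hjk : j ≠ k) :
    (openArc i j).Nonempty := by
  have h0 : ∀ l, 0 ≤ (fun l => if l = k then (0 : ℝ) else 1 / 2) l := fun l => by
    simp only; split_ifs <;> norm_num
  refine ⟨ofSq fun l => if l = k then 0 else 1 / 2, (mem_openArc_iff hij hik hjk).2 ⟨?_, ?_⟩⟩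
  · refine ofSq_mem_sphere h0 ?_
    fin_cases k <;> simp <;> norm_num
  · simp only [sq_ofSq h0]
    simp [hik, hjk]

theorem heteroclinic_edge {p : Params} {i j k : Fin 3}
    (hij : i ≠ j) (hik : i ≠ k) (hjk : j ≠ k) {κ : ℝ} (hκ : 0 < κ)
    (hr : ∀ y : Fin 3 → ℝ, y k = 0 → rate p.m y i = κ * y j) :
    IsHeteroclinicOrbit p (openArc i j) (e j) (e i) := by
  obtain ⟨x, hx⟩ := openArc_nonempty hij hik hjk
  obtain ⟨γ, hγ, h0⟩ := exists_isSphereCurve p.m ((mem_openArc_iff hij hik hjk).1 hx).1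
  obtain ⟨-, hP, hQ, hR⟩ := hγ.edge hij hik hjk hκ hr (h0 ▸ hx)
  rw [← hR]
  exact heteroclinic_of_tendsto hγ (e_injective.ne hij.symm) hP hQ

theorem openArc_comm (i j : Fin 3) : openArc i j = openArc j i := by
  ext x
  simp only [openArc, arc, mem_ofPred_eq]
  rw [add_comm (x i ^ 2)]
  constructor <;> rintro ⟨⟨h1, h2, h3⟩, h4, h5⟩ <;>
    exact ⟨⟨h1, h2, fun k hk hk' => h3 k hk' hk⟩, h5, h4⟩

/-! ### Linearization at the vertices -/

theorem fderiv_field_e (p : Params) {i j : Fin 3} (hij : i ≠ j) :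
    fderiv ℝ (field p) (e i) (e j) = rate p.m (sq (e i)) j • e j := by
  have hl : HasDerivAt (fun t : ℝ => e i + t • e j) (e j) 0 := by
    simpa using ((hasDerivAt_id (0 : ℝ)).smul_const (e j)).const_add (e i)
  have h1 : HasDerivAt (fun t : ℝ => field p (e i + t • e j))
      (fderiv ℝ (field p) (e i) (e j)) 0 := by
    have hd := ((contDiff_field p).differentiable one_ne_zero (e i + (0 : ℝ) • e j)).hasFDerivAt
    have := hd.comp_hasDerivAt (0 : ℝ) hl
    rwa [zero_smul, add_zero] at this
  refine h1.unique (hasDerivAt_coord.2 fun k => ?_)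
  have hsq : ∀ t : ℝ, ∀ l, sq (e i + t • e j) l = sq (e i) l + t ^ 2 * sq (e j) l := by
    intro t l
    simp only [sq, PiLp.add_apply, PiLp.smul_apply, smul_eq_mul, e_apply]
    by_cases h1 : l = i
    · have : l ≠ j := fun h => hij (h1.symm.trans h)
      simp [h1, hij]
    · simp [h1]
  have hf : ∀ t : ℝ, field p (e i + t • e j) k = (e i k + t * e j k) *
      (rate p.m (sq (e i)) k + t ^ 2 * (rate p.m (sq (e j)) k - p.α)) := by
    intro t
    have hn : ‖e i + t • e j‖ ^ 2 = 1 + t ^ 2 := by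
      have h0 := hsq t
      have hi := sum_sq (e_mem_sphere i)
      have hj := sum_sq (e_mem_sphere j)
      rw [normSq_eq]
      simp only [← show ∀ (x : E) l, sq x l = x l ^ 2 from fun _ _ => rfl]
      rw [h0, h0, h0]
      linear_combination hi + t ^ 2 * hj
    have hr : rate p.m (sq (e i + t • e j)) k =
        rate p.m (sq (e i)) k + t ^ 2 * rate p.m (sq (e j)) k := by
      fin_cases k <;> simp only [rate, hsq] <;> simp <;> ring
    rw [field_apply, hn, hr]
    simp only [PiLp.add_apply, PiLp.smul_apply, smul_eq_mul]; ring
  simp only [hf]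
  have h2 : HasDerivAt (fun t : ℝ => e i k + t * e j k) (e j k) 0 := by
    simpa using ((hasDerivAt_id (0 : ℝ)).mul_const (e j k)).const_add (e i k)
  have h3 : HasDerivAt (fun t : ℝ => rate p.m (sq (e i)) k +
      t ^ 2 * (rate p.m (sq (e j)) k - p.α)) 0 0 := by
    simpa using ((hasDerivAt_pow 2 (0 : ℝ)).mul_const (rate p.m (sq (e j)) k - p.α)).const_add
      (rate p.m (sq (e i)) k)
  refine (h2.mul h3).congr_deriv ?_
  by_cases hkj : k = j
  · subst hkj; simp; ring
  · simp [e_apply, hkj]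

theorem hasTangentEigenvalues_e (p : Params) {i j k : Fin 3} (hij : i ≠ j) (hik : i ≠ k)
    (hjk : j ≠ k) :
    HasTangentEigenvalues p (e i) (rate p.m (sq (e i)) j) (rate p.m (sq (e i)) k) := by
  refine ⟨e_mem_sphere i, (isEq_iff_field (e_mem_sphere i)).1 (isEq_e _ i), ?_⟩
  have horth : ∀ l, i ≠ l → e l ∈ (Submodule.span ℝ {e i})ᗮ := by
    intro l hl
    rw [Submodule.mem_orthogonal_singleton_iff_inner_right, e, EuclideanSpace.inner_single_left]
    simp [e_apply, hl]
  let v : Fin 2 → (Submodule.span ℝ {e i})ᗮ := ![⟨e j, horth j hij⟩, ⟨e k, horth k hik⟩]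
  have hv : LinearIndependent ℝ v := by
    rw [LinearIndependent.pair_iff]
    intro s t hst
    have h1 : s • e j + t • e k = 0 := by simpa using congrArg Subtype.val hst
    have h2 := congrArg (fun x : E => x j) h1
    have h3 := congrArg (fun x : E => x k) h1
    simp [e_apply, hjk, hjk.symm] at h2 h3
    exact ⟨h2, h3⟩
  have hcard : Fintype.card (Fin 2) = Module.finrank ℝ (Submodule.span ℝ {e i})ᗮ := by
    have : Fact (Module.finrank ℝ E = 2 + 1) := ⟨by simp⟩
    rw [Submodule.finrank_orthogonal_span_singleton (n := 2)
      (show e i ≠ 0 from fun h => by simpa [e_apply] using congrArg (fun x : E => x i) h)]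
    simp
  let b := basisOfLinearIndependentOfCardEqFinrank hv hcard
  have hb : ∀ l, b l = v l := fun l => by simp [b]
  have heig : ∀ l (hl : i ≠ l), tangentLinearization p (e i) ⟨e l, horth l hl⟩ =
      rate p.m (sq (e i)) l • (⟨e l, horth l hl⟩ : (Submodule.span ℝ {e i})ᗮ) := by
    intro l hl
    simp only [tangentLinearization, ContinuousLinearMap.coe_coe, ContinuousLinearMap.comp_apply,
      Submodule.subtypeL_apply]
    rw [fderiv_field_e p hl, map_smul]
    congr 1
    exact Submodule.orthogonalProjectionOnto_mem_subspace_eq_self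
      (⟨e l, horth l hl⟩ : (Submodule.span ℝ {e i})ᗮ)
  have hM : LinearMap.toMatrix b b (tangentLinearization p (e i)) =
      Matrix.diagonal ![rate p.m (sq (e i)) j, rate p.m (sq (e i)) k] := by
    have h : ∀ l, tangentLinearization p (e i) (b l) =
        (![rate p.m (sq (e i)) j, rate p.m (sq (e i)) k] l) • b l := by
      intro l
      rw [hb]
      fin_cases l
      · exact heig j hij
      · exact heig k hik
    ext r s
    rw [LinearMap.toMatrix_apply, h]
    simp only [map_smul, Module.Basis.repr_self, Matrix.diagonal_apply, Finsupp.smul_apply]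
    by_cases hrs : r = s
    · subst hrs; simp
    · simp [hrs]
  rw [← LinearMap.charpoly_toMatrix (tangentLinearization p (e i)) b, hM, Matrix.charpoly_diagonal]
  simp [Fin.prod_univ_two]

/-! ### Equilibria -/

theorem equilibria_eq (p : Params) : equilibria p = {0} ∪ {x | x ∈ sphere ∧ IsEq p.m x} := by
  ext x
  constructor
  · rintro ⟨hx, h⟩
    by_cases h0 : x = 0
    · exact .inl h0
    have hn : 0 < ‖x‖ ^ 2 := pow_pos (norm_pos_iff.2 h0) 2
    have h1 : p.α * (1 - ‖x‖ ^ 2) * ‖x‖ ^ 2 = 0 := by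
      have : ∀ i, field p x i = 0 := fun i => by rw [h]; rfl
      simp only [field_apply] at this
      have e0 := this 0
      have e1 := this 1
      have e2 := this 2
      simp only [rate, sq] at e0 e1 e2
      rw [normSq_eq] at e0 e1 e2 ⊢
      simp at e0 e1 e2
      rw [← mul_eq_zero] at e0 e1 e2
      linear_combination x 0 * e0 + x 1 * e1 + x 2 * e2
    have h2 : ‖x‖ ^ 2 = 1 := by
      rcases mul_eq_zero.1 h1 with h | h
      · rcases mul_eq_zero.1 h with h | h
        · exact absurd h p.α_pos.ne'
        · linarith
      · exact absurd h hn.ne'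
    have hs : x ∈ sphere := ⟨hx, by rw [← normSq_eq, h2]⟩
    exact .inr ⟨hs, (isEq_iff_field hs).2 h⟩
  · rintro (rfl | ⟨hs, h⟩)
    · exact ⟨fun _ => le_rfl, field_zero p⟩
    · exact ⟨hs.1, (isEq_iff_field hs).1 h⟩

theorem eq_e_of_zero {x : E} (hx : x ∈ sphere) {i j k : Fin 3} (hij : i ≠ j) (hik : i ≠ k)
    (hjk : j ≠ k) (hj : sq x j = 0) (hk : sq x k = 0) : x = e i :=
  eq_e_of_sq hx (by linarith [sum_sq_edge hx hij hik hjk hk])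

/-- The solution on the sphere through the radial projection of a point determines the
`ω`-limit set of the point. -/
theorem exists_curve_omega (p : Params) {x : E} (hx : x ∈ octant \ {0}) :
    ∃ u, IsSphereCurve p.m u ∧ (∀ i, 0 < sq (u 0) i ↔ 0 < x i) ∧ (x ∈ sphere → u 0 = x) ∧
      ∀ Q, Tendsto u atTop (𝓝 Q) → omega p x = {Q} := by
  obtain ⟨u, hu, hr, hxu, hux⟩ := exists_polar p.m hx
  refine ⟨u, hu, fun i => ?_, fun h => ?_, fun Q hQ => ?_⟩
  · rw [sq_pos_iff (hu.mem 0).1, hux]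
    simp [hr]
  · rw [hux, (mem_sphere_iff.1 h).2, inv_one, one_smul]
  · rw [hxu]; exact omega_eq_singleton hu hr hQ

theorem intOctant_subset : intOctant ⊆ octant \ {0} := fun x hx =>
  ⟨fun i => (hx i).le, fun h => by have := hx 0; rw [h] at this; exact lt_irrefl _ this⟩

theorem sphere_subset : sphere ⊆ octant \ {0} := fun x hx =>
  ⟨hx.1, fun h => by have := (mem_sphere_iff.1 hx).2; rw [h, norm_zero] at this; norm_num at this⟩

theorem mem_intSphere_iff {x : E} : x ∈ intSphere ↔ x ∈ sphere ∧ ∀ i, 0 < sq x i :=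
  and_congr_right fun h => forall_congr' fun i => (sq_pos_iff h.1 i).symm

theorem IsSphereCurve.range_subset_intSphere {m : Fin 3 → ℝ} {γ : ℝ → E} (hγ : IsSphereCurve m γ)
    (h : γ 0 ∈ intSphere) : range γ ⊆ intSphere := by
  rintro _ ⟨t, rfl⟩
  exact mem_intSphere_iff.2 ⟨hγ.mem t, fun i => hγ.sq_pos ((mem_intSphere_iff.1 h).2 i) t⟩

theorem IsSphereCurve.range_subset_sphere {m : Fin 3 → ℝ} {γ : ℝ → E} (hγ : IsSphereCurve m γ) :
    range γ ⊆ sphere := by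
  rintro _ ⟨t, rfl⟩
  exact hγ.mem t

/-! ### The saddle integral -/

/-- The unimodal function `u ↦ (u/w)^w ((1-u)/(1-w))^(1-w)` on `[0, 1]` with maximum `1` at `w`. -/
def bump (w u : ℝ) : ℝ := (u / w) ^ w * ((1 - u) / (1 - w)) ^ (1 - w)

section Bump

variable {w : ℝ}

theorem continuous_bump (h0 : 0 < w) (h1 : w < 1) : Continuous (bump w) := by
  have h2 : 0 ≤ 1 - w := by linarith
  unfold bump
  exact ((continuous_id.div_const w).rpow_const fun _ => .inr h0.le).mul
    (((continuous_const.sub continuous_id).div_const (1 - w)).rpow_const fun _ => .inr h2)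

theorem bump_self (h0 : 0 < w) (h1 : w < 1) : bump w w = 1 := by
  have h2 : 1 - w ≠ 0 := by linarith
  simp [bump, h0.ne', h2]

theorem bump_zero (h0 : 0 < w) : bump w 0 = 0 := by
  simp [bump, Real.zero_rpow h0.ne']

theorem bump_one (h1 : w < 1) : bump w 1 = 0 := by
  have h2 : 1 - w ≠ 0 := by linarith
  simp [bump, Real.zero_rpow h2]

theorem bump_nonneg (h0 : 0 < w) (h1 : w < 1) {u : ℝ} (hu : u ∈ Icc (0 : ℝ) 1) : 0 ≤ bump w u :=
  mul_nonneg (Real.rpow_nonneg (div_nonneg hu.1 h0.le) _)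
    (Real.rpow_nonneg (div_nonneg (by linarith [hu.2]) (by linarith)) _)

theorem bump_pos (h0 : 0 < w) (h1 : w < 1) {u : ℝ} (hu : u ∈ Ioo (0 : ℝ) 1) : 0 < bump w u :=
  mul_pos (Real.rpow_pos_of_pos (div_pos hu.1 h0) _)
    (Real.rpow_pos_of_pos (div_pos (by linarith [hu.2]) (by linarith)) _)

theorem hasDerivAt_bump (h0 : 0 < w) (h1 : w < 1) {u : ℝ} (hu : u ∈ Ioo (0 : ℝ) 1) :
    HasDerivAt (bump w) (bump w u * ((w - u) / (u * (1 - u)))) u := by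
  have h2 : 0 < 1 - w := by linarith
  have hu0 := hu.1
  have hu1 : 0 < 1 - u := by linarith [hu.2]
  have hA : HasDerivAt (fun u => (u / w) ^ w) (1 / w * w * (u / w) ^ (w - 1)) u :=
    ((hasDerivAt_id u).div_const w).rpow_const (.inl (div_pos hu0 h0).ne')
  have hB : HasDerivAt (fun u => ((1 - u) / (1 - w)) ^ (1 - w))
      (-1 / (1 - w) * (1 - w) * ((1 - u) / (1 - w)) ^ (1 - w - 1)) u :=
    (((hasDerivAt_id u).const_sub 1).div_const (1 - w)).rpow_const (.inl (div_pos hu1 h2).ne')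
  refine (hA.mul hB).congr_deriv ?_
  rw [Real.rpow_sub_one (div_pos hu0 h0).ne', Real.rpow_sub_one (div_pos hu1 h2).ne', bump]
  field_simp
  ring

theorem strictMonoOn_bump (h0 : 0 < w) (h1 : w < 1) : StrictMonoOn (bump w) (Icc 0 w) := by
  refine strictMonoOn_of_deriv_pos (convex_Icc _ _) (continuous_bump h0 h1).continuousOn ?_
  rw [interior_Icc]
  intro u hu
  have hu' : u ∈ Ioo (0 : ℝ) 1 := ⟨hu.1, hu.2.trans h1⟩
  rw [(hasDerivAt_bump h0 h1 hu').deriv]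
  exact mul_pos (bump_pos h0 h1 hu') (div_pos (by linarith [hu.2])
    (mul_pos hu'.1 (by linarith [hu'.2])))

theorem strictAntiOn_bump (h0 : 0 < w) (h1 : w < 1) : StrictAntiOn (bump w) (Icc w 1) := by
  refine strictAntiOn_of_deriv_neg (convex_Icc _ _) (continuous_bump h0 h1).continuousOn ?_
  rw [interior_Icc]
  intro u hu
  have hu' : u ∈ Ioo (0 : ℝ) 1 := ⟨h0.trans hu.1, hu.2⟩
  rw [(hasDerivAt_bump h0 h1 hu').deriv]
  exact mul_neg_of_pos_of_neg (bump_pos h0 h1 hu') (div_neg_of_neg_of_pos (by linarith [hu.1])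
    (mul_pos hu'.1 (by linarith [hu'.2])))

theorem bump_le_one (h0 : 0 < w) (h1 : w < 1) {u : ℝ} (hu : u ∈ Icc (0 : ℝ) 1) :
    bump w u ≤ 1 := by
  rw [← bump_self h0 h1]
  rcases le_total u w with h | h
  · exact (strictMonoOn_bump h0 h1).monotoneOn ⟨hu.1, h⟩ ⟨h0.le, le_rfl⟩ h
  · exact (strictAntiOn_bump h0 h1).antitoneOn ⟨le_rfl, h1.le⟩ ⟨h, hu.2⟩ h

/-- Two points at the same level of the unimodal function lie on both sides of its maximum. -/
theorem lt_of_bump_eq (h0 : 0 < w) (h1 : w < 1) {u v : ℝ} (hu : 0 ≤ u) (hv : v ≤ 1) (huv : u < v)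
    (h : bump w u = bump w v) : u < w ∧ w < v := by
  constructor
  · by_contra! hw
    exact ((strictAntiOn_bump h0 h1) ⟨hw, (huv.trans_le hv).le⟩ ⟨hw.trans huv.le, hv⟩ huv).ne' h
  · by_contra! hw
    exact ((strictMonoOn_bump h0 h1) ⟨hu, huv.le.trans hw⟩ ⟨hu.trans huv.le, hw⟩ huv).ne h

end Bump

/-- The position of the maximum of the saddle integral on the edge of equilibria, in the case
`m 0 = 0`, `0 < m 1`, `0 < m 2`. -/
def saddleWeight (m : Fin 3 → ℝ) : ℝ := m 2 / (m 1 + m 2)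

/-- The first integral in the case `m 0 = 0`, `0 < m 1`, `0 < m 2`. -/
def saddleLevel (m y : Fin 3 → ℝ) : ℝ :=
  (y 0 / saddleWeight m) ^ saddleWeight m * (y 1 / (1 - saddleWeight m)) ^ (1 - saddleWeight m)

section Saddle

variable {m : Fin 3 → ℝ}

theorem saddleWeight_pos (h1 : 0 < m 1) (h2 : 0 < m 2) : 0 < saddleWeight m :=
  div_pos h2 (add_pos h1 h2)

theorem saddleWeight_lt_one (h1 : 0 < m 1) (h2 : 0 < m 2) : saddleWeight m < 1 := by
  rw [saddleWeight, div_lt_one (add_pos h1 h2)]; linarith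

theorem saddleLevel_eq_mul_bump {y : Fin 3 → ℝ} (h1 : 0 < m 1) (h2 : 0 < m 2) {s u : ℝ}
    (hs : 0 ≤ s) (hu : u ∈ Icc (0 : ℝ) 1) (hy0 : y 0 = s * u) (hy1 : y 1 = s * (1 - u)) :
    saddleLevel m y = s * bump (saddleWeight m) u := by
  have hw := saddleWeight_pos h1 h2
  have hw' := saddleWeight_lt_one h1 h2
  rw [saddleLevel, bump, hy0, hy1, mul_div_assoc, mul_div_assoc,
    Real.mul_rpow hs (div_nonneg hu.1 hw.le),
    Real.mul_rpow hs (div_nonneg (by linarith [hu.2]) (by linarith))]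
  have : s ^ saddleWeight m * s ^ (1 - saddleWeight m) = s := by
    rw [← Real.rpow_add_of_nonneg hs hw.le (by linarith)]; simp
  linear_combination (u / saddleWeight m) ^ saddleWeight m *
    ((1 - u) / (1 - saddleWeight m)) ^ (1 - saddleWeight m) * this

theorem continuous_saddleLevel (h1 : 0 < m 1) (h2 : 0 < m 2) :
    Continuous fun x : E => saddleLevel m (sq x) := by
  have hw := saddleWeight_pos h1 h2
  have hw' := saddleWeight_lt_one h1 h2
  exact (((continuous_sq 0).div_const _).rpow_const fun _ => .inr hw.le).mul
    (((continuous_sq 1).div_const _).rpow_const fun _ => .inr (by linarith))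

theorem IsSphereCurve.saddleLevel_eq {γ : ℝ → E} (hγ : IsSphereCurve m γ) (h0 : m 0 = 0)
    (h1 : 0 < m 1) (h2 : 0 < m 2) (t : ℝ) :
    saddleLevel m (sq (γ t)) = saddleLevel m (sq (γ 0)) := by
  obtain ⟨I, -, -, h⟩ := hγ.exists_integrals
  have hw := saddleWeight_pos h1 h2
  have hw' : 0 < 1 - saddleWeight m := by linarith [saddleWeight_lt_one h1 h2]
  have e0 : rate m (I t) 0 = m 1 * I t 2 := by simp [rate, h0]
  have e1 : rate m (I t) 1 = -(m 2 * I t 2) := by simp [rate, h0]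
  rw [saddleLevel, h t 0, h t 1, e0, e1, mul_div_right_comm, mul_div_right_comm,
    Real.mul_rpow (div_nonneg (sq_nonneg' _ _) hw.le) (Real.exp_pos _).le,
    Real.mul_rpow (div_nonneg (sq_nonneg' _ _) hw'.le) (Real.exp_pos _).le, ← Real.exp_mul,
    ← Real.exp_mul, mul_mul_mul_comm, ← Real.exp_add]
  have : 2 * (m 1 * I t 2) * saddleWeight m + 2 * -(m 2 * I t 2) * (1 - saddleWeight m) = 0 := by
    have : m 1 + m 2 ≠ 0 := by positivity
    rw [saddleWeight]; field_simp; ring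
  rw [this, Real.exp_zero, mul_one, saddleLevel]

end Saddle

/-! ### Limits of the solutions when there is no inner equilibrium -/

section Cases

variable {m : Fin 3 → ℝ} {γ : ℝ → E}

theorem isEq_iff_node (h0 : m 0 < 0) (h1 : 0 < m 1) (h2 : m 2 < 0) {x : E} (hx : x ∈ sphere) :
    IsEq m x ↔ ∃ i, x = e i := by
  refine ⟨fun h => ?_, by rintro ⟨i, rfl⟩; exact isEq_e m i⟩
  have y0 := sq_nonneg' x 0
  have y1 := sq_nonneg' x 1
  have y2 := sq_nonneg' x 2
  have e0 := h 0
  have e2 := h 2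
  simp only [rate] at e0 e2
  simp at e0 e2
  have a0 : sq x 0 = 0 ∨ (sq x 1 = 0 ∧ sq x 2 = 0) := by
    rcases e0 with e0 | e0
    · exact .inl e0
    · right; constructor <;> nlinarith
  rcases a0 with a0 | ⟨a1, a2⟩
  · rcases e2 with e2 | e2
    · exact ⟨1, eq_e_of_zero hx (by decide) (by decide) (by decide) a0 e2⟩
    · rw [a0] at e2
      have : sq x 1 = 0 := by nlinarith
      exact ⟨2, eq_e_of_zero hx (by decide) (by decide) (by decide) a0 this⟩
  · exact ⟨0, eq_e_of_zero hx (by decide) (by decide) (by decide) a1 a2⟩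

/-- With signs `(-, +, -)` all solutions go from one vertex to another. -/
theorem IsSphereCurve.node_limits (hγ : IsSphereCurve m γ) (h0 : m 0 < 0) (h1 : 0 < m 1)
    (h2 : m 2 < 0) : (∃ i, Tendsto γ atBot (𝓝 (e i))) ∧ (∃ i, Tendsto γ atTop (𝓝 (e i))) ∧
      (0 < sq (γ 0) 0 → Tendsto γ atTop (𝓝 (e 0))) ∧
      (0 < sq (γ 0) 2 → Tendsto γ atBot (𝓝 (e 2))) := by
  have m0 : Monotone fun t => sq (γ t) 0 := hγ.monotone_of_nonneg fun t => by
    have := sq_nonneg' (γ t) 1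
    have := sq_nonneg' (γ t) 2
    simp [rate]; nlinarith
  have m2 : Antitone fun t => sq (γ t) 2 := hγ.antitone_of_nonpos fun t => by
    have := sq_nonneg' (γ t) 0
    have := sq_nonneg' (γ t) 1
    simp [rate]; nlinarith
  obtain ⟨P, Q, ⟨hPs, hPe, hP⟩, hQs, hQe, hQ⟩ := hγ.exists_tendsto (show (0 : Fin 3) ≠ 2 by decide)
    (.inl m0) (.inr m2)
  obtain ⟨i, rfl⟩ := (isEq_iff_node h0 h1 h2 hPs).1 hPe
  obtain ⟨j, rfl⟩ := (isEq_iff_node h0 h1 h2 hQs).1 hQe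
  refine ⟨⟨i, hP⟩, ⟨j, hQ⟩, fun h => ?_, fun h => ?_⟩
  · have := m0.ge_of_tendsto (tendsto_sq hQ 0) 0
    rw [sq_e] at this
    split_ifs at this with hj
    · exact hj ▸ hQ
    · linarith
  · have := m2.ge_of_tendsto (tendsto_sq hP 2) 0
    rw [sq_e] at this
    split_ifs at this with hj
    · exact hj ▸ hP
    · linarith

theorem isEq_iff_saddle (h0 : m 0 = 0) (h1 : 0 < m 1) (h2 : 0 < m 2) {x : E} (hx : x ∈ sphere) :
    IsEq m x ↔ x = e 2 ∨ x ∈ arc 0 1 := by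
  rw [mem_arc_iff (k := 2) (by decide) (by decide) (by decide)]
  constructor
  · intro h
    have e0 := h 0
    have e1 := h 1
    simp [rate, h0, h1.ne', h2.ne'] at e0 e1
    by_cases a2 : sq x 2 = 0
    · exact .inr ⟨hx, a2⟩
    · exact .inl (eq_e_of_zero hx (by decide) (by decide) (by decide) (e0.resolve_right a2)
        (e1.resolve_right a2))
  · rintro (rfl | ⟨-, h⟩)
    · exact isEq_e m 2
    · intro i
      fin_cases i <;> simp [rate, h0, h]

theorem IsSphereCurve.saddle_mono (hγ : IsSphereCurve m γ) (h0 : m 0 = 0)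
    (h1 : 0 < m 1) (h2 : 0 < m 2) :
    Monotone (fun t => sq (γ t) 0) ∧ Antitone fun t => sq (γ t) 1 :=
  ⟨hγ.monotone_of_nonneg fun t => by
    have := sq_nonneg' (γ t) 2
    simp [rate, h0]; positivity,
  hγ.antitone_of_nonpos fun t => by
    have := sq_nonneg' (γ t) 2
    simp [rate, h0]; positivity⟩

theorem IsSphereCurve.saddle_limits (hγ : IsSphereCurve m γ) (h0 : m 0 = 0)
    (h1 : 0 < m 1) (h2 : 0 < m 2) :
    ∃ P Q : E, (P ∈ sphere ∧ (P = e 2 ∨ P ∈ arc 0 1) ∧ Tendsto γ atBot (𝓝 P)) ∧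
      (Q ∈ sphere ∧ (Q = e 2 ∨ Q ∈ arc 0 1) ∧ Tendsto γ atTop (𝓝 Q)) := by
  obtain ⟨m0, m1⟩ := hγ.saddle_mono h0 h1 h2
  obtain ⟨P, Q, ⟨hPs, hPe, hP⟩, hQs, hQe, hQ⟩ := hγ.exists_tendsto (show (0 : Fin 3) ≠ 1 by decide)
    (.inl m0) (.inr m1)
  exact ⟨P, Q, ⟨hPs, (isEq_iff_saddle h0 h1 h2 hPs).1 hPe, hP⟩, hQs,
    (isEq_iff_saddle h0 h1 h2 hQs).1 hQe, hQ⟩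

/-- The inner solutions connect the two parts of the edge of equilibria. -/
theorem IsSphereCurve.saddle_limits_int (hγ : IsSphereCurve m γ) (h0 : m 0 = 0)
    (h1 : 0 < m 1) (h2 : 0 < m 2) (hi : γ 0 ∈ intSphere) :
    ∃ P Q : E, (P ∈ arc 0 1 ∧ sq P 0 < saddleWeight m ∧ Tendsto γ atBot (𝓝 P)) ∧
      (Q ∈ arc 0 1 ∧ saddleWeight m < sq Q 0 ∧ Tendsto γ atTop (𝓝 Q)) ∧
      0 < sq P 0 ∧ 0 < sq Q 1 := by
  have hi' := (mem_intSphere_iff.1 hi).2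
  obtain ⟨m0, m1⟩ := hγ.saddle_mono h0 h1 h2
  obtain ⟨P, Q, ⟨hPs, hPe, hP⟩, hQs, hQe, hQ⟩ := hγ.saddle_limits h0 h1 h2
  have s0 : StrictMono fun t => sq (γ t) 0 := hγ.strictMono_of_pos (hi' 0) fun t => by
    have := hγ.sq_pos (hi' 2) t
    simp [rate, h0]; positivity
  have hPQ : sq P 0 < sq Q 0 :=
    ((s0.monotone.le_of_tendsto (tendsto_sq hP 0) 0).trans_lt (s0 zero_lt_one)).trans_le
      (s0.monotone.ge_of_tendsto (tendsto_sq hQ 0) 1)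
  have hQa : Q ∈ arc 0 1 := hQe.resolve_left fun h => by
    have := m0.ge_of_tendsto (tendsto_sq hQ 0) 0
    rw [h, sq_e] at this
    simp at this; linarith [hi' 0]
  have hPa : P ∈ arc 0 1 := hPe.resolve_left fun h => by
    have := m1.ge_of_tendsto (tendsto_sq hP 1) 0
    rw [h, sq_e] at this
    simp at this; linarith [hi' 1]
  have hlev : ∀ l : Filter ℝ, l.NeBot → ∀ R ∈ arc 0 1, Tendsto γ l (𝓝 R) →
      bump (saddleWeight m) (sq R 0) = saddleLevel m (sq (γ 0)) := by
    intro l hl R hR hRl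
    obtain ⟨hRs, hR2⟩ := (mem_arc_iff (k := 2) (by decide) (by decide) (by decide)).1 hR
    have e1 := sum_sq hRs
    have := saddleLevel_eq_mul_bump (y := sq R) h1 h2 zero_le_one
      ⟨sq_nonneg' R 0, sq_le_one hRs 0⟩ (by ring) (by linarith)
    rw [one_mul] at this
    rw [← this]
    refine tendsto_nhds_unique (((continuous_saddleLevel h1 h2).tendsto R).comp hRl) ?_
    exact tendsto_const_nhds.congr fun t => (hγ.saddleLevel_eq h0 h1 h2 t).symm
  have hPl := hlev _ inferInstance P hPa hP
  have hQl := hlev _ inferInstance Q hQa hQ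
  have hpos : 0 < saddleLevel m (sq (γ 0)) :=
    mul_pos (Real.rpow_pos_of_pos (div_pos (hi' 0) (saddleWeight_pos h1 h2)) _)
      (Real.rpow_pos_of_pos (div_pos (hi' 1) (by linarith [saddleWeight_lt_one h1 h2])) _)
  -- The two limits lie at the same positive level of the first integral, hence on both sides of
  -- its maximum.
  obtain ⟨hw1, hw2⟩ := lt_of_bump_eq (saddleWeight_pos h1 h2) (saddleWeight_lt_one h1 h2)
    (sq_nonneg' P 0) (sq_le_one hQs 0) hPQ (hPl.trans hQl.symm)
  refine ⟨P, Q, ⟨hPa, hw1, hP⟩, ⟨hQa, hw2, hQ⟩, (sq_nonneg' P 0).lt_of_ne fun h => ?_,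
    (sq_nonneg' Q 1).lt_of_ne fun h => ?_⟩
  · rw [← h, bump_zero (saddleWeight_pos h1 h2)] at hPl
    exact hpos.ne hPl
  · have e1 := sum_sq hQs
    rw [((mem_arc_iff (k := 2) (by decide) (by decide) (by decide)).1 hQa).2, ← h] at e1
    rw [show sq Q 0 = 1 by linarith, bump_one (saddleWeight_lt_one h1 h2)] at hQl
    exact hpos.ne hQl

theorem isEq_iff_star (h0 : 0 < m 0) (h1 : m 1 = 0) (h2 : m 2 < 0) {x : E} (hx : x ∈ sphere) :
    IsEq m x ↔ x = e 1 ∨ x ∈ arc 0 2 := by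
  rw [mem_arc_iff (k := 1) (by decide) (by decide) (by decide)]
  constructor
  · intro h
    have e0 := h 0
    have e2 := h 2
    simp [rate, h1, h0.ne', h2.ne] at e0 e2
    by_cases a1 : sq x 1 = 0
    · exact .inr ⟨hx, a1⟩
    · exact .inl (eq_e_of_zero hx (by decide) (by decide) (by decide) (e0.resolve_right a1)
        (e2.resolve_right a1))
  · rintro (rfl | ⟨-, h⟩)
    · exact isEq_e m 1
    · intro i
      fin_cases i <;> simp [rate, h1, h]

/-- With signs `(+, 0, -)` all solutions outside the edge of equilibria converge to `e 1`, and they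
come from that edge. -/
theorem IsSphereCurve.star_limits (hγ : IsSphereCurve m γ) (h0 : 0 < m 0) (h1 : m 1 = 0)
    (h2 : m 2 < 0) : (∃ Q ∈ {e 1} ∪ arc 0 2, Tendsto γ atTop (𝓝 Q)) ∧
      (0 < sq (γ 0) 1 → Tendsto γ atTop (𝓝 (e 1))) ∧
      (sq (γ 0) 1 < 1 → ∃ P ∈ arc 0 2, Tendsto γ atBot (𝓝 P)) := by
  have m1 : Monotone fun t => sq (γ t) 1 := hγ.monotone_of_nonneg fun t => by
    have := sq_nonneg' (γ t) 0
    have := sq_nonneg' (γ t) 2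
    simp [rate]; nlinarith
  have m0 : Antitone fun t => sq (γ t) 0 := hγ.antitone_of_nonpos fun t => by
    have := sq_nonneg' (γ t) 1
    simp [rate, h1]; positivity
  obtain ⟨P, Q, ⟨hPs, hPe, hP⟩, hQs, hQe, hQ⟩ := hγ.exists_tendsto (show (0 : Fin 3) ≠ 1 by decide)
    (.inr m0) (.inl m1)
  rw [isEq_iff_star h0 h1 h2 hPs] at hPe
  rw [isEq_iff_star h0 h1 h2 hQs] at hQe
  refine ⟨⟨Q, hQe, hQ⟩, fun h => ?_, fun h => ⟨P, hPe.resolve_left fun h' => ?_, hP⟩⟩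
  · suffices Q = e 1 by rwa [this] at hQ
    refine hQe.resolve_right fun h' => ?_
    have := m1.ge_of_tendsto (tendsto_sq hQ 1) 0
    rw [((mem_arc_iff (k := 1) (by decide) (by decide) (by decide)).1 h').2] at this
    linarith
  · have := m1.le_of_tendsto (tendsto_sq hP 1) 0
    rw [h', sq_e] at this
    simp at this; linarith

theorem isEq_iff_strip (h0 : m 0 = 0) (h1 : m 1 = 0) (h2 : m 2 < 0) {x : E} (hx : x ∈ sphere) :
    IsEq m x ↔ x ∈ arc 0 1 ∨ x ∈ arc 0 2 := by
  rw [mem_arc_iff (i := 0) (j := 1) (k := 2) (by decide) (by decide) (by decide),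
    mem_arc_iff (i := 0) (j := 2) (k := 1) (by decide) (by decide) (by decide)]
  constructor
  · intro h
    have e1 := h 1
    simp [rate, h0, h2.ne] at e1
    exact e1.elim (fun h => .inr ⟨hx, h⟩) fun h => .inl ⟨hx, h⟩
  · rintro (⟨-, h⟩ | ⟨-, h⟩) <;> intro i <;> fin_cases i <;> simp [rate, h0, h1, h]

/-- With signs `(0, 0, -)` the first coordinate is constant. -/
theorem IsSphereCurve.strip_limits (hγ : IsSphereCurve m γ) (h0 : m 0 = 0) (h1 : m 1 = 0)
    (h2 : m 2 < 0) : ∃ P Q : E, (P ∈ arc 0 1 ∪ arc 0 2 ∧ Tendsto γ atBot (𝓝 P)) ∧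
      (Q ∈ arc 0 1 ∪ arc 0 2 ∧ Tendsto γ atTop (𝓝 Q)) ∧
      (0 < sq (γ 0) 1 → Q ∈ arc 0 1) ∧ (0 < sq (γ 0) 2 → P ∈ arc 0 2) ∧
      sq P 0 = sq (γ 0) 0 ∧ sq Q 0 = sq (γ 0) 0 := by
  have m1 : Monotone fun t => sq (γ t) 1 := hγ.monotone_of_nonneg fun t => by
    have := sq_nonneg' (γ t) 2
    simp [rate, h0]; nlinarith
  have m2 : Antitone fun t => sq (γ t) 2 := hγ.antitone_of_nonpos fun t => by
    have := sq_nonneg' (γ t) 1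
    simp [rate, h1]; nlinarith
  have m0 : ∀ t, sq (γ t) 0 = sq (γ 0) 0 := by
    obtain ⟨I, -, -, h⟩ := hγ.exists_integrals
    intro t
    rw [h]; simp [rate, h0, h1]
  obtain ⟨P, Q, ⟨hPs, hPe, hP⟩, hQs, hQe, hQ⟩ := hγ.exists_tendsto (show (1 : Fin 3) ≠ 2 by decide)
    (.inl m1) (.inr m2)
  rw [isEq_iff_strip h0 h1 h2 hPs] at hPe
  rw [isEq_iff_strip h0 h1 h2 hQs] at hQe
  refine ⟨P, Q, ⟨hPe, hP⟩, ⟨hQe, hQ⟩, fun h => hQe.resolve_right fun h' => ?_,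
    fun h => hPe.resolve_left fun h' => ?_, tendsto_nhds_unique (tendsto_sq hP 0) (by simp [m0]),
    tendsto_nhds_unique (tendsto_sq hQ 0) (by simp [m0])⟩
  · have := m1.ge_of_tendsto (tendsto_sq hQ 1) 0
    rw [((mem_arc_iff (k := 1) (by decide) (by decide) (by decide)).1 h').2] at this
    linarith
  · have := m2.ge_of_tendsto (tendsto_sq hP 2) 0
    rw [((mem_arc_iff (k := 2) (by decide) (by decide) (by decide)).1 h').2] at this
    linarith

end Cases

/-! ### The phase portraits without inner equilibrium -/

theorem union_setOf_eq {p : Params} {S : Set E} (hS : S ⊆ sphere)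
    (h : ∀ x ∈ sphere, IsEq p.m x ↔ x ∈ S) : equilibria p = {0} ∪ S := by
  rw [equilibria_eq]
  congr 1
  ext x
  exact ⟨fun hx => (h x hx.1).1 hx.2, fun hx => ⟨hS hx, (h x (hS hx)).2 hx⟩⟩

theorem arc_subset_sphere {i j k : Fin 3} (hij : i ≠ j) (hik : i ≠ k) (hjk : j ≠ k) :
    arc i j ⊆ sphere := fun _ hx => ((mem_arc_iff hij hik hjk).1 hx).1

theorem exists_zero_of_bdOctant {x : E} (hx : x ∈ bdOctant \ {0}) :
    x ∈ octant \ {0} ∧ ∃ i, x i = 0 := ⟨⟨hx.1.1, hx.2⟩, hx.1.2⟩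

section

variable {p : Params}

theorem node_case (h0 : p.m 0 < 0) (h1 : 0 < p.m 1) (h2 : p.m 2 < 0) :
    equilibria p = {0, e 0, e 1, e 2} ∧
      IsStableNode p (e 0) ∧ IsSaddle p (e 1) ∧ IsUnstableNode p (e 2) ∧
      IsHeteroclinicOrbit p (openArc 1 2) (e 2) (e 1) ∧
      IsHeteroclinicOrbit p (openArc 0 1) (e 1) (e 0) ∧
      (∀ x ∈ sphere \ (arc 0 1 ∪ arc 1 2),
        ∃ C, x ∈ C ∧ C ⊆ sphere ∧ IsHeteroclinicOrbit p C (e 2) (e 0)) ∧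
      (∀ x ∈ intOctant, omega p x = {e 0}) ∧
      (∀ x ∈ bdOctant \ {0}, ∃ i, omega p x = {e i}) := by
  have hr : ∀ i j, i ≠ j → rate p.m (sq (e i)) j =
      (![![0, p.m 0, -p.m 1], ![-p.m 0, 0, p.m 2], ![p.m 1, -p.m 2, 0]] : Fin 3 → Fin 3 → ℝ) i j := by
    intro i j _
    fin_cases i <;> fin_cases j <;> simp [rate, sq_e]
  refine ⟨?_, ?_, ?_, ?_, ?_, ?_, ?_, ?_, ?_⟩
  · rw [union_setOf_eq (S := {e 0, e 1, e 2}) ?_ ?_]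
    · rfl
    · rintro x (rfl | rfl | rfl) <;> exact e_mem_sphere _
    · intro x hx
      rw [isEq_iff_node h0 h1 h2 hx]
      simp [Fin.exists_fin_succ]
  · refine ⟨_, _, ?_, ?_, hasTangentEigenvalues_e p (i := 0) (j := 1) (k := 2) (by decide)
      (by decide) (by decide)⟩ <;> rw [hr _ _ (by decide)] <;> simpa
  · refine ⟨_, _, ?_, ?_, hasTangentEigenvalues_e p (i := 1) (j := 2) (k := 0) (by decide)
      (by decide) (by decide)⟩ <;> rw [hr _ _ (by decide)] <;> simpa
  · refine ⟨_, _, ?_, ?_, hasTangentEigenvalues_e p (i := 2) (j := 0) (k := 1) (by decide)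
      (by decide) (by decide)⟩ <;> rw [hr _ _ (by decide)] <;> simpa
  · exact heteroclinic_edge (k := 0) (κ := -p.m 2) (by decide) (by decide) (by decide)
      (by linarith) fun y hy => by simp [rate, hy]
  · exact heteroclinic_edge (k := 2) (κ := -p.m 0) (by decide) (by decide) (by decide)
      (by linarith) fun y hy => by simp [rate, hy]
  · rintro x ⟨hx, hx'⟩
    rw [mem_union, not_or, mem_arc_iff (i := 0) (j := 1) (k := 2) (by decide) (by decide)
      (by decide), mem_arc_iff (i := 1) (j := 2) (k := 0) (by decide) (by decide)
      (by decide)] at hx'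
    obtain ⟨γ, hγ, rfl⟩ := exists_isSphereCurve p.m hx
    obtain ⟨-, -, hQ, hP⟩ := hγ.node_limits h0 h1 h2
    refine ⟨range γ, mem_range_self 0, hγ.range_subset_sphere,
      heteroclinic_of_tendsto hγ (e_injective.ne (by decide)) (hP ?_) (hQ ?_)⟩
    · exact (sq_nonneg' _ _).lt_of_ne fun h => hx'.1 ⟨hx, h.symm⟩
    · exact (sq_nonneg' _ _).lt_of_ne fun h => hx'.2 ⟨hx, h.symm⟩
  · intro x hx
    obtain ⟨u, hu, hpos, -, ho⟩ := exists_curve_omega p (intOctant_subset hx)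
    exact ho _ ((hu.node_limits h0 h1 h2).2.2.1 ((hpos 0).2 (hx 0)))
  · intro x hx
    obtain ⟨u, hu, -, -, ho⟩ := exists_curve_omega p (exists_zero_of_bdOctant hx).1
    obtain ⟨-, ⟨i, hi⟩, -⟩ := hu.node_limits h0 h1 h2
    exact ⟨i, ho _ hi⟩

theorem mem_arcMinus {x : E} (hx : x ∈ arc 0 1) (h : sq x 0 < saddleWeight p.m) :
    x ∈ arcMinus p := ⟨hx, Real.lt_sqrt_of_sq_lt h⟩

theorem mem_arcPlus {x : E} (hx : x ∈ arc 0 1) (h : saddleWeight p.m < sq x 0)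
    (h0 : 0 ≤ saddleWeight p.m) : x ∈ arcPlus p :=
  ⟨hx, (Real.sqrt_lt_sqrt h0 h).trans_eq (Real.sqrt_sq (hx.1 0))⟩

theorem saddle_case (h0 : p.m 0 = 0) (h1 : 0 < p.m 1) (h2 : 0 < p.m 2) :
    equilibria p = {0, e 2} ∪ arc 0 1 ∧
      (∀ x ∈ intSphere, ∃ C, ∃ P ∈ arcMinus p, ∃ Q ∈ arcPlus p,
        x ∈ C ∧ C ⊆ intSphere ∧ IsHeteroclinicOrbit p C P Q) ∧
      {C : Set E | C ⊆ intSphere ∧ ∃ P Q, IsHeteroclinicOrbit p C P Q}.Infinite ∧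
      IsHeteroclinicOrbit p (openArc 1 2) (e 1) (e 2) ∧
      IsHeteroclinicOrbit p (openArc 0 2) (e 2) (e 0) ∧
      (∀ x ∈ intOctant, ∃ Q ∈ arcPlus p, omega p x = {Q}) ∧
      (∀ x ∈ bdOctant \ {0}, ∃ Q ∈ {e 2} ∪ arc 0 1, omega p x = {Q}) := by
  have hw := saddleWeight_pos h1 h2
  have hw1 := saddleWeight_lt_one h1 h2
  have hhet : ∀ γ, IsSphereCurve p.m γ → γ 0 ∈ intSphere → ∃ P ∈ arcMinus p, ∃ Q ∈ arcPlus p,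
      range γ ⊆ intSphere ∧ IsHeteroclinicOrbit p (range γ) P Q := by
    intro γ hγ hx
    obtain ⟨P, Q, ⟨hPa, hPw, hP⟩, ⟨hQa, hQw, hQ⟩, -⟩ := hγ.saddle_limits_int h0 h1 h2 hx
    exact ⟨P, mem_arcMinus hPa hPw, Q, mem_arcPlus hQa hQw hw.le, hγ.range_subset_intSphere hx,
      heteroclinic_of_tendsto hγ (fun h => by rw [h] at hPw; linarith) hP hQ⟩
  refine ⟨?_, ?_, ?_, ?_, ?_, ?_, ?_⟩
  · rw [union_setOf_eq (S := {e 2} ∪ arc 0 1) ?_ ?_]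
    · rw [← union_assoc]; rfl
    · rintro x (rfl | h)
      · exact e_mem_sphere _
      · exact arc_subset_sphere (k := 2) (by decide) (by decide) (by decide) h
    · exact fun x hx => isEq_iff_saddle h0 h1 h2 hx
  · intro x hx
    obtain ⟨γ, hγ, rfl⟩ := exists_isSphereCurve p.m hx.1
    obtain ⟨P, hP, Q, hQ, h⟩ := hhet γ hγ hx
    exact ⟨range γ, P, hP, Q, hQ, mem_range_self 0, h⟩
  · -- Different levels of the first integral give different orbits.
    have key : ∀ s : Ioo (0 : ℝ) 1, ∃ γ, IsSphereCurve p.m γ ∧ γ 0 ∈ intSphere ∧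
        saddleLevel p.m (sq (γ 0)) = s := by
      rintro ⟨s, hs0, hs1⟩
      set w := saddleWeight p.m with hwdef
      have hy : ∀ i, 0 < (![s * w, s * (1 - w), 1 - s] : Fin 3 → ℝ) i := by
        intro i
        fin_cases i <;> simp <;> nlinarith
      have hs : ofSq ![s * w, s * (1 - w), 1 - s] ∈ sphere :=
        ofSq_mem_sphere (fun i => (hy i).le) (by simp; ring)
      have hsq := sq_ofSq fun i => (hy i).le
      obtain ⟨γ, hγ, hγ0⟩ := exists_isSphereCurve p.m hs
      refine ⟨γ, hγ, ?_, ?_⟩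
      · rw [hγ0]; exact mem_intSphere_iff.2 ⟨hs, fun i => by rw [hsq]; exact hy i⟩
      · rw [hγ0, saddleLevel_eq_mul_bump h1 h2 (s := s) (u := w) hs0.le ⟨hw.le, hw1.le⟩
          (by rw [hsq]; simp) (by rw [hsq]; simp), bump_self hw hw1, mul_one]
    choose γ hγ hi hl using key
    have : Infinite (Ioo (0 : ℝ) 1) := Ioo.infinite zero_lt_one
    refine infinite_of_injective_forall_mem (f := fun s => range (γ s)) (fun s s' hss => ?_)
      fun s => ?_
    · obtain ⟨t, ht⟩ : γ s 0 ∈ range (γ s') := by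
        simp only at hss; rw [← hss]; exact mem_range_self 0
      have := (hγ s').saddleLevel_eq h0 h1 h2 t
      rw [ht, hl, hl] at this
      exact Subtype.ext this
    · obtain ⟨P, -, Q, -, h, h'⟩ := hhet _ (hγ s) (hi s)
      exact ⟨h, P, Q, h'⟩
  · rw [openArc_comm]
    exact heteroclinic_edge (k := 0) (κ := p.m 2) (by decide) (by decide) (by decide)
      h2 fun y hy => by simp [rate, hy]
  · exact heteroclinic_edge (k := 1) (κ := p.m 1) (by decide) (by decide) (by decide)
      h1 fun y hy => by simp [rate, hy]
  · intro x hx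
    obtain ⟨u, hu, hpos, -, ho⟩ := exists_curve_omega p (intOctant_subset hx)
    obtain ⟨P, Q, -, ⟨hQa, hQw, hQ⟩, -⟩ := hu.saddle_limits_int h0 h1 h2
      (mem_intSphere_iff.2 ⟨hu.mem 0, fun i => (hpos i).2 (hx i)⟩)
    exact ⟨Q, mem_arcPlus hQa hQw hw.le, ho _ hQ⟩
  · intro x hx
    obtain ⟨u, hu, -, -, ho⟩ := exists_curve_omega p (exists_zero_of_bdOctant hx).1
    obtain ⟨P, Q, -, -, hQe, hQ⟩ := hu.saddle_limits h0 h1 h2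
    exact ⟨Q, hQe, ho _ hQ⟩

theorem star_case (h0 : 0 < p.m 0) (h1 : p.m 1 = 0) (h2 : p.m 2 < 0) :
    equilibria p = {0, e 1} ∪ arc 0 2 ∧
      IsStableNode p (e 1) ∧
      (∀ x ∈ sphere \ arc 0 2, omega p x = {e 1}) ∧
      (∀ x ∈ sphere \ ({e 1} ∪ arc 0 2), ∃ C, ∃ P ∈ arc 0 2,
        x ∈ C ∧ C ⊆ sphere ∧ IsHeteroclinicOrbit p C P (e 1)) ∧
      (∀ x ∈ intOctant, omega p x = {e 1}) ∧
      (∀ x ∈ bdOctant \ {0}, ∃ Q ∈ {e 1} ∪ arc 0 2, omega p x = {Q}) := by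
  have hpos1 : ∀ x ∈ sphere \ arc 0 2, 0 < sq x 1 := fun x hx =>
    (sq_nonneg' _ _).lt_of_ne fun h => hx.2 <|
      (mem_arc_iff (k := 1) (by decide) (by decide) (by decide)).2 ⟨hx.1, h.symm⟩
  refine ⟨?_, ?_, ?_, ?_, ?_, ?_⟩
  · rw [union_setOf_eq (S := {e 1} ∪ arc 0 2) ?_ ?_]
    · rw [← union_assoc]; rfl
    · rintro x (rfl | h)
      · exact e_mem_sphere _
      · exact arc_subset_sphere (k := 1) (by decide) (by decide) (by decide) h
    · exact fun x hx => isEq_iff_star h0 h1 h2 hx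
  · refine ⟨_, _, ?_, ?_, hasTangentEigenvalues_e p (i := 1) (j := 0) (k := 2) (by decide)
      (by decide) (by decide)⟩ <;> simpa [rate, sq_e]
  · intro x hx
    obtain ⟨u, hu, -, hux, ho⟩ := exists_curve_omega p (sphere_subset hx.1)
    exact ho _ ((hu.star_limits h0 h1 h2).2.1 (by rw [hux hx.1]; exact hpos1 x hx))
  · rintro x ⟨hx, hx'⟩
    rw [mem_union, not_or] at hx'
    obtain ⟨γ, hγ, rfl⟩ := exists_isSphereCurve p.m hx
    obtain ⟨-, hQ, hP⟩ := hγ.star_limits h0 h1 h2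
    obtain ⟨P, hPa, hP⟩ := hP ((sq_le_one hx 1).lt_of_ne fun h => hx'.1 (eq_e_of_sq hx h))
    refine ⟨range γ, P, hPa, mem_range_self 0, hγ.range_subset_sphere,
      heteroclinic_of_tendsto hγ (fun h => ?_) hP (hQ (hpos1 _ ⟨hx, hx'.2⟩))⟩
    have := ((mem_arc_iff (k := 1) (by decide) (by decide) (by decide)).1 hPa).2
    rw [h, sq_e] at this
    norm_num at this
  · intro x hx
    obtain ⟨u, hu, hpos, -, ho⟩ := exists_curve_omega p (intOctant_subset hx)
    exact ho _ ((hu.star_limits h0 h1 h2).2.1 ((hpos 1).2 (hx 1)))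
  · intro x hx
    obtain ⟨u, hu, -, -, ho⟩ := exists_curve_omega p (exists_zero_of_bdOctant hx).1
    obtain ⟨⟨Q, hQ, hQl⟩, -⟩ := hu.star_limits h0 h1 h2
    exact ⟨Q, hQ, ho _ hQl⟩

theorem strip_case (h0 : p.m 0 = 0) (h1 : p.m 1 = 0) (h2 : p.m 2 < 0) :
    equilibria p = {0} ∪ arc 0 1 ∪ arc 0 2 ∧
      (∀ x ∈ intSphere, ∃ C, ∃ P ∈ arc 0 2, ∃ Q ∈ arc 0 1,
        x ∈ C ∧ C ⊆ intSphere ∧ IsHeteroclinicOrbit p C P Q) ∧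
      IsHeteroclinicOrbit p (openArc 1 2) (e 2) (e 1) ∧
      (∀ x ∈ intOctant, ∃ Q ∈ arc 0 1, omega p x = {Q}) ∧
      (∀ x ∈ bdOctant \ {0}, ∃ Q ∈ arc 0 1 ∪ arc 0 2, omega p x = {Q}) := by
  refine ⟨?_, ?_, ?_, ?_, ?_⟩
  · rw [union_setOf_eq (S := arc 0 1 ∪ arc 0 2) ?_ ?_]
    · rw [← union_assoc]
    · rintro x (h | h)
      · exact arc_subset_sphere (k := 2) (by decide) (by decide) (by decide) h
      · exact arc_subset_sphere (k := 1) (by decide) (by decide) (by decide) h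
    · exact fun x hx => isEq_iff_strip h0 h1 h2 hx
  · intro x hx
    obtain ⟨γ, hγ, rfl⟩ := exists_isSphereCurve p.m hx.1
    have hi := (mem_intSphere_iff.1 hx).2
    obtain ⟨P, Q, ⟨-, hP⟩, ⟨-, hQ⟩, hQa, hPa, hP0, -⟩ := hγ.strip_limits h0 h1 h2
    refine ⟨range γ, P, hPa (hi 2), Q, hQa (hi 1), mem_range_self 0, hγ.range_subset_intSphere hx,
      heteroclinic_of_tendsto hγ (fun h => ?_) hP hQ⟩
    -- The common point of the two edges is `e 0`, but the first coordinate is less than `1`.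
    obtain ⟨hPs, hP1⟩ := (mem_arc_iff (k := 1) (by decide) (by decide) (by decide)).1 (hPa (hi 2))
    have hP2 := ((mem_arc_iff (k := 2) (by decide) (by decide) (by decide)).1 (h ▸ hQa (hi 1))).2
    have e1 := sum_sq hPs
    have e2 := sum_sq hx.1
    have := hi 1
    have := hi 2
    linarith
  · exact heteroclinic_edge (k := 0) (κ := -p.m 2) (by decide) (by decide) (by decide)
      (by linarith) fun y hy => by simp [rate, hy]
  · intro x hx
    obtain ⟨u, hu, hpos, -, ho⟩ := exists_curve_omega p (intOctant_subset hx)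
    obtain ⟨P, Q, -, ⟨-, hQ⟩, hQa, -⟩ := hu.strip_limits h0 h1 h2
    exact ⟨Q, hQa ((hpos 1).2 (hx 1)), ho _ hQ⟩
  · intro x hx
    obtain ⟨u, hu, -, -, ho⟩ := exists_curve_omega p (exists_zero_of_bdOctant hx).1
    obtain ⟨P, Q, -, ⟨hQ', hQ⟩, -⟩ := hu.strip_limits h0 h1 h2
    exact ⟨Q, hQ', ho _ hQ⟩

theorem isEq_of_zero {m : Fin 3 → ℝ} (h0 : m 0 = 0) (h1 : m 1 = 0) (h2 : m 2 = 0) (x : E) :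
    IsEq m x := by
  intro i
  fin_cases i <;> simp [rate, h0, h1, h2]

theorem zero_case (h0 : p.m 0 = 0) (h1 : p.m 1 = 0) (h2 : p.m 2 = 0) :
    equilibria p = {0} ∪ sphere ∧
      (∀ x ∈ octant \ {0}, ∃ Q, ray x ∩ sphere = {Q} ∧ omega p x = {Q}) := by
  refine ⟨union_setOf_eq subset_rfl fun x hx => iff_of_true (isEq_of_zero h0 h1 h2 x) hx, ?_⟩
  intro x hx
  obtain ⟨u, hu, hr, hxu, hux⟩ := exists_polar p.m hx
  refine ⟨u 0, Subset.antisymm ?_ ?_, ?_⟩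
  · rintro _ ⟨⟨s, hs, rfl⟩, h⟩
    have h1 := (mem_sphere_iff.1 h).2
    rw [norm_smul, Real.norm_of_nonneg hs.le] at h1
    rw [mem_singleton_iff, hux, eq_inv_of_mul_eq_one_left h1]
  · rintro _ rfl
    exact ⟨⟨‖x‖⁻¹, inv_pos.2 hr, hux⟩, hu.mem 0⟩
  · have hc : ∀ t, u t = u 0 := hu.eq_const (isEq_of_zero h0 h1 h2 _)
    nth_rw 1 [hxu]
    exact omega_eq_singleton hu hr (tendsto_const_nhds.congr fun t => (hc t).symm)

end

/-! ### The first integral around the center -/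

/-- The coordinates of the inner equilibrium in the squares, in the case that all `m i` have the
same sign; these are also the exponents of the first integral. -/
def centerWeight (m : Fin 3 → ℝ) (i : Fin 3) : ℝ := m (Fin.rev i) / (m 0 + m 1 + m 2)

/-- The first integral, as a function of the squares `y i` of the coordinates on the sphere. It is
normalized to take the value `1` at the inner equilibrium; it vanishes on the boundary. -/
def centerLevel (m y : Fin 3 → ℝ) : ℝ :=
  (y 0 / centerWeight m 0) ^ centerWeight m 0 * (y 1 / centerWeight m 1) ^ centerWeight m 1 *
    (y 2 / centerWeight m 2) ^ centerWeight m 2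

section CenterLevel

variable {m : Fin 3 → ℝ}

theorem centerWeight_pos (hm : ∀ i, 0 < m i) (i : Fin 3) : 0 < centerWeight m i :=
  div_pos (hm _) (add_pos (add_pos (hm 0) (hm 1)) (hm 2))

theorem sum_centerWeight (hm : ∀ i, 0 < m i) :
    centerWeight m 0 + centerWeight m 1 + centerWeight m 2 = 1 := by
  have := add_pos (add_pos (hm 0) (hm 1)) (hm 2)
  simp only [centerWeight, show Fin.rev (0 : Fin 3) = 2 from rfl,
    show Fin.rev (1 : Fin 3) = 1 from rfl, show Fin.rev (2 : Fin 3) = 0 from rfl]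
  field_simp; ring

theorem continuous_centerLevel (hm : ∀ i, 0 < m i) : Continuous (centerLevel m) := by
  have h : ∀ i, Continuous fun y : Fin 3 → ℝ => (y i / centerWeight m i) ^ centerWeight m i :=
    fun i => ((continuous_apply i).div_const _).rpow_const fun _ => .inr (centerWeight_pos hm i).le
  exact ((h 0).mul (h 1)).mul (h 2)

theorem continuous_sq' : Continuous sq := continuous_pi continuous_sq

theorem centerLevel_pos (hm : ∀ i, 0 < m i) {y : Fin 3 → ℝ} (hy : ∀ i, 0 < y i) :
    0 < centerLevel m y := by
  have h : ∀ i, 0 < (y i / centerWeight m i) ^ centerWeight m i := fun i =>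
    Real.rpow_pos_of_pos (div_pos (hy i) (centerWeight_pos hm i)) _
  exact mul_pos (mul_pos (h 0) (h 1)) (h 2)

theorem centerLevel_nonneg (hm : ∀ i, 0 < m i) {y : Fin 3 → ℝ} (hy : ∀ i, 0 ≤ y i) :
    0 ≤ centerLevel m y := by
  have h : ∀ i, 0 ≤ (y i / centerWeight m i) ^ centerWeight m i := fun i =>
    Real.rpow_nonneg (div_nonneg (hy i) (centerWeight_pos hm i).le) _
  exact mul_nonneg (mul_nonneg (h 0) (h 1)) (h 2)

theorem centerLevel_eq_zero (hm : ∀ i, 0 < m i) {y : Fin 3 → ℝ} {i : Fin 3} (hy : y i = 0) :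
    centerLevel m y = 0 := by
  have h : (y i / centerWeight m i) ^ centerWeight m i = 0 := by
    rw [hy, zero_div, Real.zero_rpow (centerWeight_pos hm i).ne']
  fin_cases i <;> simp at h <;> simp [centerLevel, h]

theorem centerLevel_weight (hm : ∀ i, 0 < m i) : centerLevel m (centerWeight m) = 1 := by
  simp [centerLevel, (centerWeight_pos hm _).ne']

theorem pos_of_centerLevel_pos (hm : ∀ i, 0 < m i) {y : Fin 3 → ℝ} (hy : ∀ i, 0 ≤ y i)
    (h : 0 < centerLevel m y) (i : Fin 3) : 0 < y i :=
  (hy i).lt_of_ne fun h' => h.ne' (centerLevel_eq_zero hm h'.symm)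

/-- The first integral decreases strictly along straight rays from its maximum. -/
theorem strictAntiOn_centerLevel (hm : ∀ i, 0 < m i) {v : Fin 3 → ℝ} (hv : v 0 + v 1 + v 2 = 0)
    (hv0 : v ≠ 0) {T : ℝ} (hT : ∀ i, 0 ≤ centerWeight m i + T * v i) :
    StrictAntiOn (fun t => centerLevel m fun i => centerWeight m i + t * v i) (Icc 0 T) := by
  have hw := centerWeight_pos hm
  refine strictAntiOn_of_deriv_neg (convex_Icc _ _)
    ((continuous_centerLevel hm).comp (continuous_pi fun i => by fun_prop)).continuousOn ?_
  rw [interior_Icc]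
  intro t ht
  have hy : ∀ i, 0 < centerWeight m i + t * v i := by
    intro i
    have h1 := hT i
    have h2 := hw i
    have h3 : 0 < T := ht.1.trans ht.2
    have h4 : T * (centerWeight m i + t * v i) =
      (T - t) * centerWeight m i + t * (centerWeight m i + T * v i) := by ring
    have h5 : 0 < T * (centerWeight m i + t * v i) := by
      rw [h4]
      exact add_pos_of_pos_of_nonneg (mul_pos (by linarith [ht.2]) h2) (mul_nonneg ht.1.le h1)
    exact pos_of_mul_pos_right h5 h3.le
  have hd : ∀ i, HasDerivAt
      (fun t => ((centerWeight m i + t * v i) / centerWeight m i) ^ centerWeight m i)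
      (((centerWeight m i + t * v i) / centerWeight m i) ^ centerWeight m i *
        (centerWeight m i * v i / (centerWeight m i + t * v i))) t := by
    intro i
    have h1 : HasDerivAt (fun t => (centerWeight m i + t * v i) / centerWeight m i)
        (v i / centerWeight m i) t := by
      simpa using (((hasDerivAt_id t).mul_const (v i)).const_add (centerWeight m i)).div_const
        (centerWeight m i)
    refine (h1.rpow_const (.inl (div_pos (hy i) (hw i)).ne')).congr_deriv ?_
    rw [Real.rpow_sub_one (div_pos (hy i) (hw i)).ne']
    have := (hw i).ne'
    have := (hy i).ne'
    field_simp
  -- As the `v i` add up to `0`, the logarithmic derivative is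
  -- `-t * ∑ i, v i ^ 2 / (w i + t * v i)`.
  have hsum : ∀ i, centerWeight m i * v i / (centerWeight m i + t * v i) =
      v i - t * (v i ^ 2 / (centerWeight m i + t * v i)) := by
    intro i
    rw [eq_sub_iff_add_eq, ← mul_div_assoc, ← add_div, div_eq_iff (hy i).ne']
    ring
  have hderiv : HasDerivAt (fun t => centerLevel m fun i => centerWeight m i + t * v i)
      (-(centerLevel m (fun i => centerWeight m i + t * v i) * (t *
        (v 0 ^ 2 / (centerWeight m 0 + t * v 0) + v 1 ^ 2 / (centerWeight m 1 + t * v 1) +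
          v 2 ^ 2 / (centerWeight m 2 + t * v 2))))) t := by
    refine (((hd 0).mul (hd 1)).mul (hd 2)).congr_deriv ?_
    rw [hsum, hsum, hsum]
    simp only [centerLevel, Pi.mul_apply]
    linear_combination ((centerWeight m 0 + t * v 0) / centerWeight m 0) ^ centerWeight m 0 *
      ((centerWeight m 1 + t * v 1) / centerWeight m 1) ^ centerWeight m 1 *
      ((centerWeight m 2 + t * v 2) / centerWeight m 2) ^ centerWeight m 2 * hv
  rw [hderiv.deriv, neg_lt_zero]
  refine mul_pos (centerLevel_pos hm hy) (mul_pos ht.1 ?_)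
  have hn : ∀ i, 0 ≤ v i ^ 2 / (centerWeight m i + t * v i) := fun i =>
    div_nonneg (sq_nonneg _) (hy i).le
  obtain ⟨i, hi⟩ : ∃ i, v i ≠ 0 := Function.ne_iff.1 hv0
  have hp : 0 < v i ^ 2 / (centerWeight m i + t * v i) := div_pos (by positivity) (hy i)
  have n0 := hn 0
  have n1 := hn 1
  have n2 := hn 2
  fin_cases i <;> simp only [Fin.zero_eta, Fin.mk_one, Fin.reduceFinMk] at hp <;> linarith

theorem centerLevel_lt_one (hm : ∀ i, 0 < m i) {y : Fin 3 → ℝ} (hy : ∀ i, 0 ≤ y i)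
    (hs : y 0 + y 1 + y 2 = 1) (hne : y ≠ centerWeight m) : centerLevel m y < 1 := by
  have h := strictAntiOn_centerLevel hm (v := fun i => y i - centerWeight m i) (T := 1)
    (by linarith [sum_centerWeight hm])
    (fun h => hne (funext fun i => sub_eq_zero.1 (congrFun h i))) (fun i => by simpa using hy i)
    ⟨le_rfl, zero_le_one⟩ ⟨zero_le_one, le_rfl⟩ zero_lt_one
  simpa [centerLevel_weight hm] using h

theorem centerLevel_le_one (hm : ∀ i, 0 < m i) {y : Fin 3 → ℝ} (hy : ∀ i, 0 ≤ y i)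
    (hs : y 0 + y 1 + y 2 = 1) : centerLevel m y ≤ 1 := by
  by_cases h : y = centerWeight m
  · rw [h, centerLevel_weight hm]
  · exact (centerLevel_lt_one hm hy hs h).le

theorem IsSphereCurve.centerLevel_eq {γ : ℝ → E} (hγ : IsSphereCurve m γ) (hm : ∀ i, 0 < m i)
    (t : ℝ) : centerLevel m (sq (γ t)) = centerLevel m (sq (γ 0)) := by
  obtain ⟨I, -, -, h⟩ := hγ.exists_integrals
  have hw := centerWeight_pos hm
  have key : ∀ i, (sq (γ t) i / centerWeight m i) ^ centerWeight m i =
      (sq (γ 0) i / centerWeight m i) ^ centerWeight m i *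
        Real.exp (2 * rate m (I t) i * centerWeight m i) := fun i => by
    rw [h t i, mul_div_right_comm, Real.mul_rpow (div_nonneg (sq_nonneg' _ _) (hw i).le)
      (Real.exp_pos _).le, ← Real.exp_mul]
  -- The vector of weights is orthogonal to all values of `rate m`.
  have hz : 2 * rate m (I t) 0 * centerWeight m 0 + 2 * rate m (I t) 1 * centerWeight m 1 +
      2 * rate m (I t) 2 * centerWeight m 2 = 0 := by
    simp only [rate, centerWeight, show Fin.rev (0 : Fin 3) = 2 from rfl,
      show Fin.rev (1 : Fin 3) = 1 from rfl, show Fin.rev (2 : Fin 3) = 0 from rfl]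
    simp; ring
  have he : Real.exp (2 * rate m (I t) 0 * centerWeight m 0) *
      Real.exp (2 * rate m (I t) 1 * centerWeight m 1) *
      Real.exp (2 * rate m (I t) 2 * centerWeight m 2) = 1 := by
    rw [← Real.exp_add, ← Real.exp_add, hz, Real.exp_zero]
  simp only [centerLevel, key]
  linear_combination (sq (γ 0) 0 / centerWeight m 0) ^ centerWeight m 0 *
    (sq (γ 0) 1 / centerWeight m 1) ^ centerWeight m 1 *
    (sq (γ 0) 2 / centerWeight m 2) ^ centerWeight m 2 * he

end CenterLevel

/-! ### Polar coordinates around the center -/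

/-- An affine coordinate on the simplex of the squares, with the inner equilibrium at `0`. The
three vertices are always mapped to the rays through `1`, `i` and `-1 - i`. -/
def centerCoord (m y : Fin 3 → ℝ) : ℂ :=
  ⟨y 0 / centerWeight m 0 - y 2 / centerWeight m 2, y 1 / centerWeight m 1 - y 2 / centerWeight m 2⟩

/-- The linear part of the inverse of `centerCoord m`. -/
def centerRay (m : Fin 3 → ℝ) (c : ℂ) : Fin 3 → ℝ :=
  ![centerWeight m 0 * (c.re - (centerWeight m 0 * c.re + centerWeight m 1 * c.im)),
    centerWeight m 1 * (c.im - (centerWeight m 0 * c.re + centerWeight m 1 * c.im)),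
    -(centerWeight m 2 * (centerWeight m 0 * c.re + centerWeight m 1 * c.im))]

/-- Polar coordinates that turn the levels of the first integral into circles: the argument is that
of `centerCoord`, the radius is `1 - centerLevel`. They map the sphere onto the unit disc. At the
inner equilibrium the factor `0 / 0 = 0` gives the right value `0`. -/
def centerMap (m : Fin 3 → ℝ) (x : E) : ℂ :=
  ((1 - centerLevel m (sq x)) / ‖centerCoord m (sq x)‖) • centerCoord m (sq x)

section CenterMap

variable {m : Fin 3 → ℝ}

theorem continuous_centerCoord : Continuous (centerCoord m) := by
  have : centerCoord m = fun y => Complex.equivRealProdCLM.symm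
    (y 0 / centerWeight m 0 - y 2 / centerWeight m 2,
      y 1 / centerWeight m 1 - y 2 / centerWeight m 2) := by
    funext y
    apply Complex.ext <;> simp [centerCoord]
  rw [this]
  exact Complex.equivRealProdCLM.symm.continuous.comp (by fun_prop)

theorem sum_centerRay (hm : ∀ i, 0 < m i) (c : ℂ) :
    centerRay m c 0 + centerRay m c 1 + centerRay m c 2 = 0 := by
  have := sum_centerWeight hm
  simp [centerRay]
  linear_combination -(centerWeight m 0 * c.re + centerWeight m 1 * c.im) * this

theorem centerCoord_ray (hm : ∀ i, 0 < m i) (c : ℂ) (t : ℝ) :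
    centerCoord m (fun i => centerWeight m i + t * centerRay m c i) = t • c := by
  have h := fun i => (centerWeight_pos hm i).ne'
  have h0 := h 0
  have h1 := h 1
  have h2 := h 2
  apply Complex.ext <;> simp [centerCoord, centerRay] <;> field_simp <;> ring

theorem eq_weight_add_ray (hm : ∀ i, 0 < m i) {y : Fin 3 → ℝ} (hs : y 0 + y 1 + y 2 = 1) :
    y = fun i => centerWeight m i + 1 * centerRay m (centerCoord m y) i := by
  have h := fun i => (centerWeight_pos hm i).ne'
  have h0 := h 0
  have h1 := h 1
  have h2 := h 2
  have hw := sum_centerWeight hm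
  have key : centerWeight m 0 * (y 0 / centerWeight m 0 - y 2 / centerWeight m 2) +
      centerWeight m 1 * (y 1 / centerWeight m 1 - y 2 / centerWeight m 2) =
      1 - y 2 / centerWeight m 2 := by
    field_simp
    linear_combination centerWeight m 2 * hs - y 2 * hw
  ext i
  fin_cases i <;> simp [centerRay, centerCoord, key] <;> field_simp <;> ring

theorem centerCoord_eq_zero_iff (hm : ∀ i, 0 < m i) {y : Fin 3 → ℝ} (hs : y 0 + y 1 + y 2 = 1) :
    centerCoord m y = 0 ↔ y = centerWeight m := by
  constructor
  · intro h
    rw [eq_weight_add_ray hm hs, h]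
    ext i; fin_cases i <;> simp [centerRay]
  · rintro rfl
    have h := fun i => (centerWeight_pos hm i).ne'
    apply Complex.ext <;> simp [centerCoord, h]

theorem centerRay_smul (c : ℂ) (r : ℝ) (i : Fin 3) :
    centerRay m (r • c) i = r * centerRay m c i := by
  fin_cases i <;> simp [centerRay] <;> ring

theorem norm_centerMap (hm : ∀ i, 0 < m i) {x : E} (hx : x ∈ sphere) :
    ‖centerMap m x‖ = 1 - centerLevel m (sq x) := by
  have hle := centerLevel_le_one hm (sq_nonneg' x) (sum_sq hx)
  by_cases h : centerCoord m (sq x) = 0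
  · rw [centerMap, h, smul_zero, norm_zero,
      (centerCoord_eq_zero_iff hm (sum_sq hx)).1 h, centerLevel_weight hm, sub_self]
  · rw [centerMap, norm_smul, Real.norm_of_nonneg (div_nonneg (by linarith) (norm_nonneg _)),
      div_mul_cancel₀ _ (norm_ne_zero_iff.2 h)]

theorem continuousOn_centerMap (hm : ∀ i, 0 < m i) : ContinuousOn (centerMap m) sphere := by
  intro x hx
  have hF : Continuous fun x : E => centerLevel m (sq x) :=
    (continuous_centerLevel hm).comp continuous_sq'
  have hz : Continuous fun x : E => centerCoord m (sq x) :=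
    continuous_centerCoord.comp continuous_sq'
  by_cases h : centerCoord m (sq x) = 0
  · have h1 : centerMap m x = 0 := by rw [centerMap, h, smul_zero]
    have h2 : centerLevel m (sq x) = 1 := by
      rw [(centerCoord_eq_zero_iff hm (sum_sq hx)).1 h, centerLevel_weight hm]
    rw [ContinuousWithinAt, h1, tendsto_zero_iff_norm_tendsto_zero]
    have h3 : Tendsto (fun x : E => 1 - centerLevel m (sq x)) (𝓝[sphere] x) (𝓝 0) := by
      have hc : Continuous fun x : E => 1 - centerLevel m (sq x) := by fun_prop
      have := hc.tendsto x
      rw [h2, sub_self] at this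
      exact this.mono_left nhdsWithin_le_nhds
    refine h3.congr' ?_
    filter_upwards [self_mem_nhdsWithin] with y hy using (norm_centerMap hm hy).symm
  · exact (((continuous_const.sub hF).continuousAt.div hz.norm.continuousAt
      (norm_ne_zero_iff.2 h)).smul hz.continuousAt).continuousWithinAt

theorem injOn_centerMap (hm : ∀ i, 0 < m i) : InjOn (centerMap m) sphere := by
  intro x hx x' hx' hxx
  have hF : centerLevel m (sq x) = centerLevel m (sq x') := by
    have h1 := norm_centerMap hm hx
    have h2 := norm_centerMap hm hx'
    rw [hxx, h2] at h1; linarith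
  refine sq_inj hx.1 hx'.1 (congrFun ?_)
  by_cases h1 : centerLevel m (sq x) = 1
  · have key : ∀ {x}, x ∈ sphere → centerLevel m (sq x) = 1 → sq x = centerWeight m :=
      fun {x} hx h => by
        by_contra hne
        exact (centerLevel_lt_one hm (sq_nonneg' x) (sum_sq hx) hne).ne h
    rw [key hx h1, key hx' (hF ▸ h1)]
  · have hlt : 0 < 1 - centerLevel m (sq x) := by
      have := (centerLevel_le_one hm (sq_nonneg' x) (sum_sq hx)).lt_of_ne h1
      linarith
    have hne : ∀ {x}, x ∈ sphere → centerLevel m (sq x) ≠ 1 → centerCoord m (sq x) ≠ 0 :=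
      fun {x} hx h h' => h (by
        rw [(centerCoord_eq_zero_iff hm (sum_sq hx)).1 h', centerLevel_weight hm])
    have hz := norm_pos_iff.2 (hne hx h1)
    have hz' := norm_pos_iff.2 (hne hx' (hF ▸ h1))
    -- The two points lie on the same ray from the maximum of the first integral.
    obtain ⟨r, hr, hrz⟩ : ∃ r : ℝ, 0 < r ∧ centerCoord m (sq x') = r • centerCoord m (sq x) := by
      refine ⟨‖centerCoord m (sq x')‖ / ‖centerCoord m (sq x)‖, div_pos hz' hz, ?_⟩
      rw [centerMap, centerMap, ← hF, div_eq_mul_inv, div_eq_mul_inv, mul_smul, mul_smul] at hxx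
      have := smul_right_injective ℂ hlt.ne' hxx
      rw [div_eq_mul_inv, mul_smul, this, smul_inv_smul₀ hz'.ne']
    have e1 := eq_weight_add_ray hm (sum_sq hx)
    have e2 : sq x' = fun i => centerWeight m i + r * centerRay m (centerCoord m (sq x)) i := by
      have := eq_weight_add_ray hm (sum_sq hx')
      rw [hrz] at this
      simpa only [centerRay_smul, one_mul] using this
    have hv : centerRay m (centerCoord m (sq x)) ≠ 0 := by
      intro h
      rw [h] at e1
      simp only [Pi.zero_apply, mul_zero, add_zero] at e1
      exact hne hx h1 ((centerCoord_eq_zero_iff hm (sum_sq hx)).2 e1)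
    suffices r = 1 by rw [e2, this, ← e1]
    have hT : ∀ i, 0 ≤ centerWeight m i +
        max 1 r * centerRay m (centerCoord m (sq x)) i := by
      intro i
      rcases max_choice 1 r with h | h <;> rw [h]
      · exact (congrFun e1 i) ▸ sq_nonneg' x i
      · exact (congrFun e2 i) ▸ sq_nonneg' x' i
    have hanti := strictAntiOn_centerLevel hm (sum_centerRay hm _) hv hT
    refine (hanti.injOn ⟨zero_le_one, le_max_left _ _⟩ ⟨hr.le, le_max_right _ _⟩ ?_).symm
    rw [← e1, ← e2, hF]

theorem image_centerMap (hm : ∀ i, 0 < m i) :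
    centerMap m '' sphere = Metric.closedBall 0 1 := by
  refine Subset.antisymm ?_ fun c hc => ?_
  · rintro _ ⟨x, hx, rfl⟩
    rw [mem_closedBall_zero_iff, norm_centerMap hm hx]
    linarith [centerLevel_nonneg hm (sq_nonneg' x)]
  rw [mem_closedBall_zero_iff] at hc
  have hw := centerWeight_pos hm
  by_cases hc0 : c = 0
  · refine ⟨ofSq (centerWeight m), ofSq_mem_sphere (fun i => (hw i).le) (sum_centerWeight hm), ?_⟩
    have : sq (ofSq (centerWeight m)) = centerWeight m := funext (sq_ofSq fun i => (hw i).le)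
    rw [centerMap, this, centerLevel_weight hm, hc0]; simp
  set v := centerRay m c with hvdef
  have hvs : v 0 + v 1 + v 2 = 0 := sum_centerRay hm c
  have hv0 : v ≠ 0 := by
    intro h
    have := centerCoord_ray hm c 1
    rw [← hvdef, h] at this
    simp only [Pi.zero_apply, mul_zero, add_zero, one_smul] at this
    exact hc0 (this ▸ (centerCoord_eq_zero_iff hm (sum_centerWeight hm)).2 rfl)
  -- The ray leaves the simplex through a boundary point.
  obtain ⟨T, hT0, hT, i₀, hi₀⟩ : ∃ T : ℝ, 0 ≤ T ∧ (∀ i, 0 ≤ centerWeight m i + T * v i) ∧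
      ∃ i, centerWeight m i + T * v i = 0 := by
    let mn : ℝ → ℝ := fun t => min (min (centerWeight m 0 + t * v 0) (centerWeight m 1 + t * v 1))
      (centerWeight m 2 + t * v 2)
    have hmn : Continuous mn := by fun_prop
    have hle : ∀ t i, mn t ≤ centerWeight m i + t * v i := by
      intro t i
      fin_cases i
      · exact (min_le_left _ _).trans (min_le_left _ _)
      · exact (min_le_left _ _).trans (min_le_right _ _)
      · exact min_le_right _ _
    obtain ⟨j, hj⟩ : ∃ j, v j < 0 := by
      by_contra! h
      have h0 := h 0
      have h1 := h 1
      have h2 := h 2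
      exact hv0 (by ext i; fin_cases i <;> simp <;> linarith)
    have hneg : 0 < -v j := by linarith
    have hb : mn (centerWeight m j / -v j) ≤ 0 := by
      refine (hle _ j).trans_eq ?_
      have := hneg.ne'
      have : v j ≠ 0 := hj.ne
      field_simp; ring
    have ha : 0 ≤ mn 0 := by
      simp only [mn, zero_mul, add_zero]
      exact le_min (le_min (hw 0).le (hw 1).le) (hw 2).le
    obtain ⟨T, hT, hT0⟩ := intermediate_value_Icc' (div_pos (hw j) hneg).le hmn.continuousOn
      ⟨hb, ha⟩
    refine ⟨T, hT.1, fun i => hT0 ▸ hle T i, ?_⟩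
    simp only [mn] at hT0
    rcases min_choice (min (centerWeight m 0 + T * v 0) (centerWeight m 1 + T * v 1))
      (centerWeight m 2 + T * v 2) with h | h
    · rcases min_choice (centerWeight m 0 + T * v 0) (centerWeight m 1 + T * v 1) with h' | h'
      · exact ⟨0, by rw [← h', ← h, hT0]⟩
      · exact ⟨1, by rw [← h', ← h, hT0]⟩
    · exact ⟨2, by rw [← h, hT0]⟩
  have hcont : ContinuousOn (fun t => centerLevel m fun i => centerWeight m i + t * v i)
      (Icc 0 T) :=
    ((continuous_centerLevel hm).comp (continuous_pi fun i => by fun_prop)).continuousOn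
  obtain ⟨t, ht, htc⟩ : 1 - ‖c‖ ∈ (fun t => centerLevel m fun i => centerWeight m i + t * v i) ''
      Icc 0 T := by
    refine intermediate_value_Icc' hT0 hcont ⟨?_, ?_⟩
    · rw [centerLevel_eq_zero hm hi₀]; linarith
    · simp only [zero_mul, add_zero]
      change _ ≤ centerLevel m (centerWeight m)
      rw [centerLevel_weight hm]; linarith [norm_nonneg c]
  have hy : ∀ i, 0 ≤ centerWeight m i + t * v i := by
    intro i
    rcases hT0.eq_or_lt with h | h
    · have : t = 0 := le_antisymm (h ▸ ht.2) ht.1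
      rw [this]; simpa using (hw i).le
    · have h4 : T * (centerWeight m i + t * v i) =
        (T - t) * centerWeight m i + t * (centerWeight m i + T * v i) := by ring
      have h5 : 0 ≤ T * (centerWeight m i + t * v i) := by
        rw [h4]
        exact add_nonneg (mul_nonneg (by linarith [ht.2]) (hw i).le) (mul_nonneg ht.1 (hT i))
      exact nonneg_of_mul_nonneg_right h5 h
  have hcn : 0 < ‖c‖ := norm_pos_iff.2 hc0
  have ht0 : 0 < t := ht.1.lt_of_ne fun h => by
    rw [← h] at htc
    simp only [zero_mul, add_zero] at htc
    change centerLevel m (centerWeight m) = _ at htc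
    rw [centerLevel_weight hm] at htc; linarith
  refine ⟨ofSq fun i => centerWeight m i + t * v i, ofSq_mem_sphere hy ?_, ?_⟩
  · linear_combination sum_centerWeight hm + t * hvs
  · simp only at htc
    rw [centerMap, show sq (ofSq fun i => centerWeight m i + t * v i) = _ from funext (sq_ofSq hy),
      htc, hvdef, centerCoord_ray hm, norm_smul, Real.norm_of_nonneg ht.1, smul_smul,
      sub_sub_cancel, div_mul_eq_mul_div, mul_comm t, div_self (mul_pos hcn ht0).ne', one_smul]

end CenterMap

/-! ### Rotation around the center -/

/-- A continuous choice of the argument along a solution of `Z' = Z k` in the complex plane. -/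
theorem exists_angle {Z k : ℝ → ℂ} (hk : Continuous k) (hZ : ∀ t, HasDerivAt Z (Z t * k t) t) :
    ∃ θ : ℝ → ℝ, θ 0 = 0 ∧ (∀ t, HasDerivAt θ (k t).im t) ∧
      ∀ t, ∃ R : ℝ, 0 < R ∧ Z t = R • (Z 0 * Complex.exp (θ t * Complex.I)) := by
  have hK : ∀ t, HasDerivAt (fun t => ∫ s in (0 : ℝ)..t, k s) (k t) t := fun t =>
    intervalIntegral.integral_hasDerivAt_right (hk.intervalIntegrable _ _)
      (hk.stronglyMeasurableAtFilter _ _) hk.continuousAt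
  have hg : ∀ t, HasDerivAt (fun t => Z t * Complex.exp (-∫ s in (0 : ℝ)..t, k s)) 0 t := fun t =>
    ((hZ t).mul (hK t).neg.cexp).congr_deriv (by ring)
  refine ⟨fun t => (∫ s in (0 : ℝ)..t, k s).im, by simp,
    fun t => Complex.imCLM.hasFDerivAt.comp_hasDerivAt t (hK t), fun t => ?_⟩
  refine ⟨Real.exp (∫ s in (0 : ℝ)..t, k s).re, Real.exp_pos _, ?_⟩
  have := is_const_of_deriv_eq_zero (fun t => (hg t).differentiableAt) (fun t => (hg t).deriv) t 0
  simp only [intervalIntegral.integral_same, neg_zero, Complex.exp_zero, mul_one] at this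
  rw [← this, Complex.real_smul, Complex.ofReal_exp]
  set K := ∫ s in (0 : ℝ)..t, k s
  have h1 : Complex.exp K.re * Complex.exp (K.im * Complex.I) = Complex.exp K := by
    rw [← Complex.exp_add, Complex.re_add_im]
  have h2 : Complex.exp (-K) * Complex.exp K = 1 := by rw [← Complex.exp_add]; simp
  linear_combination (-Z t) * h2 + (-Z t * Complex.exp (-K)) * h1

/-- A function on the line whose derivative is bounded below by a positive constant is an order
isomorphism. -/
theorem exists_orderIso {θ θ' : ℝ → ℝ} (hθ : ∀ t, HasDerivAt θ (θ' t) t) {δ : ℝ} (hδ : 0 < δ)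
    (h : ∀ t, δ ≤ θ' t) : ∃ φ : ℝ ≃o ℝ, ∀ t, φ t = θ t := by
  have hd : Differentiable ℝ θ := fun t => (hθ t).differentiableAt
  have hmono : StrictMono θ := strictMono_of_hasDerivAt_pos hθ fun t => hδ.trans_le (h t)
  have hle : ∀ s t, s ≤ t → δ * (t - s) ≤ θ t - θ s := fun s t hst =>
    mul_sub_le_image_sub_of_le_deriv hd (fun t => by rw [(hθ t).deriv]; exact h t) hst
  have htop : Tendsto θ atTop atTop := by
    refine tendsto_atTop_mono' atTop ?_
      (tendsto_atTop_add_const_right _ (θ 0) (tendsto_id.const_mul_atTop hδ))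
    filter_upwards [eventually_ge_atTop 0] with t ht
    have := hle 0 t ht
    simp only [id]; linarith
  have hbot : Tendsto θ atBot atBot := by
    refine tendsto_atBot_mono' atBot ?_
      (tendsto_atBot_add_const_right _ (θ 0) (tendsto_id.const_mul_atBot hδ))
    filter_upwards [eventually_le_atBot 0] with t ht
    have := hle t 0 ht
    simp only [id]; linarith
  exact ⟨hmono.orderIsoOfSurjective θ (hd.continuous.surjective htop hbot), fun t => rfl⟩

/-- The velocity of `centerCoord` along solutions. -/
def centerVelocity (m : Fin 3 → ℝ) (x : E) : ℂ :=
  centerCoord m fun i => 2 * (sq x i * rate m (sq x) i)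

section Rotation

variable {m : Fin 3 → ℝ} {γ : ℝ → E}

theorem IsSphereCurve.hasDerivAt_centerCoord (hγ : IsSphereCurve m γ) (t : ℝ) :
    HasDerivAt (fun s => centerCoord m (sq (γ s))) (centerVelocity m (γ t)) t := by
  have hq : ∀ i, HasDerivAt (fun s => sq (γ s) i / centerWeight m i)
      (2 * (sq (γ t) i * rate m (sq (γ t)) i) / centerWeight m i) t := fun i =>
    (hγ.hasDerivAt_sq t i).div_const _
  have h := (((hq 0).sub (hq 2)).ofReal_comp).add
    ((((hq 1).sub (hq 2)).ofReal_comp).mul_const Complex.I)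
  refine (h.congr_deriv (f' := _) ?_).congr_of_eventuallyEq (Eventually.of_forall fun s => ?_)
  · apply Complex.ext <;> simp [centerVelocity, centerCoord]
  · apply Complex.ext <;> simp [centerCoord]

/-- In the interior the solutions turn counterclockwise around the inner equilibrium. -/
theorem centerVelocity_div_im_pos (hm : ∀ i, 0 < m i) {x : E} (hx : ∀ i, 0 < sq x i)
    (hne : centerCoord m (sq x) ≠ 0) : 0 < (centerVelocity m x / centerCoord m (sq x)).im := by
  have hS : 0 < m 0 + m 1 + m 2 := add_pos (add_pos (hm 0) (hm 1)) (hm 2)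
  have hw := centerWeight_pos hm
  -- In the ratios `q i` the rates are multiples of the differences of the other two ratios, and the
  -- angular velocity is a positive combination of squares of differences.
  obtain ⟨q, hq, hqx⟩ : ∃ q : Fin 3 → ℝ, (∀ i, 0 < q i) ∧ ∀ i, sq x i = centerWeight m i * q i :=
    ⟨fun i => sq x i / centerWeight m i, fun i => div_pos (hx i) (hw i), fun i => by
      rw [mul_div_cancel₀ _ (hw i).ne']⟩
  have hN : 0 < Complex.normSq (centerCoord m (sq x)) := Complex.normSq_pos.2 hne
  rw [Complex.div_im, ← sub_div]
  refine div_pos ?_ hN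
  have hcc : ∀ y : Fin 3 → ℝ, centerCoord m (fun i => centerWeight m i * y i) =
      ⟨y 0 - y 2, y 1 - y 2⟩ := fun y => by
    have h := fun i => (hw i).ne'
    simp [centerCoord, h]
  have h1 : centerCoord m (sq x) = ⟨q 0 - q 2, q 1 - q 2⟩ := by
    rw [← hcc]; congr 1; exact funext hqx
  have h2 : centerVelocity m x = ⟨2 * (q 0 * rate m (sq x) 0) - 2 * (q 2 * rate m (sq x) 2),
      2 * (q 1 * rate m (sq x) 1) - 2 * (q 2 * rate m (sq x) 2)⟩ := by
    rw [← hcc fun i => 2 * (q i * rate m (sq x) i), centerVelocity]; congr 1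
    funext i
    rw [hqx]; ring
  have r0 : rate m (sq x) 0 = m 0 * m 1 / (m 0 + m 1 + m 2) * (q 2 - q 1) := by
    simp only [rate, hqx, centerWeight]; simp; ring
  have r1 : rate m (sq x) 1 = m 0 * m 2 / (m 0 + m 1 + m 2) * (q 0 - q 2) := by
    simp only [rate, hqx, centerWeight]; simp; ring
  have r2 : rate m (sq x) 2 = m 1 * m 2 / (m 0 + m 1 + m 2) * (q 1 - q 0) := by
    simp only [rate, hqx, centerWeight]; simp; ring
  have hn : 0 < (q 0 - q 2) ^ 2 + (q 1 - q 2) ^ 2 := by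
    rw [h1, Complex.normSq_mk] at hN; linarith
  rw [h1, h2, r0, r1, r2]
  have hab : 0 < m 0 * m 1 / (m 0 + m 1 + m 2) := div_pos (mul_pos (hm 0) (hm 1)) hS
  have hac : 0 < m 0 * m 2 / (m 0 + m 1 + m 2) := div_pos (mul_pos (hm 0) (hm 2)) hS
  have hbc : 0 < m 1 * m 2 / (m 0 + m 1 + m 2) := div_pos (mul_pos (hm 1) (hm 2)) hS
  have key : 0 < 2 * (m 0 * m 2 / (m 0 + m 1 + m 2) * q 1 * (q 0 - q 2) ^ 2 +
      m 0 * m 1 / (m 0 + m 1 + m 2) * q 0 * (q 1 - q 2) ^ 2 +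
      m 1 * m 2 / (m 0 + m 1 + m 2) * q 2 * (q 1 - q 0) ^ 2) := by
    have A := mul_pos hac (hq 1)
    have B := mul_pos hab (hq 0)
    have C := mul_nonneg (mul_pos hbc (hq 2)).le (sq_nonneg (q 1 - q 0))
    have hA := mul_nonneg A.le (sq_nonneg (q 0 - q 2))
    have hB := mul_nonneg B.le (sq_nonneg (q 1 - q 2))
    rcases (sq_nonneg (q 0 - q 2)).lt_or_eq with h | h
    · have := mul_pos A h; linarith
    · have := mul_pos B (show 0 < (q 1 - q 2) ^ 2 by linarith); linarith
  refine key.trans_eq ?_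
  simp only
  ring

theorem isCompact_centerLevel (hm : ∀ i, 0 < m i) (f : ℝ) :
    IsCompact {x : E | x ∈ sphere ∧ centerLevel m (sq x) = f} :=
  isCompact_sphere.inter_right
    (isClosed_eq ((continuous_centerLevel hm).comp continuous_sq') continuous_const)

/-- In the coordinate `centerMap m` an inner solution moves on a circle with increasing angle. -/
theorem IsSphereCurve.exists_rotation (hγ : IsSphereCurve m γ) (hm : ∀ i, 0 < m i)
    (h0 : 0 < centerLevel m (sq (γ 0))) (h1 : centerLevel m (sq (γ 0)) < 1) :
    ∃ θ : ℝ ≃o ℝ, θ 0 = 0 ∧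
      ∀ t, centerMap m (γ t) = centerMap m (γ 0) * Complex.exp (θ t * Complex.I) := by
  set f := centerLevel m (sq (γ 0)) with hf
  have hz : ∀ x ∈ {x : E | x ∈ sphere ∧ centerLevel m (sq x) = f},
      centerCoord m (sq x) ≠ 0 := by
    rintro x ⟨hx, hxf⟩ h
    rw [(centerCoord_eq_zero_iff hm (sum_sq hx)).1 h, centerLevel_weight hm] at hxf
    linarith
  have hmem : ∀ t, γ t ∈ {x : E | x ∈ sphere ∧ centerLevel m (sq x) = f} := fun t =>
    ⟨hγ.mem t, hγ.centerLevel_eq hm t⟩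
  have hvc : Continuous (centerVelocity m) := by
    refine continuous_centerCoord.comp (continuous_pi fun i => ?_)
    exact ((continuous_sq i).mul (continuous_rate m i)).const_mul 2
  have hzc : Continuous fun x : E => centerCoord m (sq x) :=
    continuous_centerCoord.comp continuous_sq'
  have hkc : ContinuousOn (fun x : E => centerVelocity m x / centerCoord m (sq x))
      {x : E | x ∈ sphere ∧ centerLevel m (sq x) = f} :=
    hvc.continuousOn.div hzc.continuousOn hz
  -- The level is compact, so that the angular velocity on it is bounded away from `0`.
  obtain ⟨x, hx, hmin⟩ := (isCompact_centerLevel hm f).exists_isMinOn ⟨γ 0, hmem 0⟩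
    (Complex.continuous_im.comp_continuousOn hkc)
  have hδ := centerVelocity_div_im_pos hm
    (pos_of_centerLevel_pos hm (sq_nonneg' x) (hx.2 ▸ h0)) (hz x hx)
  have hk : Continuous fun t => centerVelocity m (γ t) / centerCoord m (sq (γ t)) :=
    hkc.comp_continuous hγ.continuous hmem
  obtain ⟨θ, hθ0, hθ, hR⟩ := exists_angle hk fun t =>
    (hγ.hasDerivAt_centerCoord t).congr_deriv (by rw [mul_div_cancel₀ _ (hz _ (hmem t))])
  obtain ⟨φ, hφ⟩ := exists_orderIso hθ hδ fun t => hmin (hmem t)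
  refine ⟨φ, by rw [hφ, hθ0], fun t => ?_⟩
  obtain ⟨R, hR0, hR⟩ := hR t
  rw [hφ, centerMap, centerMap, (hmem t).2, (hmem 0).2, hR, norm_smul, Complex.norm_mul,
    Complex.norm_exp_ofReal_mul_I, mul_one, Real.norm_of_nonneg hR0.le, smul_smul, smul_mul_assoc]
  congr 1
  have := norm_ne_zero_iff.2 (hz _ (hmem 0))
  field_simp

/-- The levels of the first integral in the interior are periodic orbits. -/
theorem IsSphereCurve.exists_period (hγ : IsSphereCurve m γ) (hm : ∀ i, 0 < m i)
    (h0 : 0 < centerLevel m (sq (γ 0))) (h1 : centerLevel m (sq (γ 0)) < 1) :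
    ∃ T, 0 < T ∧ (∀ t, γ (t + T) = γ t) ∧ InjOn γ (Ico 0 T) ∧
      range γ = {x : E | x ∈ sphere ∧ centerLevel m (sq x) = centerLevel m (sq (γ 0))} := by
  obtain ⟨θ, hθ0, hθ⟩ := hγ.exists_rotation hm h0 h1
  have hc : centerMap m (γ 0) ≠ 0 := by
    rw [← norm_ne_zero_iff, norm_centerMap hm (hγ.mem 0)]; linarith
  have hT : γ (θ.symm (2 * Real.pi)) = γ 0 := by
    refine injOn_centerMap hm (hγ.mem _) (hγ.mem 0) ?_
    rw [hθ, θ.apply_symm_apply]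
    push_cast
    rw [Complex.exp_two_pi_mul_I, mul_one]
  refine ⟨θ.symm (2 * Real.pi), ?_, fun t => ?_, ?_, ?_⟩
  · rw [← θ.lt_iff_lt, hθ0, θ.apply_symm_apply]; positivity
  · exact congrFun ((hγ.shift (θ.symm (2 * Real.pi))).eq_of_eq hγ (s := 0) (by simpa using hT)) t
  · intro s hs t ht hst
    have hI : ∀ {s}, s ∈ Ico 0 (θ.symm (2 * Real.pi)) → θ s ∈ Ico 0 (2 * Real.pi) := fun {s} hs =>
      ⟨hθ0 ▸ θ.monotone hs.1, (θ.lt_iff_lt.2 hs.2).trans_eq (θ.apply_symm_apply _)⟩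
    have h2 : Complex.exp (θ s * Complex.I) = Complex.exp (θ t * Complex.I) := by
      have := hθ s
      rw [hst, hθ t] at this
      exact (mul_left_cancel₀ hc this).symm
    obtain ⟨n, hn⟩ := Complex.exp_eq_exp_iff_exists_int.1 h2
    have h3 : θ s = θ t + n * (2 * Real.pi) := by
      have := congrArg Complex.im hn
      simpa using this
    have hpi := Real.pi_pos
    have a1 := (hI hs).1
    have a2 := (hI hs).2
    have b1 := (hI ht).1
    have b2 := (hI ht).2
    have hn0 : n = 0 := by
      have u1 : (n : ℝ) < 1 := by nlinarith
      have u2 : (-1 : ℝ) < n := by nlinarith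
      have u1' : n < 1 := by exact_mod_cast u1
      have u2' : -1 < n := by exact_mod_cast u2
      omega
    rw [hn0] at h3
    simpa using h3
  · refine Subset.antisymm ?_ fun x hx => ?_
    · rintro _ ⟨t, rfl⟩
      exact ⟨hγ.mem t, hγ.centerLevel_eq hm t⟩
    · have hn : ‖centerMap m x / centerMap m (γ 0)‖ = 1 := by
        rw [norm_div, norm_centerMap hm hx.1, hx.2, ← norm_centerMap hm (hγ.mem 0),
          div_self (norm_ne_zero_iff.2 hc)]
      obtain ⟨φ, hφ⟩ := (Complex.norm_eq_one_iff _).1 hn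
      refine ⟨θ.symm φ, injOn_centerMap hm (hγ.mem _) hx.1 ?_⟩
      rw [hθ, θ.apply_symm_apply, hφ, mul_div_cancel₀ _ hc]

end Rotation

/-! ### The phase portrait with a center -/

section

variable {p : Params}

theorem weight_eq (p : Params) : weight p = centerWeight p.m := by
  funext i
  rw [weight, centerWeight]
  congr 1
  simp only [Params.m]; ring

theorem Qstar_eq (p : Params) : Qstar p = ofSq (centerWeight p.m) := by
  rw [Qstar, weight_eq]; rfl

theorem sq_Qstar (hm : ∀ i, 0 < p.m i) : sq (Qstar p) = centerWeight p.m := by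
  rw [Qstar_eq]; exact funext (sq_ofSq fun i => (centerWeight_pos hm i).le)

theorem Qstar_mem_sphere (hm : ∀ i, 0 < p.m i) : Qstar p ∈ sphere := by
  rw [Qstar_eq]
  exact ofSq_mem_sphere (fun i => (centerWeight_pos hm i).le) (sum_centerWeight hm)

theorem eq_Qstar (hm : ∀ i, 0 < p.m i) {x : E} (hx : x ∈ sphere) (h : sq x = centerWeight p.m) :
    x = Qstar p :=
  sq_inj hx.1 (Qstar_mem_sphere hm).1 fun i => by rw [h, sq_Qstar hm]

theorem centerLevel_lt_one' (hm : ∀ i, 0 < p.m i) {x : E} (hx : x ∈ sphere) (hne : x ≠ Qstar p) :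
    centerLevel p.m (sq x) < 1 :=
  centerLevel_lt_one hm (sq_nonneg' x) (sum_sq hx) fun h => hne (eq_Qstar hm hx h)

theorem isEq_iff_center {m : Fin 3 → ℝ} (hm : ∀ i, 0 < m i) {x : E} (hx : x ∈ sphere) :
    IsEq m x ↔ (∃ i, x = e i) ∨ sq x = centerWeight m := by
  have hS : 0 < m 0 + m 1 + m 2 := add_pos (add_pos (hm 0) (hm 1)) (hm 2)
  have m0 := (hm 0).ne'
  have m1 := (hm 1).ne'
  have m2 := (hm 2).ne'
  constructor
  · intro h
    have e0 := h 0
    have e1 := h 1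
    have e2 := h 2
    simp only [rate] at e0 e1 e2
    simp at e0 e1 e2
    by_cases a0 : sq x 0 = 0
    · rw [a0] at e1 e2
      rcases e1 with a1 | a1
      · exact .inl ⟨2, eq_e_of_zero hx (by decide) (by decide) (by decide) a0 a1⟩
      · have : sq x 2 = 0 := by simpa [m2] using a1
        exact .inl ⟨1, eq_e_of_zero hx (by decide) (by decide) (by decide) a0 this⟩
    by_cases a1 : sq x 1 = 0
    · rw [a1] at e0
      have : sq x 2 = 0 := by simpa [m1, a0] using e0
      exact .inl ⟨0, eq_e_of_zero hx (by decide) (by decide) (by decide) a1 this⟩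
    by_cases a2 : sq x 2 = 0
    · rw [a2] at e0
      have : sq x 1 = 0 := by simpa [m0, a0] using e0
      exact absurd this a1
    · right
      have e0 := e0.resolve_left a0
      have e1 := e1.resolve_left a1
      have hs := sum_sq hx
      ext i
      simp only [centerWeight]
      rw [eq_div_iff hS.ne']
      fin_cases i <;> simp only [Fin.zero_eta, Fin.mk_one, Fin.reduceFinMk,
        show Fin.rev (0 : Fin 3) = 2 from rfl, show Fin.rev (1 : Fin 3) = 1 from rfl,
        show Fin.rev (2 : Fin 3) = 0 from rfl]
      · linear_combination e1 + m 2 * hs - e2.resolve_left a2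
      · linear_combination e2.resolve_left a2 + m 1 * hs - e0
      · linear_combination e0 + m 0 * hs - e1
  · rintro (⟨i, rfl⟩ | h)
    · exact isEq_e m i
    · intro i
      rw [h]
      fin_cases i <;> simp [rate, centerWeight] <;> right <;> ring

theorem hstar_pos (hm : ∀ i, 0 < p.m i) : 0 < hstar p := by
  rw [hstar, weight_eq]
  exact Finset.prod_pos fun i _ => Real.rpow_pos_of_pos (centerWeight_pos hm i) _

/-- The integral `H` is a function of `centerLevel` of the radial projection. -/
theorem H_smul (hm : ∀ i, 0 < p.m i) {x : E} (hx : x ∈ intSphere) {r : ℝ} (hr : 0 < r) :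
    H p (r • x) = hstar p / centerLevel p.m (sq x) := by
  have hw := centerWeight_pos hm
  have hpos := (mem_intSphere_iff.1 hx).2
  have hF := centerLevel_pos hm hpos
  have key : ∀ i, (r • x) i ^ (-(2 * centerWeight p.m i)) =
      r ^ (-(2 * centerWeight p.m i)) * sq x i ^ (-centerWeight p.m i) := by
    intro i
    rw [PiLp.smul_apply, smul_eq_mul, Real.mul_rpow hr.le (hx.1.1 i), sq,
      ← Real.rpow_natCast, ← Real.rpow_mul (hx.1.1 i)]
    congr 2
    push_cast; ring
  have hfac : ∀ i, (sq x i / centerWeight p.m i) ^ centerWeight p.m i *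
      sq x i ^ (-centerWeight p.m i) = centerWeight p.m i ^ (-centerWeight p.m i) := by
    intro i
    rw [Real.div_rpow (hpos i).le (hw i).le, Real.rpow_neg (hpos i).le, Real.rpow_neg (hw i).le]
    have := (Real.rpow_pos_of_pos (hpos i) (centerWeight p.m i)).ne'
    field_simp
  have hrr : r ^ (-(2 * centerWeight p.m 0)) * r ^ (-(2 * centerWeight p.m 1)) *
      r ^ (-(2 * centerWeight p.m 2)) * r ^ 2 = 1 := by
    rw [← Real.rpow_add hr, ← Real.rpow_add hr, ← Real.rpow_natCast, ← Real.rpow_add hr]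
    convert Real.rpow_zero r using 2
    push_cast
    linear_combination -2 * sum_centerWeight hm
  rw [H, norm_smul_sphere hx.1 hr.le, hstar, weight_eq, eq_div_iff hF.ne']
  simp only [Fin.prod_univ_three, key, ← hfac, centerLevel]
  linear_combination ((sq x 0 / centerWeight p.m 0) ^ centerWeight p.m 0 *
      sq x 0 ^ (-centerWeight p.m 0)) *
    ((sq x 1 / centerWeight p.m 1) ^ centerWeight p.m 1 * sq x 1 ^ (-centerWeight p.m 1)) *
    ((sq x 2 / centerWeight p.m 2) ^ centerWeight p.m 2 * sq x 2 ^ (-centerWeight p.m 2)) * hrr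

theorem mem_Gam_iff (hm : ∀ i, 0 < p.m i) {h : ℝ} (hh : hstar p < h) {x : E} :
    x ∈ Gam p h ↔ x ∈ sphere ∧ centerLevel p.m (sq x) = hstar p / h := by
  have hs := hstar_pos hm
  have hh0 : 0 < h := hs.trans hh
  have key : ∀ {x}, x ∈ intSphere → (H p x = h ↔ centerLevel p.m (sq x) = hstar p / h) :=
    fun {x} hx => by
      have h1 := H_smul hm hx one_pos
      have hF := centerLevel_pos hm (mem_intSphere_iff.1 hx).2
      rw [one_smul] at h1
      rw [h1, div_eq_iff hF.ne', eq_div_iff hh0.ne', mul_comm, eq_comm]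
  constructor
  · rintro ⟨hx, hi, hH⟩
    exact ⟨hx, (key ⟨hx, hi⟩).1 hH⟩
  · rintro ⟨hx, hF⟩
    have hi : x ∈ intSphere := mem_intSphere_iff.2 ⟨hx, pos_of_centerLevel_pos hm (sq_nonneg' x)
      (hF ▸ div_pos hs hh0)⟩
    exact ⟨hx, hi.2, (key hi).2 hF⟩

theorem level_bounds (hm : ∀ i, 0 < p.m i) {h : ℝ} (hh : hstar p < h) :
    0 < hstar p / h ∧ hstar p / h < 1 := by
  have hs := hstar_pos hm
  exact ⟨div_pos hs (hs.trans hh), (div_lt_one (hs.trans hh)).2 hh⟩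

theorem centerLevel_surj (hm : ∀ i, 0 < p.m i) {h : ℝ} (hh : hstar p < h) :
    ∃ x ∈ sphere, centerLevel p.m (sq x) = hstar p / h := by
  obtain ⟨h0, h1⟩ := level_bounds hm hh
  obtain ⟨x, hx, hxc⟩ : ((1 - hstar p / h : ℝ) : ℂ) ∈ centerMap p.m '' sphere := by
    rw [image_centerMap hm, mem_closedBall_zero_iff, Complex.norm_real,
      Real.norm_of_nonneg (by linarith)]
    linarith
  refine ⟨x, hx, ?_⟩
  have := norm_centerMap hm hx
  rw [hxc, Complex.norm_real, Real.norm_of_nonneg (by linarith)] at this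
  linarith

theorem isPeriodicOrbit_level (hm : ∀ i, 0 < p.m i) {x : E} (hx : x ∈ sphere)
    (h0 : 0 < centerLevel p.m (sq x)) (h1 : centerLevel p.m (sq x) < 1) :
    IsPeriodicOrbit p {y | y ∈ sphere ∧ centerLevel p.m (sq y) = centerLevel p.m (sq x)} := by
  obtain ⟨γ, hγ, rfl⟩ := exists_isSphereCurve p.m hx
  obtain ⟨T, hT, hper, hinj, hrange⟩ := hγ.exists_period hm h0 h1
  exact ⟨γ, T, (isSphereCurve_iff.1 hγ).1, hT, hper, hinj, hrange.symm⟩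

theorem Gam_eq (hm : ∀ i, 0 < p.m i) {h : ℝ} (hh : hstar p < h) {x : E}
    (hx : centerLevel p.m (sq x) = hstar p / h) :
    Gam p h = {y | y ∈ sphere ∧ centerLevel p.m (sq y) = centerLevel p.m (sq x)} := by
  ext y
  rw [mem_Gam_iff hm hh, ← hx]
  rfl

theorem surrounds_Gam (hm : ∀ i, 0 < p.m i) {h : ℝ} (hh : hstar p < h) :
    Surrounds (Gam p h) (Qstar p) := by
  obtain ⟨h0, h1⟩ := level_bounds hm hh
  have hc : Continuous fun x : E => centerLevel p.m (sq x) :=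
    (continuous_centerLevel hm).comp continuous_sq'
  refine ⟨{x | hstar p / h < centerLevel p.m (sq x)}, {x | centerLevel p.m (sq x) < hstar p / h},
    isOpen_lt continuous_const hc, isOpen_lt hc continuous_const, ?_, ?_, ?_, ?_⟩
  · rw [disjoint_left]
    rintro x ⟨h1, -⟩ ⟨h2, -⟩
    rw [mem_ofPred_eq] at h1 h2
    exact lt_asymm h1 h2
  · ext x
    rw [Set.mem_sdiff, mem_Gam_iff hm hh]
    constructor
    · rintro ⟨hx, hne⟩
      refine ⟨?_, hx⟩
      rcases lt_or_gt_of_ne (fun h => hne ⟨hx, h⟩) with h | h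
      · exact .inr h
      · exact .inl h
    · rintro ⟨h | h, hx⟩ <;> rw [mem_ofPred_eq] at h
      · exact ⟨hx, fun h' => h.ne' h'.2⟩
      · exact ⟨hx, fun h' => h.ne h'.2⟩
  · rw [mem_ofPred_eq, sq_Qstar hm, centerLevel_weight hm]
    exact h1
  · rintro x ⟨hx, -, i, hi⟩
    rw [mem_ofPred_eq, centerLevel_eq_zero hm (sq_eq_zero_iff'.2 hi)]
    exact h0

theorem isCenter_Qstar (hm : ∀ i, 0 < p.m i) : IsCenterOnSphere p (Qstar p) := by
  have hQ := Qstar_mem_sphere hm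
  have hc : Continuous fun x : E => centerLevel p.m (sq x) :=
    (continuous_centerLevel hm).comp continuous_sq'
  refine ⟨hQ, (isEq_iff_field hQ).1 ((isEq_iff_center hm hQ).2 (.inr (sq_Qstar hm))), ?_⟩
  intro U hU
  -- Outside `U` the first integral stays away from its maximum.
  obtain ⟨f, hf0, hf1, hf⟩ : ∃ f : ℝ, 0 ≤ f ∧ f < 1 ∧
      ∀ x ∈ sphere, f < centerLevel p.m (sq x) → x ∈ U := by
    have hK : IsCompact (sphere \ interior U) := isCompact_sphere.diff isOpen_interior
    rcases (sphere \ interior U).eq_empty_or_nonempty with hem | hne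
    · exact ⟨0, le_rfl, one_pos, fun x hx _ => interior_subset (sdiff_eq_empty.1 hem hx)⟩
    · obtain ⟨y, hy, hmax⟩ := hK.exists_isMaxOn hne hc.continuousOn
      refine ⟨_, centerLevel_nonneg hm (sq_nonneg' y), centerLevel_lt_one' hm hy.1 fun h => ?_,
        fun x hx hlt => ?_⟩
      · exact hy.2 (h ▸ mem_interior_iff_mem_nhds.2 hU)
      · by_contra hxU
        exact hlt.not_ge (hmax ⟨hx, fun h => hxU (interior_subset h)⟩)
  refine ⟨{x | f < centerLevel p.m (sq x)}, (isOpen_lt continuous_const hc).mem_nhds ?_, ?_⟩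
  · rw [mem_ofPred_eq, sq_Qstar hm, centerLevel_weight hm]
    exact hf1
  · rintro x ⟨hxf, hx⟩ hne
    rw [mem_ofPred_eq] at hxf
    refine ⟨{y | y ∈ sphere ∧ centerLevel p.m (sq y) = centerLevel p.m (sq x)}, ⟨hx, rfl⟩, ?_,
      isPeriodicOrbit_level hm hx (hf0.trans_lt hxf) (centerLevel_lt_one' hm hx hne)⟩
    rintro y ⟨hy, hyx⟩
    exact ⟨hf y hy (hyx.symm ▸ hxf), hy⟩

theorem mem_bdSphere_cases {x : E} (hx : x ∈ sphere) (h : ∃ i, sq x i = 0) :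
    (∃ i, x = e i) ∨ x ∈ openArc 0 1 ∨ x ∈ openArc 1 2 ∨ x ∈ openArc 0 2 := by
  rw [mem_openArc_iff (i := 0) (j := 1) (k := 2) (by decide) (by decide) (by decide),
    mem_openArc_iff (i := 1) (j := 2) (k := 0) (by decide) (by decide) (by decide),
    mem_openArc_iff (i := 0) (j := 2) (k := 1) (by decide) (by decide) (by decide)]
  have hp : ∀ i, sq x i ≠ 0 → 0 < sq x i := fun i hi => (sq_nonneg' x i).lt_of_ne' hi
  by_cases a0 : sq x 0 = 0
  · by_cases a1 : sq x 1 = 0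
    · exact .inl ⟨2, eq_e_of_zero hx (by decide) (by decide) (by decide) a0 a1⟩
    by_cases a2 : sq x 2 = 0
    · exact .inl ⟨1, eq_e_of_zero hx (by decide) (by decide) (by decide) a0 a2⟩
    · exact .inr (.inr (.inl ⟨hx, a0, hp 1 a1, hp 2 a2⟩))
  by_cases a1 : sq x 1 = 0
  · by_cases a2 : sq x 2 = 0
    · exact .inl ⟨0, eq_e_of_zero hx (by decide) (by decide) (by decide) a1 a2⟩
    · exact .inr (.inr (.inr ⟨hx, a1, hp 0 a0, hp 2 a2⟩))
  · refine .inr (.inl ⟨hx, ?_, hp 0 a0, hp 1 a1⟩)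
    obtain ⟨i, hi⟩ := h
    fin_cases i
    · exact absurd hi a0
    · exact absurd hi a1
    · exact hi

theorem bdSphere_eq :
    bdSphere = {e 0, e 1, e 2} ∪ (openArc 0 1 ∪ openArc 1 2 ∪ openArc 0 2) := by
  ext x
  constructor
  · rintro ⟨hx, -, i, hi⟩
    rcases mem_bdSphere_cases hx ⟨i, sq_eq_zero_iff'.2 hi⟩ with ⟨j, rfl⟩ | h | h | h
    · left; fin_cases j <;> simp
    · exact .inr (.inl (.inl h))
    · exact .inr (.inl (.inr h))
    · exact .inr (.inr h)
  · have key : ∀ x ∈ sphere, ∀ i, sq x i = 0 → x ∈ bdSphere := fun x hx i hi =>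
      ⟨hx, hx.1, i, sq_eq_zero_iff'.1 hi⟩
    rintro ((rfl | rfl | rfl) | (h | h) | h)
    · exact key _ (e_mem_sphere 0) 1 (by simp [sq_e])
    · exact key _ (e_mem_sphere 1) 0 (by simp [sq_e])
    · exact key _ (e_mem_sphere 2) 0 (by simp [sq_e])
    · rw [mem_openArc_iff (k := 2) (by decide) (by decide) (by decide)] at h
      exact key x h.1 2 h.2.1
    · rw [mem_openArc_iff (k := 0) (by decide) (by decide) (by decide)] at h
      exact key x h.1 0 h.2.1
    · rw [mem_openArc_iff (k := 1) (by decide) (by decide) (by decide)] at h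
      exact key x h.1 1 h.2.1

/-- On the boundary of the sphere all solutions converge to vertices when all `m i` are positive. -/
theorem IsSphereCurve.center_boundary_limit {m : Fin 3 → ℝ} {γ : ℝ → E} (hγ : IsSphereCurve m γ)
    (hm : ∀ i, 0 < m i) (h : ∃ i, sq (γ 0) i = 0) : ∃ i, Tendsto γ atTop (𝓝 (e i)) := by
  rcases mem_bdSphere_cases (hγ.mem 0) h with ⟨j, hj⟩ | h | h | h
  · refine ⟨j, tendsto_const_nhds.congr fun t => ?_⟩
    rw [hγ.eq_const (hj ▸ isEq_e m j) t, hj]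
  · rw [openArc_comm] at h
    exact ⟨1, (hγ.edge (k := 2) (κ := m 0) (by decide) (by decide) (by decide) (hm 0)
      (fun y hy => by simp [rate, hy]) h).2.2.1⟩
  · rw [openArc_comm] at h
    exact ⟨2, (hγ.edge (k := 0) (κ := m 2) (by decide) (by decide) (by decide) (hm 2)
      (fun y hy => by simp [rate, hy]) h).2.2.1⟩
  · exact ⟨0, (hγ.edge (k := 1) (κ := m 1) (by decide) (by decide) (by decide) (hm 1)
      (fun y hy => by simp [rate, hy]) h).2.2.1⟩

theorem smul_mem_intOctant {x : E} (hx : x ∈ intOctant) {r : ℝ} (hr : 0 < r) :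
    r • x ∈ intOctant := fun i => by simpa using mul_pos hr (hx i)

theorem omega_cone (hm : ∀ i, 0 < p.m i) {h : ℝ} (hh : hstar p < h) {x : E} (hx : x ∈ cone p h) :
    omega p x = Gam p h := by
  obtain ⟨u, hu, hr, hxu, hux⟩ := exists_polar p.m (intOctant_subset hx.1)
  have hui : u 0 ∈ intSphere := ⟨hu.mem 0, hux ▸ smul_mem_intOctant hx.1 (inv_pos.2 hr)⟩
  obtain ⟨h0, h1⟩ := level_bounds hm hh
  have hF : centerLevel p.m (sq (u 0)) = hstar p / h := by
    have e1 := H_smul hm hui hr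
    rw [← hxu, hx.2] at e1
    have hpos := centerLevel_pos hm (mem_intSphere_iff.1 hui).2
    rw [e1]
    have := (hstar_pos hm).ne'
    field_simp
  rw [Gam_eq hm hh hF]
  obtain ⟨T, hT, hper, -, hrange⟩ := hu.exists_period hm (hF ▸ h0) (hF ▸ h1)
  nth_rw 1 [hxu]
  rw [omega_smul hu hr]
  refine Subset.antisymm ?_ ?_
  · rintro y ⟨t, -, hy⟩
    refine (isCompact_centerLevel hm _).isClosed.mem_of_tendsto hy
      (Eventually.of_forall fun k => ?_)
    exact ⟨hu.mem _, hu.centerLevel_eq hm _⟩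
  · rw [← hrange]
    rintro _ ⟨s, rfl⟩
    refine ⟨fun k => k * T + s, tendsto_atTop_add_const_right _ _
      (tendsto_natCast_atTop_atTop.atTop_mul_const hT), ?_⟩
    have hk : ∀ k : ℕ, u (k * T + s) = u s := by
      intro k
      induction k with
      | zero => simp
      | succ k ih => rw [← ih, ← hper (k * T + s)]; congr 1; push_cast; ring
    simp only [hk]
    exact tendsto_const_nhds

theorem center_case (h0 : 0 < p.m 0) (h1 : 0 < p.m 1) (h2 : 0 < p.m 2) :
    equilibria p = {0, e 0, e 1, e 2, Qstar p} ∧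
      sphere = (⋃ h ∈ Ioi (hstar p), Gam p h) ∪ {Qstar p} ∪ bdSphere ∧
      (∀ h, hstar p < h → IsPeriodicOrbit p (Gam p h) ∧ Surrounds (Gam p h) (Qstar p)) ∧
      IsCenterOnSphere p (Qstar p) ∧
      bdSphere = {e 0, e 1, e 2} ∪ (openArc 0 1 ∪ openArc 1 2 ∪ openArc 0 2) ∧
      IsHeteroclinicOrbit p (openArc 0 1) (e 0) (e 1) ∧
      IsHeteroclinicOrbit p (openArc 1 2) (e 1) (e 2) ∧
      IsHeteroclinicOrbit p (openArc 0 2) (e 2) (e 0) ∧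
      intOctant = (⋃ h ∈ Ioi (hstar p), cone p h) ∪ ray (Qstar p) ∧
      (∀ h, hstar p < h → ∀ x ∈ cone p h, omega p x = Gam p h) ∧
      (∀ x ∈ ray (Qstar p), omega p x = {Qstar p}) ∧
      (∀ x ∈ bdOctant \ {0}, ∃ i, omega p x = {e i}) := by
  have hm : ∀ i, 0 < p.m i := by intro i; fin_cases i <;> assumption
  have hs := hstar_pos hm
  have hQ := Qstar_mem_sphere hm
  have hQi : Qstar p ∈ intSphere := mem_intSphere_iff.2 ⟨hQ, fun i => by
    rw [sq_Qstar hm]; exact centerWeight_pos hm i⟩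
  have hQe : IsEq p.m (Qstar p) := (isEq_iff_center hm hQ).2 (.inr (sq_Qstar hm))
  have hlev : ∀ {x}, x ∈ intSphere → x ≠ Qstar p → hstar p < hstar p / centerLevel p.m (sq x) :=
    fun {x} hx hne => by
      rw [lt_div_iff₀ (centerLevel_pos hm (mem_intSphere_iff.1 hx).2)]
      exact mul_lt_of_lt_one_right hs (centerLevel_lt_one' hm hx.1 hne)
  refine ⟨?_, ?_, fun h hh => ⟨?_, surrounds_Gam hm hh⟩, isCenter_Qstar hm, bdSphere_eq, ?_, ?_, ?_,
    ?_, fun h hh x hx => omega_cone hm hh hx, ?_, ?_⟩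
  · rw [union_setOf_eq (S := {e 0, e 1, e 2, Qstar p}) ?_ ?_]
    · rfl
    · rintro x (rfl | rfl | rfl | rfl)
      · exact e_mem_sphere _
      · exact e_mem_sphere _
      · exact e_mem_sphere _
      · exact hQ
    · intro x hx
      have : sq x = centerWeight p.m ↔ x = Qstar p :=
        ⟨eq_Qstar hm hx, fun h => by rw [h, sq_Qstar hm]⟩
      rw [isEq_iff_center hm hx, this]
      simp [Fin.exists_fin_succ, or_assoc]
  · ext x
    simp only [mem_union, mem_iUnion, mem_singleton_iff, exists_prop]
    constructor
    · intro hx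
      by_cases hi : ∀ i, 0 < sq x i
      · have hxi := mem_intSphere_iff.2 ⟨hx, hi⟩
        by_cases hne : x = Qstar p
        · exact .inl (.inr hne)
        · refine .inl (.inl ⟨_, hlev hxi hne, (mem_Gam_iff hm (hlev hxi hne)).2 ⟨hx, ?_⟩⟩)
          have := (centerLevel_pos hm hi).ne'
          have := hs.ne'
          field_simp
      · push Not at hi
        obtain ⟨i, hi⟩ := hi
        exact .inr ⟨hx, hx.1, i, sq_eq_zero_iff'.1 (le_antisymm hi (sq_nonneg' x i))⟩
    · rintro ((⟨h, -, hx⟩ | rfl) | hx)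
      · exact hx.1
      · exact hQ
      · exact hx.1
  · obtain ⟨x, hx, hxF⟩ := centerLevel_surj hm hh
    obtain ⟨hl0, hl1⟩ := level_bounds hm hh
    rw [Gam_eq hm hh hxF]
    exact isPeriodicOrbit_level hm hx (hxF ▸ hl0) (hxF ▸ hl1)
  · rw [openArc_comm]
    exact heteroclinic_edge (k := 2) (κ := p.m 0) (by decide) (by decide) (by decide)
      h0 fun y hy => by simp [rate, hy]
  · rw [openArc_comm]
    exact heteroclinic_edge (k := 0) (κ := p.m 2) (by decide) (by decide) (by decide)
      h2 fun y hy => by simp [rate, hy]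
  · exact heteroclinic_edge (k := 1) (κ := p.m 1) (by decide) (by decide) (by decide)
      h1 fun y hy => by simp [rate, hy]
  · ext x
    simp only [mem_union, mem_iUnion, exists_prop]
    constructor
    · intro hx
      have hx0 := intOctant_subset hx
      have hr : 0 < ‖x‖ := norm_pos_iff.2 hx0.2
      have hui : ‖x‖⁻¹ • x ∈ intSphere :=
        ⟨normalize_mem_sphere hx0, smul_mem_intOctant hx (inv_pos.2 hr)⟩
      have hxu : x = ‖x‖ • ‖x‖⁻¹ • x := (smul_inv_smul₀ hr.ne' x).symm
      by_cases hne : ‖x‖⁻¹ • x = Qstar p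
      · exact .inr ⟨‖x‖, hr, by rw [← hne, ← hxu]⟩
      · exact .inl ⟨_, hlev hui hne, hx, by rw [← H_smul hm hui hr, ← hxu]⟩
    · rintro (⟨h, -, hx⟩ | ⟨r, hr, rfl⟩)
      · exact hx.1
      · exact smul_mem_intOctant hQi.2 hr
  · rintro _ ⟨r, hr, rfl⟩
    exact omega_eq_singleton (IsSphereCurve.of_isEq hQ hQe) hr tendsto_const_nhds
  · intro x hx
    obtain ⟨hx0, i, hi⟩ := exists_zero_of_bdOctant hx
    obtain ⟨u, hu, hpos, -, ho⟩ := exists_curve_omega p hx0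
    obtain ⟨j, hj⟩ := hu.center_boundary_limit hm ⟨i, le_antisymm
      (not_lt.1 fun h => ((hpos i).1 h).ne' hi) (sq_nonneg' _ _)⟩
    exact ⟨j, ho _ hj⟩

end

/-! ### Orbital equivalence -/

/-- Topological equivalence with preserved direction of time, in terms of the vectors `m` of the
two systems. Reversal of time amounts to a change of sign of `m`, see `topEquiv_iff`. -/
def OrbitEquiv (m m' : Fin 3 → ℝ) : Prop :=
  ∃ φ : sphere ≃ₜ sphere, ∀ γ : ℝ → sphere, IsSphereCurve m (fun t => (γ t : E)) →
    ∃ τ : ℝ ≃o ℝ, IsSphereCurve m' (fun t => (φ (γ (τ t)) : E))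

theorem exists_conj_neg (τ : ℝ ≃o ℝ) : ∃ τ' : ℝ ≃o ℝ, ∀ t, τ' t = -τ (-t) := by
  have hm : StrictMono fun t => -τ (-t) := fun s t h =>
    neg_lt_neg (τ.strictMono (neg_lt_neg h))
  exact ⟨hm.orderIsoOfSurjective _ fun t => ⟨-τ.symm (-t), by simp⟩, fun t => rfl⟩

namespace OrbitEquiv

variable {m m' m'' : Fin 3 → ℝ}

theorem refl (m : Fin 3 → ℝ) : OrbitEquiv m m :=
  ⟨Homeomorph.refl _, fun _ hγ => ⟨OrderIso.refl ℝ, hγ⟩⟩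

theorem trans : OrbitEquiv m m' → OrbitEquiv m' m'' → OrbitEquiv m m'' := by
  rintro ⟨φ, hφ⟩ ⟨χ, hχ⟩
  refine ⟨φ.trans χ, fun γ hγ => ?_⟩
  obtain ⟨τ, hτ⟩ := hφ γ hγ
  obtain ⟨σ, hσ⟩ := hχ _ hτ
  exact ⟨σ.trans τ, hσ⟩

theorem symm : OrbitEquiv m m' → OrbitEquiv m' m := by
  rintro ⟨φ, hφ⟩
  refine ⟨φ.symm, fun δ hδ => ?_⟩
  obtain ⟨γ, hγ, h0⟩ := exists_isSphereCurve m (φ.symm (δ 0)).2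
  obtain ⟨τ, hτ⟩ := hφ (fun t => ⟨γ t, hγ.mem t⟩) hγ
  -- The image of the solution through `φ.symm (δ 0)` is a time shift of `δ`.
  have h1 := (hτ.shift (τ.symm 0)).eq_of_eq hδ (s := 0) (by
    have : (⟨γ 0, hγ.mem 0⟩ : sphere) = φ.symm (δ 0) := Subtype.ext h0
    simp [this])
  have h2 : ∀ t, φ.symm (δ t) = ⟨γ (τ (t + τ.symm 0)), hγ.mem _⟩ := fun t => by
    rw [Homeomorph.symm_apply_eq]
    exact Subtype.ext (congrFun h1 t).symm
  refine ⟨τ.symm.trans (OrderIso.addRight (-τ.symm 0)), ?_⟩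
  convert hγ using 2 with t
  simp [h2]

protected theorem neg : OrbitEquiv m m' → OrbitEquiv (fun i => -m i) (fun i => -m' i) := by
  rintro ⟨φ, hφ⟩
  refine ⟨φ, fun γ hγ => ?_⟩
  obtain ⟨τ, hτ⟩ := hφ (fun t => γ (-t)) (by simpa using hγ.reverse)
  obtain ⟨τ', hτ'⟩ := exists_conj_neg τ
  exact ⟨τ', by simpa [hτ'] using hτ.reverse⟩

theorem smul (m : Fin 3 → ℝ) {c : ℝ} (hc : 0 < c) : OrbitEquiv m fun i => c * m i :=
  ⟨Homeomorph.refl _, fun γ hγ => ⟨OrderIso.mulLeft₀ c hc, by simpa using hγ.comp_affine c 0⟩⟩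

end OrbitEquiv

/-- Topological equivalence in terms of the vectors `m`, with time preserved or reversed. -/
def WeakEquiv (m m' : Fin 3 → ℝ) : Prop := OrbitEquiv m m' ∨ OrbitEquiv (fun i => -m i) m'

theorem topEquiv_iff {p q : Params} : TopEquiv p q ↔ WeakEquiv p.m q.m := by
  have hc : ∀ (r : Params) (γ : ℝ → sphere),
      IsTrajectory r (fun t => (γ t : E)) ↔ IsSphereCurve r.m fun t => (γ t : E) := fun r γ =>
    ⟨fun h => isSphereCurve_iff.2 ⟨h, fun t => (γ t).2⟩, fun h => (isSphereCurve_iff.1 h).1⟩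
  constructor
  · rintro ⟨φ, ε, rfl | rfl, h⟩
    · refine .inl ⟨φ, fun γ hγ => ?_⟩
      obtain ⟨τ, hτ⟩ := h γ ((hc p γ).2 hγ)
      exact ⟨τ, by simpa using (hc q fun t => φ (γ (1 * τ t))).1 hτ⟩
    · refine .inr ⟨φ, fun γ hγ => ?_⟩
      obtain ⟨τ, hτ⟩ := h (fun t => γ (-t)) ((hc p fun t => γ (-t)).2 (by simpa using hγ.reverse))
      exact ⟨τ, by simpa using (hc q fun t => φ (γ (-(-1 * τ t)))).1 hτ⟩
  · rintro (⟨φ, h⟩ | ⟨φ, h⟩)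
    · refine ⟨φ, 1, .inl rfl, fun γ hγ => ?_⟩
      obtain ⟨τ, hτ⟩ := h γ ((hc p γ).1 hγ)
      exact ⟨τ, (hc q fun t => φ (γ (1 * τ t))).2 (by simpa using hτ)⟩
    · refine ⟨φ, -1, .inr rfl, fun γ hγ => ?_⟩
      obtain ⟨τ, hτ⟩ := h (fun t => γ (-t)) ((hc p γ).1 hγ).reverse
      exact ⟨τ, (hc q fun t => φ (γ (-1 * τ t))).2 (by simpa using hτ)⟩

namespace WeakEquiv

variable {m m' m'' : Fin 3 → ℝ}

theorem symm : WeakEquiv m m' → WeakEquiv m' m := by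
  rintro (h | h)
  · exact .inl h.symm
  · exact .inr (by simpa using h.symm.neg)

theorem trans : WeakEquiv m m' → WeakEquiv m' m'' → WeakEquiv m m'' := by
  rintro (h | h) (h' | h')
  · exact .inl (h.trans h')
  · exact .inr (h.neg.trans h')
  · exact .inr (h.trans h')
  · have := h.neg
    simp only [neg_neg] at this
    exact .inl (this.trans h')

theorem of_neg (m : Fin 3 → ℝ) : WeakEquiv m fun i => -m i := .inr (OrbitEquiv.refl _)

/-- An exchange of the coordinates `Fin.rev i` and `Fin.rev j` of the phase space exchanges `m i`
and `m j` and changes the sign of `m`; reversal of time compensates for the sign. -/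
theorem swap (m : Fin 3 → ℝ) (i j : Fin 3) : WeakEquiv m (m ∘ Equiv.swap i j) := by
  by_cases hij : i = j
  · subst hij
    rw [Equiv.swap_self]
    exact .inl (OrbitEquiv.refl m)
  set σ := Equiv.swap (Fin.rev i) (Fin.rev j) with hσ
  let f : E → E := fun x => WithLp.toLp 2 fun k => x (σ k)
  have hf : Continuous f := (PiLp.continuous_toLp 2 _).comp (by fun_prop)
  have hff : ∀ x, f (f x) = x := fun x => by
    ext k; simp [f, hσ]
  have hrate : ∀ (y : Fin 3 → ℝ) k,
      rate (fun l => -(m ∘ Equiv.swap i j) l) (fun l => y (σ l)) k = rate m y (σ k) := by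
    intro y k
    rw [hσ]
    clear_value σ
    fin_cases i <;> fin_cases j <;> simp at hij <;> fin_cases k <;>
      simp [rate, Equiv.swap_apply_def, Fin.rev] <;> ring
  have hmem : ∀ x ∈ sphere, f x ∈ sphere := by
    intro x hx
    refine ⟨fun k => hx.1 _, ?_⟩
    have h1 := Equiv.sum_comp σ fun k => x k ^ 2
    simp only [Fin.sum_univ_three] at h1
    exact h1.trans hx.2
  let φ : sphere ≃ₜ sphere :=
    { toFun := fun x => ⟨f x, hmem x x.2⟩
      invFun := fun x => ⟨f x, hmem x x.2⟩
      left_inv := fun x => Subtype.ext (hff x)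
      right_inv := fun x => Subtype.ext (hff x)
      continuous_toFun := by fun_prop
      continuous_invFun := by fun_prop }
  have key : OrbitEquiv m fun l => -(m ∘ Equiv.swap i j) l := by
    refine ⟨φ, fun γ hγ => ⟨OrderIso.refl ℝ, fun t => (φ (γ t)).2, fun t k => ?_⟩⟩
    refine (hγ.deriv t (σ k)).congr_deriv ?_
    change _ = (γ t : E) (σ k) * rate _ (fun l => sq (γ t : E) (σ l)) k
    rw [hrate]
  exact WeakEquiv.trans (.inl key)
    (by simpa [Function.comp_def] using of_neg fun l => -(m ∘ Equiv.swap i j) l)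

end WeakEquiv

/-! ### Construction of equivalences -/

/-- Two systems are equivalent if there are coordinates on the sphere for each of them with the same
image and with the same oriented orbits. -/
theorem OrbitEquiv.of_coordinates {Y : Type*} [TopologicalSpace Y] [T2Space Y] {m m' : Fin 3 → ℝ}
    {ψ ψ' : E → Y} (hc : ContinuousOn ψ sphere) (hc' : ContinuousOn ψ' sphere)
    (hi : InjOn ψ sphere) (hi' : InjOn ψ' sphere) (him : ψ '' sphere = ψ' '' sphere)
    (h : ∀ γ δ, IsSphereCurve m γ → IsSphereCurve m' δ → ψ (γ 0) = ψ' (δ 0) →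
      ∃ τ : ℝ ≃o ℝ, ∀ t, ψ' (δ t) = ψ (γ (τ t))) : OrbitEquiv m m' := by
  have : CompactSpace sphere := isCompact_iff_compactSpace.1 isCompact_sphere
  have hom : ∀ {ψ : E → Y}, ContinuousOn ψ sphere → InjOn ψ sphere →
      ∃ χ : sphere ≃ₜ ψ '' sphere, ∀ x, (χ x : Y) = ψ x := by
    intro ψ hc hi
    let e₀ : sphere ≃ ψ '' sphere := Equiv.Set.imageOfInjOn ψ sphere hi
    have he : Continuous e₀ :=
      Continuous.subtype_mk (continuousOn_iff_continuous_domRestrict.1 hc) _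
    exact ⟨he.homeoOfEquivCompactToT2, fun x => rfl⟩
  obtain ⟨χ, hχ⟩ := hom hc hi
  obtain ⟨χ', hχ'⟩ := hom hc' hi'
  let φ : sphere ≃ₜ sphere := (χ.trans (Homeomorph.setCongr him)).trans χ'.symm
  have hφ : ∀ x, ψ' (φ x) = ψ x := fun x => by
    rw [← hχ', ← hχ]
    simp [φ]
    rfl
  refine ⟨φ, fun γ hγ => ?_⟩
  obtain ⟨δ, hδ, h0⟩ := exists_isSphereCurve m' (φ (γ 0)).2
  obtain ⟨τ, hτ⟩ := h _ δ hγ hδ (by rw [h0, hφ])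
  refine ⟨τ, ?_⟩
  convert hδ using 2 with t
  exact hi' (φ (γ (τ t))).2 (hδ.mem t) (by rw [hφ, hτ])

theorem range_eq_Ioo {f : ℝ → ℝ} (hf : Continuous f) (hm : StrictMono f) {a b : ℝ}
    (ha : Tendsto f atBot (𝓝 a)) (hb : Tendsto f atTop (𝓝 b)) : range f = Ioo a b := by
  refine Subset.antisymm ?_ fun x hx => ?_
  · rintro _ ⟨t, rfl⟩
    exact ⟨(hm.monotone.le_of_tendsto ha (t - 1)).trans_lt (hm (by linarith)),
      (hm (show t < t + 1 by linarith)).trans_le (hm.monotone.ge_of_tendsto hb (t + 1))⟩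
  · obtain ⟨s, hs⟩ := (ha.eventually_lt_const hx.1).exists
    obtain ⟨t, ht⟩ := (hb.eventually_const_lt hx.2).exists
    exact mem_range_of_exists_le_of_exists_ge hf ⟨s, hs.le⟩ ⟨t, ht.le⟩

/-- Two strictly increasing functions with the same range are reparametrizations of each other. -/
theorem exists_reparam {f g : ℝ → ℝ} (hf : StrictMono f) (hg : StrictMono g)
    (h : range f = range g) : ∃ τ : ℝ ≃o ℝ, ∀ t, g t = f (τ t) := by
  refine ⟨(hg.orderIso g).trans ((OrderIso.setCongr _ _ h.symm).trans (hf.orderIso f).symm),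
    fun t => ?_⟩
  have := (hf.orderIso f).apply_symm_apply (OrderIso.setCongr _ _ h.symm (hg.orderIso g t))
  exact (congrArg Subtype.val this).symm

/-- Coordinates on the sphere in which the orbits are described by data that do not depend on the
system: `B` is the image of the sphere, `Z` the image of the equilibria, `lab` is constant along the
other orbits and `pos` increases along them, from `lo` to `hi`. -/
structure IsModel (m : Fin 3 → ℝ) (ψ : E → ℝ × ℝ) (B Z : Set (ℝ × ℝ))
    (pos lab lo hi : ℝ × ℝ → ℝ) : Prop where
  cont : ContinuousOn ψ sphere
  inj : InjOn ψ sphere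
  image : ψ '' sphere = B
  isEq : ∀ x ∈ sphere, ψ x ∈ Z → IsEq m x
  not_mem : ∀ γ, IsSphereCurve m γ → ψ (γ 0) ∉ Z → ∀ t, ψ (γ t) ∉ Z
  lab_eq : ∀ γ, IsSphereCurve m γ → ψ (γ 0) ∉ Z → ∀ t, lab (ψ (γ t)) = lab (ψ (γ 0))
  mono : ∀ γ, IsSphereCurve m γ → ψ (γ 0) ∉ Z → StrictMono fun t => pos (ψ (γ t))
  lim_bot : ∀ γ, IsSphereCurve m γ → ψ (γ 0) ∉ Z →
    Tendsto (fun t => pos (ψ (γ t))) atBot (𝓝 (lo (ψ (γ 0))))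
  lim_top : ∀ γ, IsSphereCurve m γ → ψ (γ 0) ∉ Z →
    Tendsto (fun t => pos (ψ (γ t))) atTop (𝓝 (hi (ψ (γ 0))))

theorem IsModel.orbitEquiv {m m' : Fin 3 → ℝ} {ψ ψ' : E → ℝ × ℝ} {B Z : Set (ℝ × ℝ)}
    {pos lab lo hi : ℝ × ℝ → ℝ} (h : IsModel m ψ B Z pos lab lo hi)
    (h' : IsModel m' ψ' B Z pos lab lo hi) (hpos : Continuous pos)
    (hinj : ∀ y ∈ B \ Z, ∀ z ∈ B \ Z, pos y = pos z → lab y = lab z → y = z) :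
    OrbitEquiv m m' := by
  refine .of_coordinates h.cont h'.cont h.inj h'.inj (h.image.trans h'.image.symm)
    fun γ δ hγ hδ h0 => ?_
  by_cases hZ : ψ (γ 0) ∈ Z
  · refine ⟨OrderIso.refl ℝ, fun t => ?_⟩
    rw [hγ.eq_const (h.isEq _ (hγ.mem 0) hZ), hδ.eq_const (h'.isEq _ (hδ.mem 0) (h0 ▸ hZ)), h0]
  · have hZ' : ψ' (δ 0) ∉ Z := h0 ▸ hZ
    have hc : Continuous fun t => pos (ψ (γ t)) :=
      hpos.comp (h.cont.comp_continuous hγ.continuous hγ.mem)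
    have hc' : Continuous fun t => pos (ψ' (δ t)) :=
      hpos.comp (h'.cont.comp_continuous hδ.continuous hδ.mem)
    obtain ⟨τ, hτ⟩ := exists_reparam (h.mono γ hγ hZ) (h'.mono δ hδ hZ') (by
      rw [range_eq_Ioo hc (h.mono γ hγ hZ) (h.lim_bot γ hγ hZ) (h.lim_top γ hγ hZ), h0]
      exact (range_eq_Ioo hc' (h'.mono δ hδ hZ') (h'.lim_bot δ hδ hZ') (h'.lim_top δ hδ hZ')).symm)
    refine ⟨τ, fun t => hinj _ ⟨?_, h'.not_mem δ hδ hZ' t⟩ _ ⟨?_, h.not_mem γ hγ hZ _⟩ (hτ t) ?_⟩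
    · exact h'.image ▸ mem_image_of_mem _ (hδ.mem t)
    · exact h.image ▸ mem_image_of_mem _ (hγ.mem _)
    · rw [h'.lab_eq δ hδ hZ', h.lab_eq γ hγ hZ, h0]

/-- Coordinates `(W, width W * ρ)` on the sphere built from a function `W` whose fibres are arcs,
parametrized by `c p` on `[0, 1]`, and a function `ρ` that increases from `r₀` to `r₁` along each fibre. The fibres
over the zeros of `width` are points. -/
theorem fibered_coordinates {W ρ : E → ℝ} {width : ℝ → ℝ} {a b r₀ r₁ : ℝ} {c : ℝ → ℝ → E}
    (hW : Continuous W) (hwidth : Continuous width) (hw : ∀ p ∈ Icc a b, 0 ≤ width p)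
    (hmem : ∀ p ∈ Icc a b, ∀ s ∈ Icc (0 : ℝ) 1, c p s ∈ sphere ∧ W (c p s) = p)
    (hsurj : ∀ x ∈ sphere, W x ∈ Icc a b ∧ ∃ s ∈ Icc (0 : ℝ) 1, x = c (W x) s)
    (hρc : ∀ x ∈ sphere, 0 < width (W x) → ContinuousAt ρ x)
    (hρb : ∀ x ∈ sphere, |ρ x| ≤ 1)
    (hmono : ∀ p ∈ Icc a b, 0 < width p → StrictMonoOn (fun s => ρ (c p s)) (Icc 0 1))
    (hcont : ∀ p ∈ Icc a b, 0 < width p → ContinuousOn (fun s => ρ (c p s)) (Icc 0 1))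
    (h0 : ∀ p ∈ Icc a b, 0 < width p → ρ (c p 0) = r₀)
    (h1 : ∀ p ∈ Icc a b, 0 < width p → ρ (c p 1) = r₁)
    (hpt : ∀ p ∈ Icc a b, width p = 0 → ∀ s, c p s = c p 0) :
    ContinuousOn (fun x => (W x, width (W x) * ρ x)) sphere ∧
      InjOn (fun x => (W x, width (W x) * ρ x)) sphere ∧
      (fun x => (W x, width (W x) * ρ x)) '' sphere =
        {y | y.1 ∈ Icc a b ∧ width y.1 * r₀ ≤ y.2 ∧ y.2 ≤ width y.1 * r₁} := by
  refine ⟨fun x hx => ?_, fun x hx x' hx' h => ?_, Subset.antisymm ?_ ?_⟩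
  · refine hW.continuousWithinAt.prodMk ?_
    rcases (hw _ (hsurj x hx).1).eq_or_lt with h | h
    · rw [ContinuousWithinAt, ← h, zero_mul]
      refine squeeze_zero_norm' (a := fun x => |width (W x)|) ?_ ?_
      · filter_upwards [self_mem_nhdsWithin] with y hy
        rw [norm_mul, Real.norm_eq_abs, Real.norm_eq_abs]
        exact mul_le_of_le_one_right (abs_nonneg _) (hρb y hy)
      · have := ((hwidth.comp hW).abs).tendsto x
        simp only [Function.comp_apply, ← h, abs_zero] at this
        exact this.mono_left nhdsWithin_le_nhds
    · exact ((hwidth.comp hW).continuousAt.mul (hρc x hx h)).continuousWithinAt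
  · obtain ⟨hxW, s, hs, hxs⟩ := hsurj x hx
    obtain ⟨-, s', hs', hxs'⟩ := hsurj x' hx'
    rw [Prod.mk.injEq] at h
    obtain ⟨hWW, hρρ⟩ := h
    rw [← hWW] at hxs' hρρ
    rcases (hw _ hxW).eq_or_lt with h | h
    · rw [hxs, hxs', hpt _ hxW h.symm s, hpt _ hxW h.symm s']
    · have e1 := mul_left_cancel₀ h.ne' hρρ
      rw [hxs', hxs] at e1
      have hx1 := (hmem _ hxW s hs).2
      rw [hx1] at e1
      have := (hmono _ hxW h).injOn hs hs' e1
      rw [hxs, hxs', this]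
  · rintro _ ⟨x, hx, rfl⟩
    obtain ⟨hxW, s, hs, hxs⟩ := hsurj x hx
    refine ⟨hxW, ?_⟩
    rcases (hw _ hxW).eq_or_lt with h | h
    · simp [← h]
    · have l0 := (hmono _ hxW h).monotoneOn ⟨le_rfl, zero_le_one⟩ hs hs.1
      have l1 := (hmono _ hxW h).monotoneOn hs ⟨zero_le_one, le_rfl⟩ hs.2
      simp only [h0 _ hxW h, h1 _ hxW h, ← hxs] at l0 l1
      exact ⟨mul_le_mul_of_nonneg_left l0 h.le, mul_le_mul_of_nonneg_left l1 h.le⟩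
  · rintro ⟨p, k⟩ ⟨hp, hk0, hk1⟩
    simp only at hp hk0 hk1
    rcases (hw _ hp).eq_or_lt with h | h
    · obtain ⟨hx, hxp⟩ := hmem p hp 0 ⟨le_rfl, zero_le_one⟩
      refine ⟨_, hx, ?_⟩
      rw [← h, zero_mul] at hk0 hk1
      simp [hxp, ← h, le_antisymm hk1 hk0]
    · obtain ⟨s, hs, hsk⟩ : k / width p ∈ (fun s => ρ (c p s)) '' Icc 0 1 := by
        refine intermediate_value_Icc zero_le_one (hcont p hp h) ?_
        simp only [h0 p hp h, h1 p hp h]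
        exact ⟨(le_div_iff₀' h).2 hk0, (div_le_iff₀' h).2 hk1⟩
      obtain ⟨hx, hxp⟩ := hmem p hp s hs
      refine ⟨_, hx, ?_⟩
      simp only at hsk
      simp [hxp, hsk, mul_div_cancel₀ _ h.ne']

/-! ### Coordinates when there is no inner equilibrium -/

/-- The point of the octant with `sq = ![a, b, c]`. -/
def pt (a b c : ℝ) : E := ofSq ![a, b, c]

theorem sq_pt {a b c : ℝ} (ha : 0 ≤ a) (hb : 0 ≤ b) (hc : 0 ≤ c) : sq (pt a b c) = ![a, b, c] :=
  funext (sq_ofSq fun i => by fin_cases i <;> assumption)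

theorem pt_mem_sphere {a b c : ℝ} (ha : 0 ≤ a) (hb : 0 ≤ b) (hc : 0 ≤ c) (h : a + b + c = 1) :
    pt a b c ∈ sphere :=
  ofSq_mem_sphere (fun i => by fin_cases i <;> assumption) h

theorem eq_pt {x : E} (hx : x ∈ sphere) {a b c : ℝ} (ha : sq x 0 = a) (hb : sq x 1 = b)
    (hc : sq x 2 = c) : x = pt a b c := by
  subst ha hb hc
  refine sq_inj hx.1 (ofSq_mem_octant _) fun i => ?_
  rw [sq_pt (sq_nonneg' x 0) (sq_nonneg' x 1) (sq_nonneg' x 2)]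
  fin_cases i <;> rfl

/-- `A / (A + B)` increases strictly when `A` increases and `B` decreases. -/
theorem strictMonoOn_share {A B : ℝ → ℝ} (hA : StrictMonoOn A (Icc 0 1))
    (hB : AntitoneOn B (Icc 0 1)) (hA0 : ∀ s ∈ Icc (0 : ℝ) 1, 0 ≤ A s)
    (hB0 : ∀ s ∈ Icc (0 : ℝ) 1, 0 ≤ B s) (hB1 : ∀ s ∈ Ico (0 : ℝ) 1, 0 < B s) :
    StrictMonoOn (fun s => A s / (A s + B s)) (Icc 0 1) := by
  intro s hs t ht hst
  have h1 := hA hs ht hst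
  have h2 := hB hs ht hst.le
  have h3 := hA0 s hs
  have h4 := hB0 t ht
  have h5 := hB1 s ⟨hs.1, hst.trans_le ht.2⟩
  simp only
  rw [div_lt_div_iff₀ (by linarith) (by linarith)]
  have : A s * B t ≤ A s * B s := mul_le_mul_of_nonneg_left h2 h3
  have : A s * B s < A t * B s := mul_lt_mul_of_pos_right h1 h5
  linarith

theorem abs_share_le {A B : ℝ} (hA : 0 ≤ A) (hB : 0 ≤ B) : |A / (A + B)| ≤ 1 := by
  rw [abs_of_nonneg (div_nonneg hA (by linarith))]
  exact div_le_one_of_le₀ (by linarith) (by linarith)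

section Star

variable {m : Fin 3 → ℝ}

/-- For the signs `(+, 0, -)`, the share that labels an orbit: it is constant, since both summands
of the denominator are multiplied by the same factor `exp (-2 * ∫ sq x 1)` along solutions. -/
def starShare (m : Fin 3 → ℝ) (x : E) : ℝ :=
  sq x 0 ^ (1 / m 0) / (sq x 0 ^ (1 / m 0) + sq x 2 ^ (1 / -m 2))

/-- Coordinates for the signs `(+, 0, -)`: the orbits are the segments from the side `y.1 = 0` of a
triangle to its apex `(1, 0)`, the image of `e 1`. -/
def starMap (m : Fin 3 → ℝ) (x : E) : ℝ × ℝ := (sq x 1, (1 - sq x 1) * starShare m x)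

theorem starMap_coordinates (h0 : 0 < m 0) (h2 : m 2 < 0) :
    ContinuousOn (starMap m) sphere ∧ InjOn (starMap m) sphere ∧ starMap m '' sphere =
      {y | y.1 ∈ Icc (0 : ℝ) 1 ∧ (1 - y.1) * 0 ≤ y.2 ∧ y.2 ≤ (1 - y.1) * 1} := by
  have e0 : 0 < 1 / m 0 := by positivity
  have e2 : 0 < 1 / -m 2 := one_div_pos.2 (by linarith)
  have hsq : ∀ p ∈ Icc (0 : ℝ) 1, ∀ s ∈ Icc (0 : ℝ) 1,
      sq (pt ((1 - p) * s) p ((1 - p) * (1 - s))) = ![(1 - p) * s, p, (1 - p) * (1 - s)] :=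
    fun p hp s hs => sq_pt (mul_nonneg (by linarith [hp.2]) hs.1) hp.1
      (mul_nonneg (by linarith [hp.2]) (by linarith [hs.2]))
  have hsh : ∀ p ∈ Icc (0 : ℝ) 1, ∀ s ∈ Icc (0 : ℝ) 1,
      starShare m (pt ((1 - p) * s) p ((1 - p) * (1 - s))) = ((1 - p) * s) ^ (1 / m 0) /
        (((1 - p) * s) ^ (1 / m 0) + ((1 - p) * (1 - s)) ^ (1 / -m 2)) := fun p hp s hs => by
    rw [starShare, hsq p hp s hs]; simp
  have hA : ∀ x : E, ∀ r : ℝ, ∀ i, 0 ≤ sq x i ^ r := fun x r i =>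
    Real.rpow_nonneg (sq_nonneg' x i) r
  have hmono : ∀ p ∈ Icc (0 : ℝ) 1, 0 < 1 - p →
      StrictMonoOn (fun s => starShare m (pt ((1 - p) * s) p ((1 - p) * (1 - s)))) (Icc 0 1) := by
    intro p hp hp1
    refine StrictMonoOn.congr (strictMonoOn_share
      (A := fun s => ((1 - p) * s) ^ (1 / m 0)) (B := fun s => ((1 - p) * (1 - s)) ^ (1 / -m 2))
      ?_ ?_ ?_ ?_ ?_) fun s hs => (hsh p hp s hs).symm
    · intro s hs t ht hst
      exact Real.rpow_lt_rpow (mul_nonneg hp1.le hs.1) (mul_lt_mul_of_pos_left hst hp1) e0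
    · intro s hs t ht hst
      exact Real.rpow_le_rpow (mul_nonneg hp1.le (by linarith [ht.2]))
        (mul_le_mul_of_nonneg_left (by linarith) hp1.le) e2.le
    · exact fun s hs => Real.rpow_nonneg (mul_nonneg hp1.le hs.1) _
    · exact fun s hs => Real.rpow_nonneg (mul_nonneg hp1.le (by linarith [hs.2])) _
    · exact fun s hs => Real.rpow_pos_of_pos (mul_pos hp1 (by linarith [hs.2])) _
  have hpos : ∀ x ∈ sphere, 0 < 1 - sq x 1 →
      sq x 0 ^ (1 / m 0) + sq x 2 ^ (1 / -m 2) ≠ 0 := by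
    intro x hx h
    have h3 := sum_sq hx
    have n0 := sq_nonneg' x 0
    have n2 := sq_nonneg' x 2
    rcases n0.lt_or_eq with h4 | h4
    · have := Real.rpow_pos_of_pos h4 (1 / m 0)
      have := hA x (1 / -m 2) 2
      positivity
    · have := Real.rpow_pos_of_pos (show 0 < sq x 2 by linarith) (1 / -m 2)
      have := hA x (1 / m 0) 0
      positivity
  have hcont : ∀ x ∈ sphere, 0 < 1 - sq x 1 → ContinuousAt (starShare m) x := by
    intro x hx h
    have c0 := ((continuous_sq 0).rpow_const fun _ => .inr e0.le).continuousAt (x := x)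
    have c2 := ((continuous_sq 2).rpow_const fun _ => .inr e2.le).continuousAt (x := x)
    exact c0.div (c0.add c2) (hpos x hx h)
  refine fibered_coordinates (W := fun x => sq x 1) (ρ := starShare m) (width := fun p => 1 - p)
    (c := fun p s => pt ((1 - p) * s) p ((1 - p) * (1 - s))) (continuous_sq 1) (by fun_prop)
    (fun p hp => by linarith [hp.2]) ?_ ?_ hcont ?_ hmono ?_ ?_ ?_ ?_
  · intro p hp s hs
    refine ⟨pt_mem_sphere (mul_nonneg (by linarith [hp.2]) hs.1) hp.1
      (mul_nonneg (by linarith [hp.2]) (by linarith [hs.2])) (by ring), ?_⟩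
    rw [hsq p hp s hs]; simp
  · intro x hx
    have h3 := sum_sq hx
    have n0 := sq_nonneg' x 0
    have n1 := sq_nonneg' x 1
    have n2 := sq_nonneg' x 2
    refine ⟨⟨n1, sq_le_one hx 1⟩, ?_⟩
    rcases (show 0 ≤ 1 - sq x 1 by linarith).lt_or_eq with h | h
    · refine ⟨sq x 0 / (1 - sq x 1), ⟨div_nonneg n0 h.le, (div_le_one h).2 (by linarith)⟩,
        eq_pt hx ?_ rfl ?_⟩ <;> field_simp
      linarith
    · exact ⟨0, ⟨le_rfl, zero_le_one⟩, eq_pt hx (by rw [← h]; linarith) rfl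
        (by rw [← h]; linarith)⟩
  · exact fun x hx => abs_share_le (hA _ _ _) (hA _ _ _)
  · intro p hp hp1
    refine ContinuousOn.congr (f := fun s => ((1 - p) * s) ^ (1 / m 0) /
        (((1 - p) * s) ^ (1 / m 0) + ((1 - p) * (1 - s)) ^ (1 / -m 2))) ?_ (hsh p hp)
    have c0 : Continuous fun s : ℝ => ((1 - p) * s) ^ (1 / m 0) :=
      (continuous_const.mul continuous_id).rpow_const fun _ => .inr e0.le
    have c2 : Continuous fun s : ℝ => ((1 - p) * (1 - s)) ^ (1 / -m 2) :=
      (continuous_const.mul (continuous_const.sub continuous_id)).rpow_const fun _ => .inr e2.le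
    refine c0.continuousOn.div (c0.add c2).continuousOn fun s hs => ?_
    rcases hs.1.lt_or_eq with h | h
    · exact (add_pos_of_pos_of_nonneg (Real.rpow_pos_of_pos (mul_pos hp1 h) _)
        (Real.rpow_nonneg (mul_nonneg hp1.le (by linarith [hs.2])) _)).ne'
    · exact (add_pos_of_nonneg_of_pos (Real.rpow_nonneg (mul_nonneg hp1.le hs.1) _)
        (Real.rpow_pos_of_pos (mul_pos hp1 (by linarith)) _)).ne'
  · intro p hp hp1
    rw [hsh p hp 0 ⟨le_rfl, zero_le_one⟩, mul_zero, Real.zero_rpow e0.ne', zero_div]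
  · intro p hp hp1
    rw [hsh p hp 1 ⟨zero_le_one, le_rfl⟩, sub_self, mul_zero, Real.zero_rpow e2.ne', add_zero,
      mul_one, div_self (Real.rpow_pos_of_pos hp1 _).ne']
  · intro p hp hp0 s
    rw [hp0]; simp

theorem starMap_isModel (h0 : 0 < m 0) (h1 : m 1 = 0) (h2 : m 2 < 0) :
    IsModel m (starMap m)
      {y | y.1 ∈ Icc (0 : ℝ) 1 ∧ (1 - y.1) * 0 ≤ y.2 ∧ y.2 ≤ (1 - y.1) * 1}
      {y | y.1 = 0 ∨ y.1 = 1} Prod.fst (fun y => y.2 / (1 - y.1)) (fun _ => 0) (fun _ => 1) := by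
  obtain ⟨hc, hi, him⟩ := starMap_coordinates h0 h2
  have hpos : ∀ γ, IsSphereCurve m γ → starMap m (γ 0) ∉ {y : ℝ × ℝ | y.1 = 0 ∨ y.1 = 1} →
      0 < sq (γ 0) 1 ∧ sq (γ 0) 1 < 1 := by
    intro γ hγ h
    rw [mem_ofPred_eq, not_or] at h
    exact ⟨(sq_nonneg' _ _).lt_of_ne' h.1, (sq_le_one (hγ.mem 0) 1).lt_of_ne h.2⟩
  have hlt : ∀ γ, IsSphereCurve m γ → sq (γ 0) 1 < 1 → ∀ t, sq (γ t) 1 < 1 := by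
    intro γ hγ h t
    refine (sq_le_one (hγ.mem t) 1).lt_of_ne fun h' => ?_
    have := hγ.eq_const (s := t) (by rw [eq_e_of_sq (hγ.mem t) h']; exact isEq_e m 1) 0
    rw [this] at h; linarith
  have hshare : ∀ γ, IsSphereCurve m γ → ∀ t, starShare m (γ t) = starShare m (γ 0) := by
    intro γ hγ t
    obtain ⟨I, -, -, h⟩ := hγ.exists_integrals
    have r0 : rate m (I t) 0 = -(m 0 * I t 1) := by simp [rate, h1]
    have r2 : rate m (I t) 2 = m 2 * I t 1 := by simp [rate, h1]
    have hA : sq (γ t) 0 ^ (1 / m 0) = sq (γ 0) 0 ^ (1 / m 0) * Real.exp (-2 * I t 1) := by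
      rw [h t 0, Real.mul_rpow (sq_nonneg' _ _) (Real.exp_pos _).le, ← Real.exp_mul, r0]
      congr 2
      field_simp
    have hB : sq (γ t) 2 ^ (1 / -m 2) = sq (γ 0) 2 ^ (1 / -m 2) * Real.exp (-2 * I t 1) := by
      rw [h t 2, Real.mul_rpow (sq_nonneg' _ _) (Real.exp_pos _).le, ← Real.exp_mul, r2]
      congr 2
      have := h2.ne
      field_simp
    rw [starShare, hA, hB, ← add_mul, mul_div_mul_right _ _ (Real.exp_pos _).ne', starShare]
  refine ⟨hc, hi, him, ?_, ?_, ?_, ?_, ?_, ?_⟩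
  · intro x hx h
    rw [isEq_iff_star h0 h1 h2 hx, mem_arc_iff (k := 1) (by decide) (by decide) (by decide)]
    exact h.elim (fun h => .inr ⟨hx, h⟩) fun h => .inl (eq_e_of_sq hx h)
  · intro γ hγ h t
    obtain ⟨p0, p1⟩ := hpos γ hγ h
    rw [mem_ofPred_eq, not_or]
    exact ⟨(hγ.sq_pos p0 t).ne', (hlt γ hγ p1 t).ne⟩
  · intro γ hγ h t
    obtain ⟨p0, p1⟩ := hpos γ hγ h
    have n0 : 1 - sq (γ 0) 1 ≠ 0 := by linarith
    have nt : 1 - sq (γ t) 1 ≠ 0 := by linarith [hlt γ hγ p1 t]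
    simp only [starMap]
    rw [mul_div_cancel_left₀ _ n0, mul_div_cancel_left₀ _ nt, hshare γ hγ t]
  · intro γ hγ h
    obtain ⟨p0, p1⟩ := hpos γ hγ h
    refine hγ.strictMono_of_pos p0 fun t => ?_
    have n0 := sq_nonneg' (γ t) 0
    have n2 := sq_nonneg' (γ t) 2
    have := sum_sq (hγ.mem t)
    have := hlt γ hγ p1 t
    simp only [rate]; simp
    rcases n0.lt_or_eq with h | h
    · nlinarith
    · rw [← h]; nlinarith
  · intro γ hγ h
    obtain ⟨p0, p1⟩ := hpos γ hγ h
    obtain ⟨P, hP, hl⟩ := (hγ.star_limits h0 h1 h2).2.2 p1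
    have := tendsto_sq hl 1
    rwa [((mem_arc_iff (k := 1) (by decide) (by decide) (by decide)).1 hP).2] at this
  · intro γ hγ h
    obtain ⟨p0, p1⟩ := hpos γ hγ h
    have := tendsto_sq ((hγ.star_limits h0 h1 h2).2.1 p0) 1
    simpa [sq_e, starMap] using this

theorem OrbitEquiv.star {m' : Fin 3 → ℝ} (h0 : 0 < m 0) (h1 : m 1 = 0) (h2 : m 2 < 0)
    (h0' : 0 < m' 0) (h1' : m' 1 = 0) (h2' : m' 2 < 0) : OrbitEquiv m m' := by
  refine (starMap_isModel h0 h1 h2).orbitEquiv (starMap_isModel h0' h1' h2') continuous_fst ?_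
  rintro ⟨p, k⟩ ⟨-, hy⟩ ⟨p', k'⟩ - (rfl : p = p') hl
  rw [mem_ofPred_eq, not_or] at hy
  have : 1 - p ≠ 0 := fun h => hy.2 (by simp only; linarith)
  rw [div_left_inj' this] at hl
  simp only at hl
  rw [hl]

end Star

/-! ### Coordinates for the signs `(0, +, +)` -/

section Saddle

/-- A continuous increasing function from `[0, 1]` onto `[-1, 1]` that vanishes at `w` and satisfies
`|fold w| = 1 - bump w`. -/
def fold (w u : ℝ) : ℝ := if u ≤ w then bump w u - 1 else 1 - bump w u

variable {w : ℝ}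

theorem continuous_fold (h0 : 0 < w) (h1 : w < 1) : Continuous (fold w) :=
  Continuous.if_le ((continuous_bump h0 h1).sub continuous_const)
    (continuous_const.sub (continuous_bump h0 h1)) continuous_id continuous_const
    fun u hu => by rw [show u = w from hu, bump_self h0 h1, sub_self]

theorem abs_fold (h0 : 0 < w) (h1 : w < 1) {u : ℝ} (hu : u ∈ Icc (0 : ℝ) 1) :
    |fold w u| = 1 - bump w u := by
  have := bump_le_one h0 h1 hu
  rw [fold]
  split_ifs
  · rw [abs_of_nonpos (by linarith)]; ring
  · rw [abs_of_nonneg (by linarith)]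

theorem bump_lt_one (h0 : 0 < w) (h1 : w < 1) {u : ℝ} (hu : w < u) (hu1 : u ≤ 1) :
    bump w u < 1 := by
  rw [← bump_self h0 h1]
  exact strictAntiOn_bump h0 h1 ⟨le_rfl, h1.le⟩ ⟨hu.le, hu1⟩ hu

theorem strictMonoOn_fold (h0 : 0 < w) (h1 : w < 1) : StrictMonoOn (fold w) (Icc 0 1) := by
  intro u hu v hv huv
  rw [fold, fold]
  split_ifs with h h' h'
  · linarith [strictMonoOn_bump h0 h1 ⟨hu.1, h⟩ ⟨hv.1, h'⟩ huv]
  · linarith [bump_le_one h0 h1 hu, bump_lt_one h0 h1 (not_le.1 h') hv.2]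
  · linarith
  · linarith [strictAntiOn_bump h0 h1 ⟨(not_le.1 h).le, hu.2⟩ ⟨(not_le.1 h').le, hv.2⟩ huv]

variable {m : Fin 3 → ℝ} {γ : ℝ → E}

/-- The position of the central projection from `e 2` on the edge `y 2 = 0`. -/
def edgePos (x : E) : ℝ := sq x 0 / (sq x 0 + sq x 1)

theorem edgePos_mem (x : E) : edgePos x ∈ Icc (0 : ℝ) 1 := by
  have n0 := sq_nonneg' x 0
  have n1 := sq_nonneg' x 1
  exact ⟨div_nonneg n0 (by linarith), div_le_one_of_le₀ (by linarith) (by linarith)⟩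

/-- Coordinates for the signs `(0, +, +)`. The absolute value of the second one is
`1 - sq x 2 - saddleLevel m (sq x)`, so that the orbits lie on the curves where `y.1 + |y.2|` is
constant. -/
def saddleMap (m : Fin 3 → ℝ) (x : E) : ℝ × ℝ :=
  (sq x 2, (1 - sq x 2) * fold (saddleWeight m) (edgePos x))

theorem saddleMap_coordinates (h1 : 0 < m 1) (h2 : 0 < m 2) :
    ContinuousOn (saddleMap m) sphere ∧ InjOn (saddleMap m) sphere ∧ saddleMap m '' sphere =
      {y | y.1 ∈ Icc (0 : ℝ) 1 ∧ (1 - y.1) * -1 ≤ y.2 ∧ y.2 ≤ (1 - y.1) * 1} := by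
  have w0 := saddleWeight_pos h1 h2
  have w1 := saddleWeight_lt_one h1 h2
  have hsq : ∀ p ∈ Icc (0 : ℝ) 1, ∀ s ∈ Icc (0 : ℝ) 1,
      sq (pt ((1 - p) * s) ((1 - p) * (1 - s)) p) = ![(1 - p) * s, (1 - p) * (1 - s), p] :=
    fun p hp s hs => sq_pt (mul_nonneg (by linarith [hp.2]) hs.1)
      (mul_nonneg (by linarith [hp.2]) (by linarith [hs.2])) hp.1
  have hpos : ∀ p ∈ Icc (0 : ℝ) 1, 0 < 1 - p → ∀ s ∈ Icc (0 : ℝ) 1,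
      edgePos (pt ((1 - p) * s) ((1 - p) * (1 - s)) p) = s := fun p hp hp1 s hs => by
    rw [edgePos, hsq p hp s hs]
    simp only [Matrix.cons_val_zero, Matrix.cons_val_one]
    rw [← mul_add, add_sub_cancel, mul_one, mul_div_cancel_left₀ _ hp1.ne']
  refine fibered_coordinates (W := fun x => sq x 2)
    (ρ := fun x => fold (saddleWeight m) (edgePos x)) (width := fun p => 1 - p)
    (c := fun p s => pt ((1 - p) * s) ((1 - p) * (1 - s)) p) (continuous_sq 2) (by fun_prop)
    (fun p hp => by linarith [hp.2]) ?_ ?_ ?_ ?_ ?_ ?_ ?_ ?_ ?_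
  · intro p hp s hs
    refine ⟨pt_mem_sphere (mul_nonneg (by linarith [hp.2]) hs.1)
      (mul_nonneg (by linarith [hp.2]) (by linarith [hs.2])) hp.1 (by ring), ?_⟩
    rw [hsq p hp s hs]; simp
  · intro x hx
    have h3 := sum_sq hx
    have n0 := sq_nonneg' x 0
    have n1 := sq_nonneg' x 1
    refine ⟨⟨sq_nonneg' x 2, sq_le_one hx 2⟩, edgePos x, edgePos_mem x, eq_pt hx ?_ ?_ rfl⟩
    all_goals
      rw [show 1 - sq x 2 = sq x 0 + sq x 1 by linarith, edgePos]
      rcases (add_nonneg n0 n1).lt_or_eq with h | h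
      · field_simp
        try ring
      · rw [← h]; linarith
  · intro x hx h
    have h3 := sum_sq hx
    have hne : sq x 0 + sq x 1 ≠ 0 := by linarith
    exact (continuous_fold w0 w1).continuousAt.comp ((continuous_sq 0).continuousAt.div
      ((continuous_sq 0).add (continuous_sq 1)).continuousAt hne)
  · intro x hx
    rw [abs_fold w0 w1 (edgePos_mem x)]
    linarith [bump_nonneg w0 w1 (edgePos_mem x)]
  · intro p hp hp1
    exact (strictMonoOn_fold w0 w1).congr fun s hs => by simp only [hpos p hp hp1 s hs]
  · intro p hp hp1
    exact (continuous_fold w0 w1).continuousOn.congr fun s hs => by simp only [hpos p hp hp1 s hs]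
  · intro p hp hp1
    rw [hpos p hp hp1 0 ⟨le_rfl, zero_le_one⟩, fold, if_pos w0.le, bump_zero w0, zero_sub]
  · intro p hp hp1
    rw [hpos p hp hp1 1 ⟨zero_le_one, le_rfl⟩, fold, if_neg w1.not_ge, bump_one w1, sub_zero]
  · intro p hp hp0 s
    rw [hp0]; simp

theorem saddleLevel_eq_edgePos (h1 : 0 < m 1) (h2 : 0 < m 2) {x : E} (hx : x ∈ sphere) :
    saddleLevel m (sq x) = (1 - sq x 2) * bump (saddleWeight m) (edgePos x) := by
  have h3 := sum_sq hx
  have n0 := sq_nonneg' x 0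
  have n1 := sq_nonneg' x 1
  refine saddleLevel_eq_mul_bump h1 h2 (by linarith) (edgePos_mem x) ?_ ?_
  all_goals
    rw [show 1 - sq x 2 = sq x 0 + sq x 1 by linarith, edgePos]
    rcases (add_nonneg n0 n1).lt_or_eq with h | h
    · field_simp
      try ring
    · rw [← h]; linarith

theorem abs_saddleMap (h1 : 0 < m 1) (h2 : 0 < m 2) {x : E} (hx : x ∈ sphere) :
    |(saddleMap m x).2| = 1 - sq x 2 - saddleLevel m (sq x) := by
  have h3 := sq_le_one hx 2
  rw [saddleLevel_eq_edgePos h1 h2 hx, saddleMap, abs_mul, abs_of_nonneg (by linarith),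
    abs_fold (saddleWeight_pos h1 h2) (saddleWeight_lt_one h1 h2) (edgePos_mem x)]
  ring

/-- The lower end of the range of the second coordinate along an orbit: `0`, the value at the vertex
`e 2`, for the edge from `e 2` to `e 0`, and otherwise the value at which `y.1` would vanish. -/
def saddleLo (y : ℝ × ℝ) : ℝ := if y.2 = 1 - y.1 then 0 else -(y.1 + |y.2|)

/-- The upper end of the range of the second coordinate along an orbit; it is `0` for the edge from
`e 1` to `e 2`. -/
def saddleHi (y : ℝ × ℝ) : ℝ := if y.2 = -(1 - y.1) then 0 else y.1 + |y.2|

theorem IsSphereCurve.saddleMap_snd_int (hγ : IsSphereCurve m γ) (h0 : m 0 = 0) (h1 : 0 < m 1)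
    (h2 : 0 < m 2) (hi : γ 0 ∈ intSphere) :
    StrictMono (fun t => (saddleMap m (γ t)).2) ∧
      Tendsto (fun t => (saddleMap m (γ t)).2) atBot (𝓝 (saddleLo (saddleMap m (γ 0)))) ∧
      Tendsto (fun t => (saddleMap m (γ t)).2) atTop (𝓝 (saddleHi (saddleMap m (γ 0)))) := by
  have w0 := saddleWeight_pos h1 h2
  have w1 := saddleWeight_lt_one h1 h2
  have hi' := (mem_intSphere_iff.1 hi).2
  have hpos : ∀ t i, 0 < sq (γ t) i := fun t i => hγ.sq_pos (hi' i) t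
  have hlevel : ∀ t, (1 - sq (γ t) 2) * bump (saddleWeight m) (edgePos (γ t)) =
      saddleLevel m (sq (γ 0)) := fun t => by
    rw [← saddleLevel_eq_edgePos h1 h2 (hγ.mem t), hγ.saddleLevel_eq h0 h1 h2 t]
  have hs : ∀ t, 0 < 1 - sq (γ t) 2 := fun t => by
    linarith [sum_sq (hγ.mem t), hpos t 0, hpos t 1]
  have hu : ∀ t, edgePos (γ t) ∈ Ioo (0 : ℝ) 1 := fun t =>
    ⟨div_pos (hpos t 0) (add_pos (hpos t 0) (hpos t 1)),
      (div_lt_one (add_pos (hpos t 0) (hpos t 1))).2 (by linarith [hpos t 1])⟩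
  have hb : ∀ t, 0 < bump (saddleWeight m) (edgePos (γ t)) := fun t => bump_pos w0 w1 (hu t)
  have hL : 0 < saddleLevel m (sq (γ 0)) := by
    rw [← hlevel 0]; exact mul_pos (hs 0) (hb 0)
  have hmono : StrictMono fun t => edgePos (γ t) := by
    intro s t hst
    have a0 : sq (γ s) 0 < sq (γ t) 0 := hγ.strictMono_of_pos (hi' 0) (fun t => by
      have := hpos t 2
      simp [rate, h0]; positivity) hst
    have a1 := (hγ.saddle_mono h0 h1 h2).2 hst.le
    simp only [edgePos] at a1 ⊢
    rw [div_lt_div_iff₀ (add_pos (hpos s 0) (hpos s 1)) (add_pos (hpos t 0) (hpos t 1))]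
    nlinarith [hpos s 0, hpos s 1, hpos t 1]
  obtain ⟨P, Q, ⟨hP, hPw, hPl⟩, ⟨hQ, hQw, hQl⟩, -⟩ := hγ.saddle_limits_int h0 h1 h2 hi
  -- At the limit points the level and the first coordinate determine the second coordinate.
  have hlim : ∀ l : Filter ℝ, l.NeBot → ∀ R ∈ arc 0 1, Tendsto γ l (𝓝 R) →
      Tendsto (fun t => (saddleMap m (γ t)).2) l (𝓝 (fold (saddleWeight m) (sq R 0))) ∧
        bump (saddleWeight m) (sq R 0) = saddleLevel m (sq (γ 0)) := by
    intro l hl R hR hRl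
    obtain ⟨hRs, hR2⟩ := (mem_arc_iff (k := 2) (by decide) (by decide) (by decide)).1 hR
    have e1 := sum_sq hRs
    have e2 : edgePos R = sq R 0 := by rw [edgePos, show sq R 0 + sq R 1 = 1 by linarith, div_one]
    have e3 : (saddleMap m R).2 = fold (saddleWeight m) (sq R 0) := by
      simp [saddleMap, hR2, e2]
    constructor
    · rw [← e3]
      refine (continuous_snd.tendsto _).comp (((saddleMap_coordinates h1 h2).1 R hRs).tendsto.comp
        (tendsto_nhdsWithin_iff.2 ⟨hRl, Eventually.of_forall hγ.mem⟩))
    · have e4 := saddleLevel_eq_edgePos h1 h2 hRs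
      rw [e2, hR2, sub_zero, one_mul] at e4
      rw [← e4]
      refine tendsto_nhds_unique (((continuous_saddleLevel h1 h2).tendsto R).comp hRl) ?_
      exact tendsto_const_nhds.congr fun t => (hγ.saddleLevel_eq h0 h1 h2 t).symm
  have habs := abs_saddleMap h1 h2 (hγ.mem 0)
  have hab : (saddleMap m (γ 0)).1 + |(saddleMap m (γ 0)).2| = 1 - saddleLevel m (sq (γ 0)) := by
    rw [habs, saddleMap]; ring
  have hlt : |(saddleMap m (γ 0)).2| < 1 - (saddleMap m (γ 0)).1 := by linarith
  rw [abs_lt] at hlt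
  refine ⟨fun s t hst => ?_, ?_, ?_⟩
  · have hst' := hmono hst
    have es := hlevel s
    have et := hlevel t
    have bs := hb s
    have bt := hb t
    have ps := hs s
    have pt := hs t
    simp only [saddleMap, fold] at hst' ⊢
    split_ifs with a a' a'
    · have := strictMonoOn_bump w0 w1 ⟨(hu s).1.le, a⟩ ⟨(hu t).1.le, a'⟩ hst'
      nlinarith
    · have e5 := bump_le_one w0 w1 ⟨(hu s).1.le, (hu s).2.le⟩
      have e6 := bump_lt_one w0 w1 (not_le.1 a') (hu t).2.le
      have := mul_nonneg ps.le (sub_nonneg.2 e5)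
      have := mul_pos pt (sub_pos.2 e6)
      linarith
    · linarith
    · have := strictAntiOn_bump w0 w1 ⟨(not_le.1 a).le, (hu s).2.le⟩
        ⟨(not_le.1 a').le, (hu t).2.le⟩ hst'
      nlinarith
  · obtain ⟨a, b⟩ := hlim _ inferInstance P hP hPl
    rw [saddleLo, if_neg hlt.2.ne, hab]
    rw [fold, if_pos hPw.le, b] at a
    simpa using a
  · obtain ⟨a, b⟩ := hlim _ inferInstance Q hQ hQl
    rw [saddleHi, if_neg hlt.1.ne', hab]
    rwa [fold, if_neg hQw.not_ge, b] at a

theorem IsSphereCurve.saddleMap_snd (hγ : IsSphereCurve m γ) (h0 : m 0 = 0) (h1 : 0 < m 1)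
    (h2 : 0 < m 2) (hp : 0 < sq (γ 0) 2) (hp1 : sq (γ 0) 2 < 1) :
    StrictMono (fun t => (saddleMap m (γ t)).2) ∧
      Tendsto (fun t => (saddleMap m (γ t)).2) atBot (𝓝 (saddleLo (saddleMap m (γ 0)))) ∧
      Tendsto (fun t => (saddleMap m (γ t)).2) atTop (𝓝 (saddleHi (saddleMap m (γ 0)))) := by
  have w0 := saddleWeight_pos h1 h2
  have w1 := saddleWeight_lt_one h1 h2
  have hsum := sum_sq (hγ.mem 0)
  rcases (sq_nonneg' (γ 0) 0).lt_or_eq with a0 | a0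
  · rcases (sq_nonneg' (γ 0) 1).lt_or_eq with a1 | a1
    · refine hγ.saddleMap_snd_int h0 h1 h2 (mem_intSphere_iff.2 ⟨hγ.mem 0, fun i => ?_⟩)
      fin_cases i <;> assumption
    · -- the edge from `e 2` to `e 0`
      obtain ⟨hm, hb, ht, -⟩ := hγ.edge (i := 0) (j := 2) (k := 1) (by decide) (by decide)
        (by decide) h1 (fun y hy => by simp [rate, hy])
        ((mem_openArc_iff (by decide) (by decide) (by decide)).2 ⟨hγ.mem 0, a1.symm, a0, hp⟩)
      have hK : ∀ t, (saddleMap m (γ t)).2 = sq (γ t) 0 := fun t => by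
        have := hγ.sq_zero a1.symm t
        have e1 := sum_sq (hγ.mem t)
        have e2 : edgePos (γ t) = 1 := by
          rw [edgePos, this, add_zero, div_self (hγ.sq_pos a0 t).ne']
        rw [saddleMap, e2, fold, if_neg w1.not_ge, bump_one w1]
        simp only; linarith
      have hne : (saddleMap m (γ 0)).2 = 1 - (saddleMap m (γ 0)).1 := by
        rw [hK 0]; simp only [saddleMap]; linarith
      have hne' : (saddleMap m (γ 0)).2 ≠ -(1 - (saddleMap m (γ 0)).1) := by
        rw [← hne, hK 0]; linarith
      have hb' := tendsto_sq hb 0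
      have ht' := tendsto_sq ht 0
      simp [sq_e] at hb' ht'
      rw [saddleLo, if_pos hne, saddleHi, if_neg hne', hK 0, abs_of_pos a0]
      simp only [hK]
      refine ⟨hm, hb', ?_⟩
      rwa [show (saddleMap m (γ 0)).1 + sq (γ 0) 0 = 1 by simp only [saddleMap]; linarith]
  · -- the edge from `e 1` to `e 2`
    have a1 : 0 < sq (γ 0) 1 := by linarith
    obtain ⟨hm, hb, ht, -⟩ := hγ.edge (i := 2) (j := 1) (k := 0) (by decide) (by decide)
      (by decide) h2 (fun y hy => by simp [rate, hy])
      ((mem_openArc_iff (by decide) (by decide) (by decide)).2 ⟨hγ.mem 0, a0.symm, hp, a1⟩)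
    have hK : ∀ t, (saddleMap m (γ t)).2 = sq (γ t) 2 - 1 := fun t => by
      have := hγ.sq_zero a0.symm t
      have e2 : edgePos (γ t) = 0 := by rw [edgePos, this, zero_div]
      rw [saddleMap, e2, fold, if_pos w0.le, bump_zero w0]
      simp only; linarith
    have hne : (saddleMap m (γ 0)).2 = -(1 - (saddleMap m (γ 0)).1) := by
      rw [hK 0]; simp only [saddleMap]; linarith
    have hne' : (saddleMap m (γ 0)).2 ≠ 1 - (saddleMap m (γ 0)).1 := by
      rw [hK 0]; simp only [saddleMap]; linarith
    have hb' := (tendsto_sq hb 2).sub_const 1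
    have ht' := (tendsto_sq ht 2).sub_const 1
    simp [sq_e] at hb' ht'
    rw [saddleLo, if_neg hne', saddleHi, if_pos hne, hK 0, abs_of_neg (by linarith)]
    simp only [hK]
    refine ⟨fun s t h => by have := hm h; simp only at this ⊢; linarith, ?_, ht'⟩
    rwa [show -((saddleMap m (γ 0)).1 + -(sq (γ 0) 2 - 1)) = -1 by simp only [saddleMap]; linarith]

theorem saddleMap_isModel (h0 : m 0 = 0) (h1 : 0 < m 1) (h2 : 0 < m 2) :
    IsModel m (saddleMap m)
      {y | y.1 ∈ Icc (0 : ℝ) 1 ∧ (1 - y.1) * -1 ≤ y.2 ∧ y.2 ≤ (1 - y.1) * 1}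
      {y | y.1 = 0 ∨ y.1 = 1} Prod.snd (fun y => 1 - y.1 - |y.2|) saddleLo saddleHi := by
  obtain ⟨hc, hi, him⟩ := saddleMap_coordinates h1 h2
  have hpos : ∀ γ, IsSphereCurve m γ → saddleMap m (γ 0) ∉ {y : ℝ × ℝ | y.1 = 0 ∨ y.1 = 1} →
      0 < sq (γ 0) 2 ∧ sq (γ 0) 2 < 1 := by
    intro γ hγ h
    rw [mem_ofPred_eq, not_or] at h
    exact ⟨(sq_nonneg' _ _).lt_of_ne' h.1, (sq_le_one (hγ.mem 0) 2).lt_of_ne h.2⟩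
  have hcurve := fun γ hγ h => IsSphereCurve.saddleMap_snd (m := m) (γ := γ) hγ h0 h1 h2
    (hpos γ hγ h).1 (hpos γ hγ h).2
  refine ⟨hc, hi, him, ?_, ?_, ?_, fun γ hγ h => (hcurve γ hγ h).1,
    fun γ hγ h => (hcurve γ hγ h).2.1, fun γ hγ h => (hcurve γ hγ h).2.2⟩
  · intro x hx h
    rw [isEq_iff_saddle h0 h1 h2 hx, mem_arc_iff (k := 2) (by decide) (by decide) (by decide)]
    exact h.elim (fun h => .inr ⟨hx, h⟩) fun h => .inl (eq_e_of_sq hx h)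
  · intro γ hγ h t
    obtain ⟨p0, p1⟩ := hpos γ hγ h
    rw [mem_ofPred_eq, not_or]
    refine ⟨(hγ.sq_pos p0 t).ne', fun h' => ?_⟩
    have := hγ.eq_const (s := t) (by rw [eq_e_of_sq (hγ.mem t) h']; exact isEq_e m 2) 0
    rw [this] at p1
    exact p1.ne h'
  · intro γ hγ h t
    rw [abs_saddleMap h1 h2 (hγ.mem t), abs_saddleMap h1 h2 (hγ.mem 0),
      hγ.saddleLevel_eq h0 h1 h2 t]
    simp only [saddleMap]; ring

theorem OrbitEquiv.saddle {m' : Fin 3 → ℝ} (h0 : m 0 = 0) (h1 : 0 < m 1) (h2 : 0 < m 2)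
    (h0' : m' 0 = 0) (h1' : 0 < m' 1) (h2' : 0 < m' 2) : OrbitEquiv m m' := by
  refine (saddleMap_isModel h0 h1 h2).orbitEquiv (saddleMap_isModel h0' h1' h2') continuous_snd ?_
  rintro ⟨p, k⟩ - ⟨p', k'⟩ - (rfl : k = k') hl
  simp only at hl
  rw [show p = p' by linarith]

end Saddle

/-! ### Coordinates for the signs `(-, +, -)` -/

section Node

variable {m : Fin 3 → ℝ} {γ : ℝ → E}

/-- The weight of the vertex `e 1` in the label of the orbits, for the signs `(-, +, -)`. -/
def nodeIn (m : Fin 3 → ℝ) (x : E) : ℝ := sq x 1 ^ m 1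

/-- The weight of the edge from `e 2` to `e 0` in the label of the orbits, for the signs
`(-, +, -)`. -/
def nodeOut (m : Fin 3 → ℝ) (x : E) : ℝ := sq x 0 ^ (-m 2) * sq x 2 ^ (-m 0)

/-- The share that labels an orbit, for the signs `(-, +, -)`: it is constant, since `nodeIn` and
`nodeOut` are multiplied by the same factor along solutions. -/
def nodeShare (m : Fin 3 → ℝ) (x : E) : ℝ := nodeIn m x / (nodeIn m x + nodeOut m x)

/-- Coordinates for the signs `(-, +, -)`: the first one increases along all orbits, and `nodeShare`
is constant. The image is the triangle `0 ≤ y.2 ≤ 1 - |y.1|`. -/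
def nodeMap (m : Fin 3 → ℝ) (x : E) : ℝ × ℝ :=
  (sq x 0 - sq x 2, (1 - |sq x 0 - sq x 2|) * nodeShare m x)

theorem nodeIn_nonneg (x : E) : 0 ≤ nodeIn m x := Real.rpow_nonneg (sq_nonneg' x 1) _

theorem nodeOut_nonneg (x : E) : 0 ≤ nodeOut m x :=
  mul_nonneg (Real.rpow_nonneg (sq_nonneg' x 0) _) (Real.rpow_nonneg (sq_nonneg' x 2) _)

theorem abs_sub_le_one_sub {x : E} (hx : x ∈ sphere) :
    |sq x 0 - sq x 2| ≤ 1 - sq x 1 := by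
  have := sum_sq hx
  rw [abs_le]
  constructor <;> linarith [sq_nonneg' x 0, sq_nonneg' x 2]

theorem node_add_ne_zero {x : E} (hx : x ∈ sphere) (h : 0 < 1 - |sq x 0 - sq x 2|) :
    nodeIn m x + nodeOut m x ≠ 0 := by
  have hs := sum_sq hx
  have n1 := nodeIn_nonneg (m := m) x
  have n2 := nodeOut_nonneg (m := m) x
  rcases (sq_nonneg' x 1).lt_or_eq with h1 | h1
  · exact (add_pos_of_pos_of_nonneg (Real.rpow_pos_of_pos h1 _) n2).ne'
  · have hlt : |sq x 0 - sq x 2| < 1 := by linarith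
    rw [abs_lt] at hlt
    exact (add_pos_of_nonneg_of_pos n1 (mul_pos (Real.rpow_pos_of_pos (by linarith) _)
      (Real.rpow_pos_of_pos (by linarith) _))).ne'

/-- The point with `sq x 0 - sq x 2 = p` at the relative position `s` in this fibre. -/
def nodeFibre (p s : ℝ) : E :=
  pt ((1 - (1 - |p|) * s + p) / 2) ((1 - |p|) * s) ((1 - (1 - |p|) * s - p) / 2)

theorem nodeFibre_bounds {p s : ℝ} (hp : p ∈ Icc (-1 : ℝ) 1) (hs : s ∈ Icc (0 : ℝ) 1) :
    0 ≤ (1 - (1 - |p|) * s + p) / 2 ∧ 0 ≤ (1 - |p|) * s ∧ 0 ≤ (1 - (1 - |p|) * s - p) / 2 := by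
  have h1 : |p| ≤ 1 := abs_le.2 hp
  have h2 : (1 - |p|) * s ≤ 1 - |p| := mul_le_of_le_one_right (by linarith) hs.2
  have h3 := le_abs_self p
  have h4 := neg_abs_le p
  exact ⟨by linarith, mul_nonneg (by linarith) hs.1, by linarith⟩

theorem sq_nodeFibre {p s : ℝ} (hp : p ∈ Icc (-1 : ℝ) 1) (hs : s ∈ Icc (0 : ℝ) 1) :
    sq (nodeFibre p s) =
      ![(1 - (1 - |p|) * s + p) / 2, (1 - |p|) * s, (1 - (1 - |p|) * s - p) / 2] := by
  obtain ⟨h0, h1, h2⟩ := nodeFibre_bounds hp hs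
  exact sq_pt h0 h1 h2

theorem nodeMap_coordinates (h0 : m 0 < 0) (h1 : 0 < m 1) (h2 : m 2 < 0) :
    ContinuousOn (nodeMap m) sphere ∧ InjOn (nodeMap m) sphere ∧ nodeMap m '' sphere =
      {y | y.1 ∈ Icc (-1 : ℝ) 1 ∧ (1 - |y.1|) * 0 ≤ y.2 ∧ y.2 ≤ (1 - |y.1|) * 1} := by
  have e0 : 0 < -m 0 := by linarith
  have e2 : 0 < -m 2 := by linarith
  have hinf : ∀ p ∈ Icc (-1 : ℝ) 1, ∀ s ∈ Icc (0 : ℝ) 1,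
      nodeIn m (nodeFibre p s) = ((1 - |p|) * s) ^ m 1 := fun p hp s hs => by
    rw [nodeIn, sq_nodeFibre hp hs]; simp
  have houtf : ∀ p ∈ Icc (-1 : ℝ) 1, ∀ s ∈ Icc (0 : ℝ) 1, nodeOut m (nodeFibre p s) =
      ((1 - (1 - |p|) * s + p) / 2) ^ (-m 2) * ((1 - (1 - |p|) * s - p) / 2) ^ (-m 0) :=
    fun p hp s hs => by rw [nodeOut, sq_nodeFibre hp hs]; simp
  have cin : Continuous (nodeIn m) := (continuous_sq 1).rpow_const fun _ => .inr h1.le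
  have cout : Continuous (nodeOut m) := ((continuous_sq 0).rpow_const fun _ => .inr e2.le).mul
    ((continuous_sq 2).rpow_const fun _ => .inr e0.le)
  have hW : ∀ p ∈ Icc (-1 : ℝ) 1, ∀ s ∈ Icc (0 : ℝ) 1,
      sq (nodeFibre p s) 0 - sq (nodeFibre p s) 2 = p := fun p hp s hs => by
    rw [sq_nodeFibre hp hs]; simp; ring
  have hmem : ∀ p ∈ Icc (-1 : ℝ) 1, ∀ s ∈ Icc (0 : ℝ) 1, nodeFibre p s ∈ sphere :=
    fun p hp s hs => by
      obtain ⟨h0, h1, h2⟩ := nodeFibre_bounds hp hs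
      exact pt_mem_sphere h0 h1 h2 (by ring)
  have hcρ : ∀ x ∈ sphere, 0 < 1 - |sq x 0 - sq x 2| → ContinuousAt (nodeShare m) x :=
    fun x hx h => cin.continuousAt.div (cin.add cout).continuousAt (node_add_ne_zero hx h)
  have hfib : ∀ p, Continuous (nodeFibre p) := by
    intro p
    refine (PiLp.continuous_toLp 2 _).comp (continuous_pi fun i => Continuous.sqrt ?_)
    fin_cases i <;> simp <;> fun_prop
  refine fibered_coordinates (W := fun x => sq x 0 - sq x 2) (ρ := nodeShare m)
    (width := fun p => 1 - |p|) (c := nodeFibre) ((continuous_sq 0).sub (continuous_sq 2))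
    (by fun_prop) (fun p hp => by linarith [abs_le.2 hp]) (fun p hp s hs => ⟨hmem p hp s hs,
      hW p hp s hs⟩) ?_ hcρ (fun x _ => abs_share_le (nodeIn_nonneg x) (nodeOut_nonneg x)) ?_ ?_ ?_
    ?_ ?_
  · intro x hx
    have hs := sum_sq hx
    have n1 := sq_nonneg' x 1
    have hle := abs_sub_le_one_sub hx
    refine ⟨abs_le.1 (by linarith), ?_⟩
    rcases (show 0 ≤ 1 - |sq x 0 - sq x 2| by linarith).lt_or_eq with h | h
    · have hw : (1 - |sq x 0 - sq x 2|) * (sq x 1 / (1 - |sq x 0 - sq x 2|)) = sq x 1 :=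
        mul_div_cancel₀ _ h.ne'
      refine ⟨sq x 1 / (1 - |sq x 0 - sq x 2|),
        ⟨div_nonneg n1 h.le, (div_le_one h).2 (by linarith)⟩,
        eq_pt hx ?_ hw.symm ?_⟩ <;> rw [hw] <;> linarith
    · exact ⟨0, ⟨le_rfl, zero_le_one⟩, eq_pt hx (by linarith) (by linarith) (by linarith)⟩
  · intro p hp hp1
    refine (strictMonoOn_share (A := fun s => nodeIn m (nodeFibre p s))
      (B := fun s => nodeOut m (nodeFibre p s)) ?_ ?_ (fun s _ => nodeIn_nonneg _)
      (fun s _ => nodeOut_nonneg _) ?_)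
    · intro s hs t ht hst
      simp only
      rw [hinf p hp s hs, hinf p hp t ht]
      exact Real.rpow_lt_rpow (mul_nonneg hp1.le hs.1) (mul_lt_mul_of_pos_left hst hp1) h1
    · intro s hs t ht hst
      simp only
      rw [houtf p hp s hs, houtf p hp t ht]
      obtain ⟨a0, -, a2⟩ := nodeFibre_bounds hp hs
      obtain ⟨b0, -, b2⟩ := nodeFibre_bounds hp ht
      have := mul_le_mul_of_nonneg_left hst hp1.le
      exact mul_le_mul (Real.rpow_le_rpow b0 (by linarith) e2.le)
        (Real.rpow_le_rpow b2 (by linarith) e0.le) (Real.rpow_nonneg b2 _) (Real.rpow_nonneg a0 _)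
    · intro s hs
      rw [houtf p hp s ⟨hs.1, hs.2.le⟩]
      have := mul_lt_mul_of_pos_left hs.2 hp1
      have h3 := le_abs_self p
      have h4 := neg_abs_le p
      exact mul_pos (Real.rpow_pos_of_pos (by linarith) _) (Real.rpow_pos_of_pos (by linarith) _)
  · intro p hp hp1 s hs
    refine ((hcρ _ (hmem p hp s hs) ?_).comp (hfib p).continuousAt).continuousWithinAt
    rwa [hW p hp s hs]
  · intro p hp hp1
    rw [nodeShare, hinf p hp 0 ⟨le_rfl, zero_le_one⟩, mul_zero, Real.zero_rpow h1.ne', zero_div]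
  · intro p hp hp1
    have hs : (1 : ℝ) ∈ Icc (0 : ℝ) 1 := ⟨zero_le_one, le_rfl⟩
    have hout : nodeOut m (nodeFibre p 1) = 0 := by
      rw [houtf p hp 1 hs]
      rcases le_total 0 p with h | h
      · rw [abs_of_nonneg h, show (1 - (1 - p) * 1 - p) / 2 = 0 by ring, Real.zero_rpow e0.ne',
          mul_zero]
      · rw [abs_of_nonpos h, show (1 - (1 - -p) * 1 + p) / 2 = 0 by ring, Real.zero_rpow e2.ne',
          zero_mul]
    rw [nodeShare, hout, add_zero, hinf p hp 1 hs, mul_one,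
      div_self (Real.rpow_pos_of_pos hp1 _).ne']
  · intro p hp hp0 s
    rw [nodeFibre, nodeFibre, hp0, zero_mul, zero_mul]

/-- The images of the three vertices. -/
def nodeZeros : Set (ℝ × ℝ) := {(1, 0), (0, 1), (-1, 0)}

theorem nodeMap_e : nodeMap m (e 0) = (1, 0) ∧ nodeMap m (e 2) = (-1, 0) ∧
    (m 0 < 0 → nodeMap m (e 1) = (0, 1)) := by
  refine ⟨?_, ?_, fun h => ?_⟩
  · simp [nodeMap, sq_e]
  · simp [nodeMap, sq_e]
  · simp [nodeMap, sq_e, nodeShare, nodeIn, nodeOut, Real.zero_rpow (neg_ne_zero.2 h.ne)]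

theorem nodeMap_mem_iff (h0 : m 0 < 0) (h1 : 0 < m 1) (h2 : m 2 < 0) {x : E} (hx : x ∈ sphere) :
    nodeMap m x ∈ nodeZeros ↔ ∃ i, x = e i := by
  obtain ⟨e0, e2, e1⟩ := nodeMap_e (m := m)
  have e1 := e1 h0
  have hi := (nodeMap_coordinates h0 h1 h2).2.1
  constructor
  · rintro (h | h | h)
    · exact ⟨0, hi hx (e_mem_sphere 0) (h.trans e0.symm)⟩
    · exact ⟨1, hi hx (e_mem_sphere 1) (h.trans e1.symm)⟩
    · exact ⟨2, hi hx (e_mem_sphere 2) (h.trans e2.symm)⟩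
  · rintro ⟨i, rfl⟩
    fin_cases i
    · exact .inl e0
    · exact .inr (.inl e1)
    · exact .inr (.inr e2)

/-- The lower end of the range of the first coordinate along an orbit: `0`, the value at `e 1`, for
the edge from `e 1` to `e 0`, and otherwise the value `-1` at `e 2`. -/
def nodeLo (y : ℝ × ℝ) : ℝ := if y.2 = 1 - |y.1| ∧ 0 < y.1 then 0 else -1

/-- The upper end of the range of the first coordinate along an orbit: `0`, the value at `e 1`, for
the edge from `e 2` to `e 1`, and otherwise the value `1` at `e 0`. -/
def nodeHi (y : ℝ × ℝ) : ℝ := if y.2 = 1 - |y.1| ∧ y.1 < 0 then 0 else 1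

theorem IsSphereCurve.nodeShare_eq (hγ : IsSphereCurve m γ) (t : ℝ) :
    nodeShare m (γ t) = nodeShare m (γ 0) := by
  obtain ⟨I, -, -, h⟩ := hγ.exists_integrals
  have key : ∀ i (r : ℝ), sq (γ t) i ^ r = sq (γ 0) i ^ r * Real.exp (2 * rate m (I t) i * r) :=
    fun i r => by
      rw [h t i, Real.mul_rpow (sq_nonneg' _ _) (Real.exp_pos _).le, ← Real.exp_mul]
  have hin : nodeIn m (γ t) = nodeIn m (γ 0) * Real.exp (2 * rate m (I t) 1 * m 1) := key 1 _
  have hout : nodeOut m (γ t) = nodeOut m (γ 0) * Real.exp (2 * rate m (I t) 1 * m 1) := by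
    rw [nodeOut, nodeOut, key, key, mul_mul_mul_comm, ← Real.exp_add]
    congr 2
    simp [rate]; ring
  rw [nodeShare, hin, hout, ← add_mul, mul_div_mul_right _ _ (Real.exp_pos _).ne', nodeShare]

theorem IsSphereCurve.nodeMap_fst (hγ : IsSphereCurve m γ) (h0 : m 0 < 0) (h1 : 0 < m 1)
    (h2 : m 2 < 0) (hne : ∀ t i, γ t ≠ e i) :
    StrictMono (fun t => (nodeMap m (γ t)).1) ∧
      Tendsto (fun t => (nodeMap m (γ t)).1) atBot (𝓝 (nodeLo (nodeMap m (γ 0)))) ∧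
      Tendsto (fun t => (nodeMap m (γ t)).1) atTop (𝓝 (nodeHi (nodeMap m (γ 0)))) := by
  have hs := sum_sq (hγ.mem 0)
  have n0 := sq_nonneg' (γ 0) 0
  have n1 := sq_nonneg' (γ 0) 1
  have n2 := sq_nonneg' (γ 0) 2
  have hne' : ∀ i, sq (γ 0) i ≠ 1 := fun i h => hne 0 i (eq_e_of_sq (hγ.mem 0) h)
  constructor
  · refine strictMono_of_hasDerivAt_pos
      (fun t => (hγ.hasDerivAt_sq t 0).sub (hγ.hasDerivAt_sq t 2)) fun t => ?_
    have h02 : ∀ t, 0 < sq (γ t) 0 ∧ 0 < sq (γ t) 2 ∨ 0 < sq (γ t) 0 ∧ 0 < sq (γ t) 1 ∨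
        0 < sq (γ t) 1 ∧ 0 < sq (γ t) 2 := by
      intro t
      have hs := sum_sq (hγ.mem t)
      have hne' : ∀ i, sq (γ t) i ≠ 1 := fun i h => hne t i (eq_e_of_sq (hγ.mem t) h)
      have a0 := hne' 0
      have a1 := hne' 1
      have a2 := hne' 2
      rcases (sq_nonneg' (γ t) 0).lt_or_eq with b0 | b0 <;>
        rcases (sq_nonneg' (γ t) 1).lt_or_eq with b1 | b1 <;>
        rcases (sq_nonneg' (γ t) 2).lt_or_eq with b2 | b2 <;> try tauto
      all_goals exfalso
      · exact a0 (by linarith)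
      · exact a1 (by linarith)
      · exact a2 (by linarith)
      · linarith
    have c0 := sq_nonneg' (γ t) 0
    have c1 := sq_nonneg' (γ t) 1
    have c2 := sq_nonneg' (γ t) 2
    have d0 := mul_nonneg h1.le (mul_nonneg c0 c2)
    have d1 := mul_nonneg (neg_pos.2 h0).le (mul_nonneg c0 c1)
    have d2 := mul_nonneg (neg_pos.2 h2).le (mul_nonneg c1 c2)
    have hform : 2 * (sq (γ t) 0 * rate m (sq (γ t)) 0) - 2 * (sq (γ t) 2 * rate m (sq (γ t)) 2) =
        4 * (m 1 * (sq (γ t) 0 * sq (γ t) 2)) + 2 * (-m 0 * (sq (γ t) 0 * sq (γ t) 1)) +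
          2 * (-m 2 * (sq (γ t) 1 * sq (γ t) 2)) := by
      simp only [rate]; simp; ring
    rw [hform]
    rcases h02 t with ⟨ha, hb⟩ | ⟨ha, hb⟩ | ⟨ha, hb⟩
    · linarith [mul_pos h1 (mul_pos ha hb)]
    · linarith [mul_pos (neg_pos.2 h0) (mul_pos ha hb)]
    · linarith [mul_pos (neg_pos.2 h2) (mul_pos ha hb)]
  · have htend : ∀ (l : Filter ℝ) (Q : E), Tendsto γ l (𝓝 Q) →
        Tendsto (fun t => (nodeMap m (γ t)).1) l (𝓝 (sq Q 0 - sq Q 2)) := fun l Q h =>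
      (tendsto_sq h 0).sub (tendsto_sq h 2)
    have e0 : -m 0 ≠ 0 := neg_ne_zero.2 h0.ne
    have e2 : -m 2 ≠ 0 := neg_ne_zero.2 h2.ne
    rcases n0.lt_or_eq with a0 | a0
    · rcases n2.lt_or_eq with a2 | a2
      · have hlt : |sq (γ 0) 0 - sq (γ 0) 2| < 1 := by
          rw [abs_lt]; constructor <;> linarith
        have hshare : nodeShare m (γ 0) < 1 := by
          have hB : 0 < nodeOut m (γ 0) :=
            mul_pos (Real.rpow_pos_of_pos a0 _) (Real.rpow_pos_of_pos a2 _)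
          have := nodeIn_nonneg (m := m) (γ 0)
          rw [nodeShare, div_lt_one (by linarith)]
          linarith
        have hK : (nodeMap m (γ 0)).2 ≠ 1 - |(nodeMap m (γ 0)).1| :=
          (mul_lt_of_lt_one_right (by linarith) hshare).ne
        rw [nodeLo, if_neg fun h => hK h.1, nodeHi, if_neg fun h => hK h.1]
        obtain ⟨-, -, ht, hb⟩ := hγ.node_limits h0 h1 h2
        have ht' := htend _ _ (ht a0)
        have hb' := htend _ _ (hb a2)
        simp [sq_e] at ht' hb'
        exact ⟨hb', ht'⟩
      · -- the edge from `e 1` to `e 0`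
        have a1 : 0 < sq (γ 0) 1 := n1.lt_of_ne' fun h => hne' 0 (by linarith)
        obtain ⟨-, hb, ht, -⟩ := hγ.edge (i := 0) (j := 1) (k := 2) (by decide) (by decide)
          (by decide) (neg_pos.2 h0) (fun y hy => by simp [rate, hy])
          ((mem_openArc_iff (by decide) (by decide) (by decide)).2 ⟨hγ.mem 0, a2.symm, a0, a1⟩)
        have hshare : nodeShare m (γ 0) = 1 := by
          rw [nodeShare, nodeOut, ← a2, Real.zero_rpow e0, mul_zero, add_zero,
            nodeIn, div_self (Real.rpow_pos_of_pos a1 _).ne']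
        have hp : 0 < (nodeMap m (γ 0)).1 := by simp only [nodeMap]; linarith
        have hK : (nodeMap m (γ 0)).2 = 1 - |(nodeMap m (γ 0)).1| := by
          simp only [nodeMap, hshare, mul_one]
        rw [nodeLo, if_pos ⟨hK, hp⟩, nodeHi, if_neg fun h => hp.not_gt h.2]
        have ht' := htend _ _ ht
        have hb' := htend _ _ hb
        simp [sq_e] at ht' hb'
        exact ⟨hb', ht'⟩
    · -- the edge from `e 2` to `e 1`
      have a1 : 0 < sq (γ 0) 1 := n1.lt_of_ne' fun h => hne' 2 (by linarith)
      have a2 : 0 < sq (γ 0) 2 := n2.lt_of_ne' fun h => hne' 1 (by linarith)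
      obtain ⟨-, hb, ht, -⟩ := hγ.edge (i := 1) (j := 2) (k := 0) (by decide) (by decide)
        (by decide) (neg_pos.2 h2) (fun y hy => by simp [rate, hy])
        ((mem_openArc_iff (by decide) (by decide) (by decide)).2 ⟨hγ.mem 0, a0.symm, a1, a2⟩)
      have hshare : nodeShare m (γ 0) = 1 := by
        rw [nodeShare, nodeOut, ← a0, Real.zero_rpow e2, zero_mul, add_zero,
          nodeIn, div_self (Real.rpow_pos_of_pos a1 _).ne']
      have hp : (nodeMap m (γ 0)).1 < 0 := by simp only [nodeMap]; linarith
      have hK : (nodeMap m (γ 0)).2 = 1 - |(nodeMap m (γ 0)).1| := by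
        simp only [nodeMap, hshare, mul_one]
      rw [nodeLo, if_neg fun h => hp.not_gt h.2, nodeHi, if_pos ⟨hK, hp⟩]
      have ht' := htend _ _ ht
      have hb' := htend _ _ hb
      simp [sq_e] at ht' hb'
      exact ⟨hb', ht'⟩

theorem nodeMap_isModel (h0 : m 0 < 0) (h1 : 0 < m 1) (h2 : m 2 < 0) :
    IsModel m (nodeMap m)
      {y | y.1 ∈ Icc (-1 : ℝ) 1 ∧ (1 - |y.1|) * 0 ≤ y.2 ∧ y.2 ≤ (1 - |y.1|) * 1}
      nodeZeros Prod.fst (fun y => y.2 / (1 - |y.1|)) nodeLo nodeHi := by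
  obtain ⟨hc, hi, him⟩ := nodeMap_coordinates h0 h1 h2
  have hne : ∀ γ, IsSphereCurve m γ → nodeMap m (γ 0) ∉ nodeZeros → ∀ t i, γ t ≠ e i := by
    intro γ hγ h t i hi
    refine h ((nodeMap_mem_iff h0 h1 h2 (hγ.mem 0)).2 ⟨i, ?_⟩)
    rw [hγ.eq_const (s := t) (hi ▸ isEq_e m i) 0, hi]
  have hcurve := fun γ hγ h => IsSphereCurve.nodeMap_fst (m := m) (γ := γ) hγ h0 h1 h2
    (hne γ hγ h)
  refine ⟨hc, hi, him, ?_, ?_, ?_, fun γ hγ h => (hcurve γ hγ h).1,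
    fun γ hγ h => (hcurve γ hγ h).2.1, fun γ hγ h => (hcurve γ hγ h).2.2⟩
  · intro x hx h
    exact (isEq_iff_node h0 h1 h2 hx).2 ((nodeMap_mem_iff h0 h1 h2 hx).1 h)
  · intro γ hγ h t ht
    obtain ⟨i, hi⟩ := (nodeMap_mem_iff h0 h1 h2 (hγ.mem t)).1 ht
    exact hne γ hγ h t i hi
  · intro γ hγ h t
    have hw : ∀ t, 1 - |sq (γ t) 0 - sq (γ t) 2| ≠ 0 := by
      intro t h'
      have hs := sum_sq (hγ.mem t)
      have n0 := sq_nonneg' (γ t) 0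
      have n1 := sq_nonneg' (γ t) 1
      have n2 := sq_nonneg' (γ t) 2
      rcases abs_cases (sq (γ t) 0 - sq (γ t) 2) with ⟨ha, -⟩ | ⟨ha, -⟩
      · exact hne γ hγ h t 0 (eq_e_of_sq (hγ.mem t) (by linarith))
      · exact hne γ hγ h t 2 (eq_e_of_sq (hγ.mem t) (by linarith))
    simp only [nodeMap]
    rw [mul_div_cancel_left₀ _ (hw 0), mul_div_cancel_left₀ _ (hw t), hγ.nodeShare_eq t]

theorem OrbitEquiv.node {m' : Fin 3 → ℝ} (h0 : m 0 < 0) (h1 : 0 < m 1) (h2 : m 2 < 0)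
    (h0' : m' 0 < 0) (h1' : 0 < m' 1) (h2' : m' 2 < 0) : OrbitEquiv m m' := by
  refine (nodeMap_isModel h0 h1 h2).orbitEquiv (nodeMap_isModel h0' h1' h2') continuous_fst ?_
  rintro ⟨p, k⟩ ⟨⟨hp, hk0, hk1⟩, hy⟩ ⟨p', k'⟩ - (rfl : p = p') hl
  simp only at hk0 hk1 hl
  have hp1 : |p| ≤ 1 := abs_le.2 hp
  have : 1 - |p| ≠ 0 := by
    intro h
    rw [h, zero_mul] at hk0 hk1
    have hk : k = 0 := le_antisymm hk1 hk0
    subst hk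
    rcases abs_cases p with ⟨ha, -⟩ | ⟨ha, -⟩
    · exact hy (.inl (by rw [show p = 1 by linarith]))
    · exact hy (.inr (.inr (by rw [show p = -1 by linarith]; rfl)))
  rw [div_left_inj' this] at hl
  rw [hl]

end Node

/-! ### Equivalence of all systems with a center -/

section Center

variable {m m' : Fin 3 → ℝ}

theorem exists_zero_of_centerLevel (hm : ∀ i, 0 < m i) {x : E} (h : centerLevel m (sq x) = 0) :
    ∃ i, sq x i = 0 := by
  by_contra! hne
  exact (centerLevel_pos hm fun i => (sq_nonneg' x i).lt_of_ne' (hne i)).ne' h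

/-- On the boundary, the coordinate `centerMap m` is a function of the ratios of the numbers
`sq x i / centerWeight m i`. -/
theorem centerMap_eq_iff (hm : ∀ i, 0 < m i) (hm' : ∀ i, 0 < m' i) {x x' : E} (hx : x ∈ sphere)
    (hx' : x' ∈ sphere) (h : centerLevel m (sq x) = 0) (h' : centerLevel m' (sq x') = 0) :
    centerMap m x = centerMap m' x' ↔ ∃ c : ℝ, 0 < c ∧
      ∀ i, sq x i / centerWeight m i = c * (sq x' i / centerWeight m' i) := by
  have hz : ∀ {m : Fin 3 → ℝ}, (∀ i, 0 < m i) → ∀ {x : E}, x ∈ sphere →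
      centerLevel m (sq x) = 0 → 0 < ‖centerCoord m (sq x)‖ := by
    intro m hm x hx h
    rw [norm_pos_iff]
    intro h'
    rw [(centerCoord_eq_zero_iff hm (sum_sq hx)).1 h', centerLevel_weight hm] at h
    exact one_ne_zero h
  have n := hz hm hx h
  have n' := hz hm' hx' h'
  have hq : ∀ {m : Fin 3 → ℝ}, (∀ i, 0 < m i) → ∀ (x : E) i, 0 ≤ sq x i / centerWeight m i :=
    fun hm x i => div_nonneg (sq_nonneg' x i) (centerWeight_pos hm i).le
  rw [centerMap, centerMap, h, h', sub_zero]
  constructor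
  · intro heq
    obtain ⟨c, hc, hcz⟩ : ∃ c : ℝ, 0 < c ∧ centerCoord m (sq x) = c • centerCoord m' (sq x') := by
      refine ⟨‖centerCoord m (sq x)‖ / ‖centerCoord m' (sq x')‖, div_pos n n', ?_⟩
      rw [one_div, one_div] at heq
      rw [div_eq_mul_inv, mul_smul, ← heq, smul_inv_smul₀ n.ne']
    refine ⟨c, hc, ?_⟩
    have h0 := congrArg Complex.re hcz
    have h1 := congrArg Complex.im hcz
    simp [centerCoord] at h0 h1
    -- Both triples of ratios have a vanishing entry.
    obtain ⟨i, hi⟩ := exists_zero_of_centerLevel hm h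
    obtain ⟨j, hj⟩ := exists_zero_of_centerLevel hm' h'
    have hd : ∀ l, sq x l / centerWeight m l = c * (sq x' l / centerWeight m' l) +
        (sq x 2 / centerWeight m 2 - c * (sq x' 2 / centerWeight m' 2)) := by
      intro l
      fin_cases l <;> simp <;> linarith
    have d1 := hd i
    have d2 := hd j
    rw [hi, zero_div] at d1
    rw [hj, zero_div, mul_zero, zero_add] at d2
    have d3 := mul_nonneg hc.le (hq hm' x' i)
    have d4 := hq hm x j
    intro l
    rw [hd l]
    linarith
  · rintro ⟨c, hc, hcq⟩
    have : centerCoord m (sq x) = c • centerCoord m' (sq x') := by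
      apply Complex.ext <;> simp [centerCoord, hcq] <;> ring
    rw [this, norm_smul, Real.norm_of_nonneg hc.le, smul_smul]
    congr 1
    field_simp

theorem exists_reparam_edge (hm : ∀ i, 0 < m i) (hm' : ∀ i, 0 < m' i) {γ δ : ℝ → E}
    (hγ : IsSphereCurve m γ) (hδ : IsSphereCurve m' δ) {i j k : Fin 3} (hij : i ≠ j) (hik : i ≠ k)
    (hjk : j ≠ k) {κ κ' : ℝ} (hκ : 0 < κ) (hκ' : 0 < κ')
    (hr : ∀ y : Fin 3 → ℝ, y k = 0 → rate m y i = κ * y j)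
    (hr' : ∀ y : Fin 3 → ℝ, y k = 0 → rate m' y i = κ' * y j)
    (h : γ 0 ∈ openArc i j) (h' : δ 0 ∈ openArc i j) :
    ∃ τ : ℝ ≃o ℝ, ∀ t, centerMap m' (δ t) = centerMap m (γ (τ t)) := by
  -- The ratio of the two nonzero coordinates measures the position on the edge.
  have key : ∀ {m : Fin 3 → ℝ}, (∀ i, 0 < m i) → ∀ {γ : ℝ → E}, IsSphereCurve m γ →
      ∀ {κ : ℝ}, 0 < κ → (∀ y : Fin 3 → ℝ, y k = 0 → rate m y i = κ * y j) → γ 0 ∈ openArc i j →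
      (∀ t, sq (γ t) k = 0 ∧ 0 < sq (γ t) i / centerWeight m i ∧
        0 < sq (γ t) j / centerWeight m j) ∧
      StrictMono (fun t => sq (γ t) i / centerWeight m i /
        (sq (γ t) i / centerWeight m i + sq (γ t) j / centerWeight m j)) ∧
      range (fun t => sq (γ t) i / centerWeight m i /
        (sq (γ t) i / centerWeight m i + sq (γ t) j / centerWeight m j)) = Ioo 0 1 := by
    intro m hm γ hγ κ hκ hr h
    have hw := centerWeight_pos hm
    obtain ⟨hmono, hb, ht, hR⟩ := hγ.edge hij hik hjk hκ hr h
    have hmem : ∀ t, sq (γ t) k = 0 ∧ 0 < sq (γ t) i ∧ 0 < sq (γ t) j := fun t =>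
      ((mem_openArc_iff hij hik hjk).1 (hR ▸ mem_range_self t)).2
    have hq : ∀ t, sq (γ t) k = 0 ∧ 0 < sq (γ t) i / centerWeight m i ∧
        0 < sq (γ t) j / centerWeight m j := fun t =>
      ⟨(hmem t).1, div_pos (hmem t).2.1 (hw i), div_pos (hmem t).2.2 (hw j)⟩
    have hsum := fun t => sum_sq_edge (hγ.mem t) hij hik hjk (hmem t).1
    have hm2 : StrictMono (fun t => sq (γ t) i / centerWeight m i /
        (sq (γ t) i / centerWeight m i + sq (γ t) j / centerWeight m j)) := by
      intro s t hst
      have h1 : sq (γ s) i < sq (γ t) i := hmono hst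
      have h2 : sq (γ t) j < sq (γ s) j := by linarith [hsum s, hsum t]
      have h3 := div_lt_div_of_pos_right h1 (hw i)
      have h4 := div_lt_div_of_pos_right h2 (hw j)
      obtain ⟨-, s1, s2⟩ := hq s
      obtain ⟨-, t1, t2⟩ := hq t
      simp only
      rw [div_lt_div_iff₀ (by linarith) (by linarith)]
      nlinarith
    refine ⟨hq, hm2, range_eq_Ioo ?_ hm2 ?_ ?_⟩
    · have hc : ∀ i, Continuous fun t => sq (γ t) i / centerWeight m i := fun i =>
        ((continuous_sq i).comp hγ.continuous).div_const _
      exact (hc i).div ((hc i).add (hc j)) fun t => (add_pos (hq t).2.1 (hq t).2.2).ne'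
    · have bi := (tendsto_sq hb i).div_const (centerWeight m i)
      have bj := (tendsto_sq hb j).div_const (centerWeight m j)
      rw [sq_e, if_neg hij, zero_div] at bi
      rw [sq_e, if_pos rfl] at bj
      have hne : 0 + 1 / centerWeight m j ≠ 0 := by
        rw [zero_add]; exact (one_div_pos.2 (hw j)).ne'
      have := bi.div (bi.add bj) hne
      rwa [zero_div] at this
    · have bi := (tendsto_sq ht i).div_const (centerWeight m i)
      have bj := (tendsto_sq ht j).div_const (centerWeight m j)
      rw [sq_e, if_neg hij.symm, zero_div] at bj
      rw [sq_e, if_pos rfl] at bi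
      have hne : 1 / centerWeight m i + 0 ≠ 0 := by
        rw [add_zero]; exact (one_div_pos.2 (hw i)).ne'
      have := bi.div (bi.add bj) hne
      rwa [add_zero, div_self (one_div_pos.2 (hw i)).ne'] at this
  obtain ⟨hq, hmono, hR⟩ := key hm hγ hκ hr h
  obtain ⟨hq', hmono', hR'⟩ := key hm' hδ hκ' hr' h'
  obtain ⟨τ, hτ⟩ := exists_reparam hmono hmono' (hR.trans hR'.symm)
  refine ⟨τ, fun t => (centerMap_eq_iff hm' hm (hδ.mem t) (hγ.mem _)
    (centerLevel_eq_zero hm' (hq' t).1) (centerLevel_eq_zero hm (hq _).1)).2 ?_⟩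
  obtain ⟨z, a, b⟩ := hq (τ t)
  obtain ⟨z', a', b'⟩ := hq' t
  have hτt := hτ t
  refine ⟨(sq (δ t) i / centerWeight m' i + sq (δ t) j / centerWeight m' j) /
    (sq (γ (τ t)) i / centerWeight m i + sq (γ (τ t)) j / centerWeight m j), by positivity,
    fun l => ?_⟩
  rw [div_eq_div_iff (add_pos a' b').ne' (add_pos a b).ne'] at hτt
  rw [div_mul_eq_mul_div, eq_div_iff (add_pos a b).ne']
  rcases show l = i ∨ l = j ∨ l = k by omega with rfl | rfl | rfl
  · rw [hτt, mul_comm]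
  · linear_combination -hτt
  · rw [z, z']; ring

theorem OrbitEquiv.center (hm : ∀ i, 0 < m i) (hm' : ∀ i, 0 < m' i) : OrbitEquiv m m' := by
  refine .of_coordinates (continuousOn_centerMap hm) (continuousOn_centerMap hm')
    (injOn_centerMap hm) (injOn_centerMap hm')
    ((image_centerMap hm).trans (image_centerMap hm').symm) fun γ δ hγ hδ h0 => ?_
  have hF : centerLevel m (sq (γ 0)) = centerLevel m' (sq (δ 0)) := by
    have h1 := norm_centerMap hm (hγ.mem 0)
    have h2 := norm_centerMap hm' (hδ.mem 0)
    rw [h0, h2] at h1; linarith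
  have hconst : IsEq m (γ 0) → IsEq m' (δ 0) →
      ∃ τ : ℝ ≃o ℝ, ∀ t, centerMap m' (δ t) = centerMap m (γ (τ t)) := fun h h' =>
    ⟨OrderIso.refl ℝ, fun t => by rw [hγ.eq_const h, hδ.eq_const h', h0]⟩
  rcases (centerLevel_le_one hm (sq_nonneg' (γ 0)) (sum_sq (hγ.mem 0))).lt_or_eq with h1 | h1
  · rcases (centerLevel_nonneg hm (sq_nonneg' (γ 0))).lt_or_eq with h2 | h2
    · obtain ⟨θ, -, hθ⟩ := hγ.exists_rotation hm h2 h1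
      obtain ⟨θ', -, hθ'⟩ := hδ.exists_rotation hm' (hF ▸ h2) (hF ▸ h1)
      refine ⟨θ'.trans θ.symm, fun t => ?_⟩
      rw [hθ, hθ', h0, OrderIso.trans_apply, OrderIso.apply_symm_apply]
    · obtain ⟨c, hc, hcq⟩ := (centerMap_eq_iff hm hm' (hγ.mem 0) (hδ.mem 0) h2.symm
        (hF ▸ h2.symm)).1 h0
      have hpos : ∀ l, 0 < sq (γ 0) l ↔ 0 < sq (δ 0) l := fun l => by
        have e1 := centerWeight_pos hm l
        have e2 := centerWeight_pos hm' l
        rw [← div_pos_iff_of_pos_right e1, hcq l, mul_pos_iff_of_pos_left hc,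
          div_pos_iff_of_pos_right e2]
      have hzero : ∀ l, sq (γ 0) l = 0 → sq (δ 0) l = 0 := fun l h =>
        le_antisymm (not_lt.1 fun h' => ((hpos l).2 h').ne' h) (sq_nonneg' _ _)
      have hedge : ∀ {i j k : Fin 3}, i ≠ j → i ≠ k → j ≠ k → γ 0 ∈ openArc i j →
          δ 0 ∈ openArc i j := by
        intro i j k hij hik hjk h
        rw [mem_openArc_iff hij hik hjk] at h ⊢
        exact ⟨hδ.mem 0, hzero k h.2.1, (hpos i).1 h.2.2.1, (hpos j).1 h.2.2.2⟩
      rcases mem_bdSphere_cases (hγ.mem 0) (exists_zero_of_centerLevel hm h2.symm) with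
        ⟨i, hi⟩ | h | h | h
      · refine hconst (hi ▸ isEq_e m i) ?_
        have hδ0 : δ 0 = e i := by
          have hz : ∀ l, l ≠ i → sq (δ 0) l = 0 := fun l hl =>
            hzero l (by rw [hi, sq_e, if_neg hl])
          have hs := sum_sq (hδ.mem 0)
          refine eq_e_of_sq (hδ.mem 0) ?_
          clear hi
          fin_cases i
          · have z1 := hz 1 (by decide)
            have z2 := hz 2 (by decide)
            simp only [Fin.zero_eta]; linarith
          · have z1 := hz 0 (by decide)
            have z2 := hz 2 (by decide)
            simp only [Fin.mk_one]; linarith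
          · have z1 := hz 0 (by decide)
            have z2 := hz 1 (by decide)
            simp only [Fin.reduceFinMk]; linarith
        exact hδ0 ▸ isEq_e m' i
      · rw [openArc_comm] at h
        exact exists_reparam_edge hm hm' hγ hδ (i := 1) (j := 0) (k := 2) (by decide) (by decide)
          (by decide) (hm 0) (hm' 0) (fun y hy => by simp [rate, hy])
          (fun y hy => by simp [rate, hy]) h
          (hedge (k := 2) (by decide) (by decide) (by decide) h)
      · rw [openArc_comm] at h
        exact exists_reparam_edge hm hm' hγ hδ (i := 2) (j := 1) (k := 0) (by decide) (by decide)
          (by decide) (hm 2) (hm' 2) (fun y hy => by simp [rate, hy])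
          (fun y hy => by simp [rate, hy]) h
          (hedge (k := 0) (by decide) (by decide) (by decide) h)
      · exact exists_reparam_edge hm hm' hγ hδ (i := 0) (j := 2) (k := 1) (by decide) (by decide)
          (by decide) (hm 1) (hm' 1) (fun y hy => by simp [rate, hy])
          (fun y hy => by simp [rate, hy]) h
          (hedge (k := 1) (by decide) (by decide) (by decide) h)
  · have key : ∀ {m : Fin 3 → ℝ}, (∀ i, 0 < m i) → ∀ {x : E}, x ∈ sphere →
        centerLevel m (sq x) = 1 → IsEq m x := by
      intro m hm x hx h
      refine (isEq_iff_center hm hx).2 (.inr ?_)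
      by_contra hne
      exact (centerLevel_lt_one hm (sq_nonneg' x) (sum_sq hx) hne).ne h
    exact hconst (key hm (hγ.mem 0) h1) (key hm' (hδ.mem 0) (hF ▸ h1))

end Center

/-! ### Reduction to the listed cases -/

theorem OrbitEquiv.of_listedCase {p q : Params} {k : Fin 6} (hp : ListedCase p k)
    (hq : ListedCase q k) : OrbitEquiv p.m q.m := by
  have all3 : ∀ {P : Fin 3 → Prop}, P 0 → P 1 → P 2 → ∀ i, P i := fun h0 h1 h2 i => by
    fin_cases i <;> assumption
  fin_cases k
  · obtain ⟨h0, h1, h2⟩ := hp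
    obtain ⟨h0', h1', h2'⟩ := hq
    exact .center (all3 h0 h1 h2) (all3 h0' h1' h2')
  · obtain ⟨h0, h1, h2⟩ := hp
    obtain ⟨h0', h1', h2'⟩ := hq
    exact .node h0 h1 h2 h0' h1' h2'
  · obtain ⟨h0, h1, h2⟩ := hp
    obtain ⟨h0', h1', h2'⟩ := hq
    exact .saddle h0 h1 h2 h0' h1' h2'
  · obtain ⟨h0, h1, h2⟩ := hp
    obtain ⟨h0', h1', h2'⟩ := hq
    exact .star h0 h1 h2 h0' h1' h2'
  · obtain ⟨h0, h1, h2⟩ := hp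
    obtain ⟨h0', h1', h2'⟩ := hq
    have : q.m = fun i => q.m 2 / p.m 2 * p.m i := by
      funext i
      fin_cases i
      · simp [h0, h0']
      · simp [h1, h1']
      · simp [h2.ne]
    rw [this]
    exact .smul _ (div_pos_of_neg_of_neg h2' h2)
  · obtain ⟨h0, h1, h2⟩ := hp
    obtain ⟨h0', h1', h2'⟩ := hq
    have : q.m = p.m := by
      funext i
      fin_cases i
      · exact h0'.trans h0.symm
      · exact h1'.trans h1.symm
      · exact h2'.trans h2.symm
    rw [this]
    exact .refl _

theorem swap_apply_ne {a c : Fin 3} (h : a ≠ c) (i : Fin 3) : Equiv.swap a i c ≠ i := fun h' =>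
  h ((Equiv.swap a i).injective ((Equiv.swap_apply_left a i).trans h'.symm))

/-- After a permutation of the coordinates and a reversal of time, every system belongs to one of
the listed cases. -/
theorem SignClass.exists_listedCase {p : Params} {k : Fin 6} (hp : SignClass p k) :
    ∃ q : Params, ListedCase q k ∧ WeakEquiv p.m q.m := by
  have refl : WeakEquiv p.m p.m := .inl (.refl _)
  have swap := WeakEquiv.swap p.m
  -- Every vector that is equivalent to `p.m`, or its negative, is realized by a system.
  have pos : ∀ {m'}, WeakEquiv p.m m' → ∀ {P : Params → Prop}, (∀ q : Params, q.m = m' → P q) →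
      ∃ q, P q ∧ WeakEquiv p.m q.m := by
    intro m' h P hP
    obtain ⟨q, rfl⟩ := exists_params m'
    exact ⟨q, hP q rfl, h⟩
  have neg : ∀ {m'}, WeakEquiv p.m m' → ∀ {P : Params → Prop},
      (∀ q : Params, (q.m = fun i => -m' i) → P q) → ∃ q, P q ∧ WeakEquiv p.m q.m :=
    fun {m'} h => pos (h.trans (.of_neg m'))
  fin_cases k
  · rcases hp with h | h
    · refine pos refl fun q hq => ?_
      change 0 < q.m 0 ∧ 0 < q.m 1 ∧ 0 < q.m 2
      rw [hq]
      exact ⟨h 0, h 1, h 2⟩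
    · refine neg refl fun q hq => ?_
      change 0 < q.m 0 ∧ 0 < q.m 1 ∧ 0 < q.m 2
      simp only [hq, neg_pos]
      exact ⟨h 0, h 1, h 2⟩
  · obtain ⟨hne, i, j, hij⟩ := hp
    change ∃ q : Params, (q.m 0 < 0 ∧ 0 < q.m 1 ∧ q.m 2 < 0) ∧ _
    have s01 : ∀ m : Fin 3 → ℝ, m ∘ Equiv.swap 0 1 = ![m 1, m 0, m 2] := fun m => by
      funext l; fin_cases l <;> simp [Equiv.swap_apply_def]
    have s12 : ∀ m : Fin 3 → ℝ, m ∘ Equiv.swap 1 2 = ![m 0, m 2, m 1] := fun m => by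
      funext l; fin_cases l <;> simp [Equiv.swap_apply_def]
    have w01 := swap 0 1
    have w12 := swap 1 2
    rw [s01] at w01
    rw [s12] at w12
    rcases (hne 0).lt_or_gt with h0 | h0 <;> rcases (hne 1).lt_or_gt with h1 | h1 <;>
      rcases (hne 2).lt_or_gt with h2 | h2
    · exfalso
      have hn : ∀ l, p.m l < 0 := fun l => by fin_cases l <;> assumption
      exact hij.not_gt (mul_pos_of_neg_of_neg (hn i) (hn j))
    · exact pos w12 fun q hq => by rw [hq]; simp [h0, h1, h2]
    · exact pos refl fun q hq => by rw [hq]; exact ⟨h0, h1, h2⟩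
    · exact neg w01 fun q hq => by rw [hq]; simp [h0, h1, h2]
    · exact pos w01 fun q hq => by rw [hq]; simp [h0, h1, h2]
    · exact neg refl fun q hq => by rw [hq]; simp [h0, h1, h2]
    · exact neg w12 fun q hq => by rw [hq]; simp [h0, h1, h2]
    · exfalso
      have hn : ∀ l, 0 < p.m l := fun l => by fin_cases l <;> assumption
      exact hij.not_gt (mul_pos (hn i) (hn j))
  · obtain ⟨i, j, k, hij, hik, hjk, hi, hpos⟩ := hp
    change ∃ q : Params, (q.m 0 = 0 ∧ 0 < q.m 1 ∧ 0 < q.m 2) ∧ _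
    have c1 : Equiv.swap 0 i 1 ≠ i := swap_apply_ne (by decide) i
    have c2 : Equiv.swap 0 i 2 ≠ i := swap_apply_ne (by decide) i
    rcases mul_pos_iff.1 hpos with ⟨hj, hk⟩ | ⟨hj, hk⟩
    · have hl : ∀ l, l ≠ i → 0 < p.m l := fun l hl => by
        rcases show l = j ∨ l = k by omega with rfl | rfl <;> assumption
      exact pos (swap 0 i) fun q hq => by rw [hq]; simpa [hi] using ⟨hl _ c1, hl _ c2⟩
    · have hl : ∀ l, l ≠ i → p.m l < 0 := fun l hl => by
        rcases show l = j ∨ l = k by omega with rfl | rfl <;> assumption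
      exact neg (swap 0 i) fun q hq => by rw [hq]; simpa [hi] using ⟨hl _ c1, hl _ c2⟩
  · obtain ⟨i, j, k, hij, hik, hjk, hi, hneg⟩ := hp
    change ∃ q : Params, (0 < q.m 0 ∧ q.m 1 = 0 ∧ q.m 2 < 0) ∧ _
    have c0 : Equiv.swap 1 i 0 ≠ i := swap_apply_ne (by decide) i
    have c2 : Equiv.swap 1 i 2 ≠ i := swap_apply_ne (by decide) i
    have c02 : Equiv.swap 1 i 0 ≠ Equiv.swap 1 i 2 := (Equiv.injective _).ne (by decide)
    have hprod : p.m (Equiv.swap 1 i 0) * p.m (Equiv.swap 1 i 2) < 0 := by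
      generalize Equiv.swap 1 i 0 = a at *
      generalize Equiv.swap 1 i 2 = b at *
      rcases show (a = j ∧ b = k) ∨ (a = k ∧ b = j) by omega with ⟨rfl, rfl⟩ | ⟨rfl, rfl⟩
      · exact hneg
      · rwa [mul_comm]
    rcases mul_neg_iff.1 hprod with ⟨ha, hb⟩ | ⟨ha, hb⟩
    · exact pos (swap 1 i) fun q hq => by rw [hq]; simpa [hi] using ⟨ha, hb⟩
    · exact neg (swap 1 i) fun q hq => by rw [hq]; simpa [hi] using ⟨ha, hb⟩
  · obtain ⟨i, j, k, hij, hik, hjk, hi, hj, hk⟩ := hp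
    change ∃ q : Params, (q.m 0 = 0 ∧ q.m 1 = 0 ∧ q.m 2 < 0) ∧ _
    have c0 : Equiv.swap 2 k 0 ≠ k := swap_apply_ne (by decide) k
    have c1 : Equiv.swap 2 k 1 ≠ k := swap_apply_ne (by decide) k
    have hl : ∀ l, l ≠ k → p.m l = 0 := fun l hl => by
      rcases show l = i ∨ l = j by omega with rfl | rfl <;> assumption
    rcases hk.lt_or_gt with hk | hk
    · exact pos (swap 2 k) fun q hq => by rw [hq]; simpa [hk] using ⟨hl _ c0, hl _ c1⟩
    · exact neg (swap 2 k) fun q hq => by rw [hq]; simpa [hk] using ⟨hl _ c0, hl _ c1⟩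
  · exact ⟨p, ⟨hp 0, hp 1, hp 2⟩, refl⟩

/-! ### Invariants of equivalence -/

/-- The equilibria on the sphere. -/
def restPoints (m : Fin 3 → ℝ) : Set sphere := {x | IsEq m x}

/-- A solution on the sphere that is not constant. -/
def IsMoving (m : Fin 3 → ℝ) (γ : ℝ → sphere) : Prop :=
  IsSphereCurve m (fun t => (γ t : E)) ∧ ∀ t, γ t ∉ restPoints m

/-- Some point is the limit of moving solutions both in forward and in backward time. -/
def HasTransit (m : Fin 3 → ℝ) : Prop :=
  ∃ x : sphere, (∃ γ, IsMoving m γ ∧ Tendsto γ atTop (𝓝 x)) ∧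
    ∃ γ, IsMoving m γ ∧ Tendsto γ atBot (𝓝 x)

/-- All moving solutions converge to the same point, either in forward or in backward time. -/
def HasFocus (m : Fin 3 → ℝ) : Prop :=
  ∃ x : sphere, (∀ γ, IsMoving m γ → Tendsto γ atTop (𝓝 x)) ∨
    ∀ γ, IsMoving m γ → Tendsto γ atBot (𝓝 x)

section Invariants

variable {m m' : Fin 3 → ℝ}

theorem restPoints_neg (m : Fin 3 → ℝ) : restPoints (fun i => -m i) = restPoints m := by
  ext x; exact isEq_neg

theorem IsMoving.reverse {γ : ℝ → sphere} (h : IsMoving m γ) :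
    IsMoving (fun i => -m i) fun t => γ (-t) :=
  ⟨h.1.reverse, fun t => by rw [restPoints_neg]; exact h.2 _⟩

theorem HasTransit.neg (h : HasTransit m) : HasTransit fun i => -m i := by
  obtain ⟨x, ⟨γ, hγ, hx⟩, δ, hδ, hx'⟩ := h
  exact ⟨x, ⟨_, hδ.reverse, hx'.comp tendsto_neg_atTop_atBot⟩,
    _, hγ.reverse, hx.comp tendsto_neg_atBot_atTop⟩

theorem HasFocus.neg (h : HasFocus m) : HasFocus fun i => -m i := by
  obtain ⟨x, hx⟩ := h
  have key : ∀ γ, IsMoving (fun i => -m i) γ → IsMoving m fun t => γ (-t) := fun γ hγ => by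
    simpa using hγ.reverse
  refine ⟨x, hx.symm.imp (fun hx γ hγ => ?_) fun hx γ hγ => ?_⟩
  · simpa [Function.comp_def] using (hx _ (key γ hγ)).comp tendsto_neg_atTop_atBot
  · simpa [Function.comp_def] using (hx _ (key γ hγ)).comp tendsto_neg_atBot_atTop

/-- What an equivalence does to equilibria and to moving solutions. -/
theorem OrbitEquiv.exists_homeomorph (h : OrbitEquiv m m') : ∃ φ : sphere ≃ₜ sphere,
    (∀ x, φ x ∈ restPoints m' ↔ x ∈ restPoints m) ∧
      ∀ γ, IsMoving m γ → ∃ τ : ℝ ≃o ℝ, IsMoving m' fun t => φ (γ (τ t)) := by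
  obtain ⟨φ, hφ⟩ := h
  have hrest : ∀ x, φ x ∈ restPoints m' ↔ x ∈ restPoints m := by
    intro x
    constructor
    · intro hx
      obtain ⟨γ, hγ, h0⟩ := exists_isSphereCurve m x.2
      obtain ⟨τ, hτ⟩ := hφ (fun t => ⟨γ t, hγ.mem t⟩) hγ
      have hx0 : (⟨γ 0, hγ.mem 0⟩ : sphere) = x := Subtype.ext h0
      have hc : ∀ t, γ t = γ 0 := fun t => by
        have := hτ.eq_const (s := τ.symm 0) (by
          rw [τ.apply_symm_apply, hx0]; exact hx) (τ.symm t)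
        simpa using congrArg Subtype.val (φ.injective (Subtype.ext this))
      have := hγ.isEq_of_const hc
      rwa [h0] at this
    · intro hx
      obtain ⟨τ, hτ⟩ := hφ (fun _ => x) (.of_isEq x.2 hx)
      exact hτ.isEq_of_const fun t => rfl
  refine ⟨φ, hrest, fun γ hγ => ?_⟩
  obtain ⟨τ, hτ⟩ := hφ γ hγ.1
  exact ⟨τ, hτ, fun t => by rw [hrest]; exact hγ.2 _⟩

theorem OrbitEquiv.encard_restPoints (h : OrbitEquiv m m') :
    (restPoints m).encard = (restPoints m').encard := by
  obtain ⟨φ, hφ, -⟩ := h.exists_homeomorph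
  rw [← φ.injective.encard_image]
  congr 1
  ext y
  constructor
  · rintro ⟨x, hx, rfl⟩
    exact (hφ x).2 hx
  · intro hy
    exact ⟨φ.symm y, (hφ _).1 (by simpa using hy), φ.apply_symm_apply y⟩

theorem OrbitEquiv.restPoints_eq_univ (h : OrbitEquiv m m') (hu : restPoints m = univ) :
    restPoints m' = univ := by
  obtain ⟨φ, hφ, -⟩ := h.exists_homeomorph
  refine eq_univ_of_forall fun y => ?_
  have := (hφ (φ.symm y)).2 (hu ▸ mem_univ _)
  simpa using this

theorem OrbitEquiv.hasTransit (h : OrbitEquiv m m') (ht : HasTransit m) : HasTransit m' := by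
  obtain ⟨φ, -, hφ⟩ := h.exists_homeomorph
  obtain ⟨x, ⟨γ, hγ, hx⟩, δ, hδ, hx'⟩ := ht
  obtain ⟨τ, hτ⟩ := hφ γ hγ
  obtain ⟨σ, hσ⟩ := hφ δ hδ
  exact ⟨φ x, ⟨_, hτ, (φ.continuous.tendsto x).comp (hx.comp τ.tendsto_atTop)⟩,
    _, hσ, (φ.continuous.tendsto x).comp (hx'.comp σ.tendsto_atBot)⟩

theorem OrbitEquiv.hasFocus (h : OrbitEquiv m m') (hf : HasFocus m') : HasFocus m := by
  obtain ⟨φ, -, hφ⟩ := h.exists_homeomorph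
  obtain ⟨x, hx⟩ := hf
  have key : ∀ l : Filter ℝ, (∀ τ : ℝ ≃o ℝ, Tendsto τ l l) →
      (∀ γ, IsMoving m' γ → Tendsto γ l (𝓝 x)) →
      ∀ γ, IsMoving m γ → Tendsto γ l (𝓝 (φ.symm x)) := by
    intro l hl hx γ hγ
    obtain ⟨τ, hτ⟩ := hφ γ hγ
    have := ((φ.symm.continuous.tendsto x).comp (hx _ hτ)).comp (hl τ.symm)
    simpa [Function.comp_def] using this
  exact ⟨φ.symm x, hx.imp (key _ fun τ => τ.tendsto_atTop) (key _ fun τ => τ.tendsto_atBot)⟩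

theorem WeakEquiv.encard_restPoints (h : WeakEquiv m m') :
    (restPoints m).encard = (restPoints m').encard := by
  rcases h with h | h
  · exact h.encard_restPoints
  · rw [← restPoints_neg m]; exact h.encard_restPoints

theorem WeakEquiv.restPoints_eq_univ_iff (h : WeakEquiv m m') :
    restPoints m = univ ↔ restPoints m' = univ := by
  rcases h with h | h
  · exact ⟨h.restPoints_eq_univ, h.symm.restPoints_eq_univ⟩
  · rw [← restPoints_neg m]; exact ⟨h.restPoints_eq_univ, h.symm.restPoints_eq_univ⟩

theorem WeakEquiv.hasTransit_iff (h : WeakEquiv m m') : HasTransit m ↔ HasTransit m' := by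
  rcases h with h | h
  · exact ⟨h.hasTransit, h.symm.hasTransit⟩
  · exact ⟨fun ht => h.hasTransit ht.neg, fun ht => by simpa using (h.symm.hasTransit ht).neg⟩

theorem WeakEquiv.hasFocus_iff (h : WeakEquiv m m') : HasFocus m ↔ HasFocus m' := by
  rcases h with h | h
  · exact ⟨h.symm.hasFocus, h.hasFocus⟩
  · exact ⟨fun ht => h.symm.hasFocus ht.neg, fun ht => by simpa using (h.hasFocus ht).neg⟩

/-! ### The values of the invariants -/

theorem encard_restPoints (m : Fin 3 → ℝ) :
    (restPoints m).encard = {x : E | x ∈ sphere ∧ IsEq m x}.encard := by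
  rw [← Subtype.val_injective.encard_image]
  congr 1
  ext x
  constructor
  · rintro ⟨y, hy, rfl⟩
    exact ⟨y.2, hy⟩
  · rintro ⟨hx, h⟩
    exact ⟨⟨x, hx⟩, h, rfl⟩

theorem encard_vertices : {x : E | ∃ i, x = e i}.encard = 3 := by
  have : {x : E | ∃ i, x = e i} = e '' univ := by
    ext x
    simp [eq_comm]
  rw [this, e_injective.encard_image]
  simp

theorem encard_restPoints_center (hm : ∀ i, 0 < m i) : (restPoints m).encard = 4 := by
  have hw := centerWeight_pos hm
  have hsq : sq (ofSq (centerWeight m)) = centerWeight m := funext (sq_ofSq fun i => (hw i).le)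
  have hmem : ofSq (centerWeight m) ∈ sphere :=
    ofSq_mem_sphere (fun i => (hw i).le) (sum_centerWeight hm)
  have : {x : E | x ∈ sphere ∧ IsEq m x} =
      insert (ofSq (centerWeight m)) {x : E | ∃ i, x = e i} := by
    ext x
    constructor
    · rintro ⟨hx, h⟩
      rcases (isEq_iff_center hm hx).1 h with h | h
      · exact .inr h
      · exact .inl (sq_inj hx.1 hmem.1 fun i => by rw [h, hsq])
    · rintro (rfl | ⟨i, rfl⟩)
      · exact ⟨hmem, (isEq_iff_center hm hmem).2 (.inr hsq)⟩
      · exact ⟨e_mem_sphere i, isEq_e m i⟩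
  rw [encard_restPoints, this, encard_insert_of_notMem, encard_vertices]
  · rfl
  · rintro ⟨i, hi⟩
    have h1 := hw (i + 1)
    rw [← hsq, hi, sq_e, if_neg (by fin_cases i <;> decide)] at h1
    exact lt_irrefl _ h1

theorem encard_restPoints_node (h0 : m 0 < 0) (h1 : 0 < m 1) (h2 : m 2 < 0) :
    (restPoints m).encard = 3 := by
  rw [encard_restPoints, ← encard_vertices]
  congr 1
  ext x
  constructor
  · rintro ⟨hx, h⟩
    exact (isEq_iff_node h0 h1 h2 hx).1 h
  · rintro ⟨i, rfl⟩
    exact ⟨e_mem_sphere i, isEq_e m i⟩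

theorem infinite_arc {i j k : Fin 3} (hij : i ≠ j) (hik : i ≠ k) (hjk : j ≠ k) :
    (arc i j).Infinite := by
  let y : ℝ → Fin 3 → ℝ := fun s l => if l = i then s else if l = j then 1 - s else 0
  have hy : ∀ s ∈ Icc (0 : ℝ) 1, ∀ l, 0 ≤ y s l := by
    intro s hs l
    simp only [y]
    split_ifs
    · exact hs.1
    · linarith [hs.2]
    · exact le_rfl
  refine ((Icc_infinite (zero_lt_one' ℝ)).image (f := fun s => ofSq (y s)) ?_).mono ?_
  · intro s hs t ht hst
    have := congrArg (fun x => sq x i) hst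
    simp only [sq_ofSq (hy s hs), sq_ofSq (hy t ht)] at this
    simpa [y] using this
  · rintro _ ⟨s, hs, rfl⟩
    refine (mem_arc_iff hij hik hjk).2 ⟨ofSq_mem_sphere (hy s hs) ?_, ?_⟩
    · have hi : y s i = s := if_pos rfl
      have hj : y s j = 1 - s := by simp [y, hij.symm]
      have hk : y s k = 0 := by simp [y, hik.symm, hjk.symm]
      clear_value y
      fin_cases i <;> fin_cases j <;> fin_cases k <;> simp at hij hik hjk hi hj hk ⊢ <;> linarith
    · rw [sq_ofSq (hy s hs)]
      simp [y, hik.symm, hjk.symm]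

theorem encard_restPoints_eq_top {i j k : Fin 3} (hij : i ≠ j) (hik : i ≠ k) (hjk : j ≠ k)
    (h : ∀ x ∈ sphere, sq x k = 0 → IsEq m x) : (restPoints m).encard = ⊤ := by
  rw [encard_restPoints, encard_eq_top_iff]
  refine (infinite_arc hij hik hjk).mono fun x hx => ?_
  rw [mem_arc_iff hij hik hjk] at hx
  exact ⟨hx.1, h x hx.1 hx.2⟩

theorem restPoints_ne_univ (h : ∀ x ∈ sphere, IsEq m x → ∃ i, sq x i = 0 ∨ sq x i = 1) :
    restPoints m ≠ univ := by
  intro hu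
  have h3 : (0 : ℝ) ≤ 1 / 3 := by norm_num
  have hx := pt_mem_sphere h3 h3 h3 (by norm_num)
  obtain ⟨i, hi⟩ := h _ hx (show (⟨_, hx⟩ : sphere) ∈ restPoints m from hu ▸ mem_univ _)
  rw [sq_pt h3 h3 h3] at hi
  fin_cases i <;> simp at hi

theorem IsMoving.of_curve {γ : ℝ → E} (hγ : IsSphereCurve m γ) (h : ¬ IsEq m (γ 0)) :
    IsMoving m fun t => ⟨γ t, hγ.mem t⟩ := ⟨hγ, fun t => hγ.not_isEq h t⟩

theorem tendsto_coe {γ : ℝ → sphere} {l : Filter ℝ} {x : sphere} :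
    Tendsto γ l (𝓝 x) ↔ Tendsto (fun t => (γ t : E)) l (𝓝 (x : E)) := tendsto_subtype_rng

theorem exists_isMoving_edge {i j k : Fin 3} (hij : i ≠ j) (hik : i ≠ k) (hjk : j ≠ k) {κ : ℝ}
    (hκ : 0 < κ) (hr : ∀ y : Fin 3 → ℝ, y k = 0 → rate m y i = κ * y j) :
    ∃ γ, IsMoving m γ ∧ Tendsto γ atBot (𝓝 ⟨e j, e_mem_sphere j⟩) ∧
      Tendsto γ atTop (𝓝 ⟨e i, e_mem_sphere i⟩) := by
  obtain ⟨x, hx⟩ := openArc_nonempty hij hik hjk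
  obtain ⟨γ, hγ, h0⟩ := exists_isSphereCurve m ((mem_openArc_iff hij hik hjk).1 hx).1
  obtain ⟨hm, hP, hQ, -⟩ := hγ.edge hij hik hjk hκ hr (h0 ▸ hx)
  refine ⟨_, .of_curve hγ fun h => ?_, tendsto_coe.2 hP, tendsto_coe.2 hQ⟩
  have := hm (zero_lt_one' ℝ)
  simp only [hγ.eq_const h 1] at this
  exact lt_irrefl _ this

theorem hasTransit_saddle (h1 : 0 < m 1) (h2 : 0 < m 2) : HasTransit m := by
  obtain ⟨γ, hγ, -, hx⟩ := exists_isMoving_edge (m := m) (i := 2) (j := 1) (k := 0) (by decide)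
    (by decide) (by decide) h2 (fun y hy => by simp [rate, hy])
  obtain ⟨δ, hδ, hx', -⟩ := exists_isMoving_edge (m := m) (i := 0) (j := 2) (k := 1) (by decide)
    (by decide) (by decide) h1 (fun y hy => by simp [rate, hy])
  exact ⟨_, ⟨γ, hγ, hx⟩, δ, hδ, hx'⟩

theorem IsMoving.star_limits {γ : ℝ → sphere} (hγ : IsMoving m γ) (h0 : 0 < m 0) (h1 : m 1 = 0)
    (h2 : m 2 < 0) : Tendsto γ atTop (𝓝 ⟨e 1, e_mem_sphere 1⟩) ∧
      ∃ P ∈ arc 0 2, Tendsto (fun t => (γ t : E)) atBot (𝓝 P) := by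
  have hne := hγ.2 0
  change ¬ IsEq m _ at hne
  rw [isEq_iff_star h0 h1 h2 (γ 0).2, not_or,
    mem_arc_iff (k := 1) (by decide) (by decide) (by decide), not_and] at hne
  obtain ⟨-, ht, hb⟩ := hγ.1.star_limits h0 h1 h2
  exact ⟨tendsto_coe.2 (ht ((sq_nonneg' _ 1).lt_of_ne' (hne.2 (γ 0).2))),
    hb ((sq_le_one (γ 0).2 1).lt_of_ne fun h => hne.1 (eq_e_of_sq (γ 0).2 h))⟩

theorem not_hasTransit_star (h0 : 0 < m 0) (h1 : m 1 = 0) (h2 : m 2 < 0) : ¬ HasTransit m := by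
  rintro ⟨x, ⟨γ, hγ, hx⟩, δ, hδ, hx'⟩
  have e1 := tendsto_nhds_unique hx (hγ.star_limits h0 h1 h2).1
  obtain ⟨P, hP, hl⟩ := (hδ.star_limits h0 h1 h2).2
  have e2 := tendsto_nhds_unique (tendsto_coe.1 hx') hl
  have e3 := ((mem_arc_iff (k := 1) (by decide) (by decide) (by decide)).1 hP).2
  rw [← e2, e1] at e3
  simp [sq_e] at e3

theorem hasFocus_star (h0 : 0 < m 0) (h1 : m 1 = 0) (h2 : m 2 < 0) : HasFocus m :=
  ⟨_, .inl fun _ hγ => (hγ.star_limits h0 h1 h2).1⟩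

theorem not_hasTransit_strip (h0 : m 0 = 0) (h1 : m 1 = 0) (h2 : m 2 < 0) : ¬ HasTransit m := by
  have key : ∀ γ, IsMoving m γ → 0 < sq (γ 0 : E) 1 ∧ 0 < sq (γ 0 : E) 2 := by
    intro γ hγ
    have hne := hγ.2 0
    change ¬ IsEq m _ at hne
    rw [isEq_iff_strip h0 h1 h2 (γ 0).2, not_or,
      mem_arc_iff (i := 0) (j := 1) (k := 2) (by decide) (by decide) (by decide), not_and,
      mem_arc_iff (i := 0) (j := 2) (k := 1) (by decide) (by decide) (by decide), not_and] at hne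
    exact ⟨(sq_nonneg' _ 1).lt_of_ne' (hne.2 (γ 0).2), (sq_nonneg' _ 2).lt_of_ne' (hne.1 (γ 0).2)⟩
  rintro ⟨x, ⟨γ, hγ, hx⟩, δ, hδ, hx'⟩
  obtain ⟨-, Q, -, ⟨-, hQl⟩, hQ, -, -, hQ0⟩ := hγ.1.strip_limits h0 h1 h2
  obtain ⟨P, -, ⟨-, hPl⟩, -, -, hP, hP0, -⟩ := hδ.1.strip_limits h0 h1 h2
  have e1 := tendsto_nhds_unique (tendsto_coe.1 hx) hQl
  have e2 := tendsto_nhds_unique (tendsto_coe.1 hx') hPl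
  have f1 := ((mem_arc_iff (k := 2) (by decide) (by decide) (by decide)).1 (hQ (key γ hγ).1)).2
  have f2 := ((mem_arc_iff (k := 1) (by decide) (by decide) (by decide)).1 (hP (key δ hδ).2)).2
  rw [← e1] at f1 hQ0
  rw [← e2] at f2
  have s1 := sum_sq x.2
  have s2 := sum_sq (γ 0).2
  linarith [(key γ hγ).1, (key γ hγ).2]

theorem not_hasFocus_strip (h0 : m 0 = 0) (h1 : m 1 = 0) (h2 : m 2 < 0) : ¬ HasFocus m := by
  -- The first coordinate is constant along solutions, and it takes different values.
  have key : ∀ a ∈ Ico (0 : ℝ) 1, ∃ γ, IsMoving m γ ∧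
      ∀ x : sphere, Tendsto γ atTop (𝓝 x) ∨ Tendsto γ atBot (𝓝 x) → sq (x : E) 0 = a := by
    intro a ha
    have hb : 0 < (1 - a) / 2 := by linarith [ha.2]
    have hsq := sq_pt ha.1 hb.le hb.le
    obtain ⟨γ, hγ, hγ0⟩ := exists_isSphereCurve m (pt_mem_sphere ha.1 hb.le hb.le (by ring))
    refine ⟨_, .of_curve hγ ?_, ?_⟩
    · rw [isEq_iff_strip h0 h1 h2 (hγ.mem 0), not_or,
        mem_arc_iff (i := 0) (j := 1) (k := 2) (by decide) (by decide) (by decide), not_and,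
        mem_arc_iff (i := 0) (j := 2) (k := 1) (by decide) (by decide) (by decide), not_and,
        hγ0, hsq]
      exact ⟨fun _ => hb.ne', fun _ => hb.ne'⟩
    · obtain ⟨P, Q, ⟨-, hP⟩, ⟨-, hQ⟩, -, -, hP0, hQ0⟩ := hγ.strip_limits h0 h1 h2
      rw [hγ0, hsq] at hP0 hQ0
      rintro x (hx | hx)
      · rw [tendsto_nhds_unique (tendsto_coe.1 hx) hQ]; exact hQ0
      · rw [tendsto_nhds_unique (tendsto_coe.1 hx) hP]; exact hP0
  obtain ⟨γ, hγ, hγx⟩ := key 0 ⟨le_rfl, zero_lt_one⟩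
  obtain ⟨δ, hδ, hδx⟩ := key (1 / 2) ⟨by norm_num, by norm_num⟩
  rintro ⟨x, h | h⟩
  · have e1 := hγx x (.inl (h γ hγ))
    have e2 := hδx x (.inl (h δ hδ))
    rw [e1] at e2; norm_num at e2
  · have e1 := hγx x (.inr (h γ hγ))
    have e2 := hδx x (.inr (h δ hδ))
    rw [e1] at e2; norm_num at e2

/-- Six exclusive topological properties of the phase portrait, which distinguish the classes. -/
def Portrait (m : Fin 3 → ℝ) : Fin 6 → Prop :=
  ![(restPoints m).encard = 4, (restPoints m).encard = 3,
    (restPoints m).encard = ⊤ ∧ restPoints m ≠ univ ∧ HasTransit m,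
    (restPoints m).encard = ⊤ ∧ restPoints m ≠ univ ∧ ¬ HasTransit m ∧ HasFocus m,
    (restPoints m).encard = ⊤ ∧ restPoints m ≠ univ ∧ ¬ HasTransit m ∧ ¬ HasFocus m,
    (restPoints m).encard = ⊤ ∧ restPoints m = univ]

theorem WeakEquiv.portrait_eq (h : WeakEquiv m m') : Portrait m = Portrait m' := by
  simp only [Portrait, h.encard_restPoints, h.restPoints_eq_univ_iff, h.hasTransit_iff,
    h.hasFocus_iff, ne_eq]

/-- The six properties exclude each other. -/
theorem Portrait.eq {k l : Fin 6} (hk : Portrait m k) (hl : Portrait m l) : k = l := by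
  have h34 : (3 : ℕ∞) ≠ 4 := by decide
  have h3 : (3 : ℕ∞) ≠ ⊤ := by decide
  have h4 : (4 : ℕ∞) ≠ ⊤ := by decide
  fin_cases k <;> fin_cases l <;> simp [Portrait, -encard_eq_top_iff] at hk hl ⊢ <;>
    grind

theorem ListedCase.portrait {p : Params} {k : Fin 6} (hp : ListedCase p k) : Portrait p.m k := by
  fin_cases k
  · obtain ⟨h0, h1, h2⟩ := hp
    exact encard_restPoints_center fun i => by fin_cases i <;> assumption
  · obtain ⟨h0, h1, h2⟩ := hp
    exact encard_restPoints_node h0 h1 h2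
  · obtain ⟨h0, h1, h2⟩ := hp
    refine ⟨encard_restPoints_eq_top (i := 0) (j := 1) (k := 2) (by decide) (by decide) (by decide)
      fun x hx h => ?_, restPoints_ne_univ fun x hx h => ?_, hasTransit_saddle h1 h2⟩
    · rw [isEq_iff_saddle h0 h1 h2 hx, mem_arc_iff (k := 2) (by decide) (by decide) (by decide)]
      exact .inr ⟨hx, h⟩
    · rw [isEq_iff_saddle h0 h1 h2 hx,
        mem_arc_iff (k := 2) (by decide) (by decide) (by decide)] at h
      rcases h with rfl | h
      · exact ⟨2, .inr (by simp [sq_e])⟩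
      · exact ⟨2, .inl h.2⟩
  · obtain ⟨h0, h1, h2⟩ := hp
    refine ⟨encard_restPoints_eq_top (i := 0) (j := 2) (k := 1) (by decide) (by decide) (by decide)
      fun x hx h => ?_, restPoints_ne_univ fun x hx h => ?_, not_hasTransit_star h0 h1 h2,
      hasFocus_star h0 h1 h2⟩
    · rw [isEq_iff_star h0 h1 h2 hx, mem_arc_iff (k := 1) (by decide) (by decide) (by decide)]
      exact .inr ⟨hx, h⟩
    · rw [isEq_iff_star h0 h1 h2 hx, mem_arc_iff (k := 1) (by decide) (by decide) (by decide)] at h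
      rcases h with rfl | h
      · exact ⟨1, .inr (by simp [sq_e])⟩
      · exact ⟨1, .inl h.2⟩
  · obtain ⟨h0, h1, h2⟩ := hp
    refine ⟨encard_restPoints_eq_top (i := 0) (j := 1) (k := 2) (by decide) (by decide) (by decide)
      fun x hx h => ?_, restPoints_ne_univ fun x hx h => ?_, not_hasTransit_strip h0 h1 h2,
      not_hasFocus_strip h0 h1 h2⟩
    · rw [isEq_iff_strip h0 h1 h2 hx]
      exact .inl ((mem_arc_iff (k := 2) (by decide) (by decide) (by decide)).2 ⟨hx, h⟩)
    · rw [isEq_iff_strip h0 h1 h2 hx,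
        mem_arc_iff (i := 0) (j := 1) (k := 2) (by decide) (by decide) (by decide),
        mem_arc_iff (i := 0) (j := 2) (k := 1) (by decide) (by decide) (by decide)] at h
      rcases h with h | h
      · exact ⟨2, .inl h.2⟩
      · exact ⟨1, .inl h.2⟩
  · obtain ⟨h0, h1, h2⟩ := hp
    have hall : ∀ x, IsEq p.m x := fun x i => by fin_cases i <;> simp [rate, h0, h1, h2]
    exact ⟨encard_restPoints_eq_top (i := 0) (j := 1) (k := 2) (by decide) (by decide) (by decide)
      fun x _ _ => hall x, eq_univ_of_forall fun x => hall x⟩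

end Invariants

/-! ### The classes of signs -/

theorem ListedCase.signClass {p : Params} {k : Fin 6} (hp : ListedCase p k) : SignClass p k := by
  fin_cases k
  · obtain ⟨h0, h1, h2⟩ := hp
    exact .inl fun i => by fin_cases i <;> assumption
  · obtain ⟨h0, h1, h2⟩ := hp
    refine ⟨fun i => ?_, 0, 1, mul_neg_of_neg_of_pos h0 h1⟩
    fin_cases i
    · exact h0.ne
    · exact h1.ne'
    · exact h2.ne
  · obtain ⟨h0, h1, h2⟩ := hp
    exact ⟨0, 1, 2, by decide, by decide, by decide, h0, mul_pos h1 h2⟩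
  · obtain ⟨h0, h1, h2⟩ := hp
    exact ⟨1, 0, 2, by decide, by decide, by decide, h1, mul_neg_of_pos_of_neg h0 h2⟩
  · obtain ⟨h0, h1, h2⟩ := hp
    exact ⟨0, 1, 2, by decide, by decide, by decide, h0, h1, h2.ne⟩
  · obtain ⟨h0, h1, h2⟩ := hp
    intro i
    fin_cases i <;> assumption

theorem exists_listedCase (k : Fin 6) : ∃ p : Params, ListedCase p k := by
  have key : ∀ m : Fin 3 → ℝ, ∃ p : Params, p.m = m := exists_params
  fin_cases k
  · obtain ⟨p, hp⟩ := key ![1, 1, 1]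
    exact ⟨p, by simp [ListedCase, hp]⟩
  · obtain ⟨p, hp⟩ := key ![-1, 1, -1]
    exact ⟨p, by simp [ListedCase, hp]⟩
  · obtain ⟨p, hp⟩ := key ![0, 1, 1]
    exact ⟨p, by simp [ListedCase, hp]⟩
  · obtain ⟨p, hp⟩ := key ![1, 0, -1]
    exact ⟨p, by simp [ListedCase, hp]⟩
  · obtain ⟨p, hp⟩ := key ![0, 0, -1]
    exact ⟨p, by simp [ListedCase, hp]⟩
  · obtain ⟨p, hp⟩ := key ![0, 0, 0]
    exact ⟨p, by simp [ListedCase, hp]⟩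

theorem exists_signClass (p : Params) : ∃ k, SignClass p k := by
  have other : ∀ {i : Fin 3}, ∃ j k, i ≠ j ∧ i ≠ k ∧ j ≠ k := fun {i} => by
    revert i; decide
  by_cases hne : ∀ i, p.m i ≠ 0
  · by_cases hneg : ∃ i j, p.m i * p.m j < 0
    · exact ⟨1, hne, hneg⟩
    · push Not at hneg
      have hpos : ∀ i j, 0 < p.m i * p.m j := fun i j =>
        (hneg i j).lt_of_ne' (mul_ne_zero (hne i) (hne j))
      refine ⟨0, (hne 0).lt_or_gt.symm.imp (fun h i => ?_) fun h i => ?_⟩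
      · exact pos_of_mul_pos_right (hpos 0 i) h.le
      · exact neg_of_mul_pos_right (hpos 0 i) h.le
  · push Not at hne
    obtain ⟨i, hi⟩ := hne
    obtain ⟨j, k, hij, hik, hjk⟩ := other (i := i)
    by_cases hj : p.m j = 0
    · by_cases hk : p.m k = 0
      · refine ⟨5, fun l => ?_⟩
        rcases show l = i ∨ l = j ∨ l = k by omega with rfl | rfl | rfl <;> assumption
      · exact ⟨4, i, j, k, hij, hik, hjk, hi, hj, hk⟩
    · by_cases hk : p.m k = 0
      · exact ⟨4, i, k, j, hik, hij, hjk.symm, hi, hk, hj⟩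
      · rcases (mul_ne_zero hj hk).lt_or_gt with h | h
        · exact ⟨3, i, j, k, hij, hik, hjk, hi, h⟩
        · exact ⟨2, i, j, k, hij, hik, hjk, hi, h⟩

/-- The class of signs is determined by the phase portrait. -/
theorem SignClass.eq_of_weakEquiv {p q : Params} (h : WeakEquiv p.m q.m) {k l : Fin 6}
    (hk : SignClass p k) (hl : SignClass q l) : k = l := by
  obtain ⟨p', hp', hpp⟩ := hk.exists_listedCase
  obtain ⟨q', hq', hqq⟩ := hl.exists_listedCase
  have := ((hpp.symm.trans h).trans hqq).portrait_eq
  exact Portrait.eq (this ▸ hp'.portrait) hq'.portrait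

theorem existsUnique_signClass (p : Params) : ∃! k, SignClass p k := by
  obtain ⟨k, hk⟩ := exists_signClass p
  exact ⟨k, hk, fun l hl => hl.eq_of_weakEquiv (.inl (.refl _)) hk⟩

theorem topEquiv_iff_signClass (p q : Params) :
    TopEquiv p q ↔ ∃ k, SignClass p k ∧ SignClass q k := by
  rw [topEquiv_iff]
  constructor
  · intro h
    obtain ⟨k, hk⟩ := exists_signClass p
    obtain ⟨l, hl⟩ := exists_signClass q
    exact ⟨k, hk, hk.eq_of_weakEquiv h hl ▸ hl⟩
  · rintro ⟨k, hp, hq⟩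
    obtain ⟨p', hp', hpp⟩ := hp.exists_listedCase
    obtain ⟨q', hq', hqq⟩ := hq.exists_listedCase
    exact (hpp.trans (.inl (.of_listedCase hp' hq'))).trans hqq.symm

end Kolmogorov

end

open Kolmogorov in
theorem theorem2p1 :
    -- Well-posedness, and the facts common to all parameters.
    (∀ p : Params,
      (∀ x ∈ octant, ∃ γ : ℝ → E, IsForwardSolution p γ ∧ γ 0 = x ∧
        (∀ t, 0 ≤ t → γ t ∈ octant) ∧
        ∀ γ' : ℝ → E, IsForwardSolution p γ' → γ' 0 = x → EqOn γ' γ (Ici 0)) ∧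
      (∀ x ∈ sphere, ∃ γ : ℝ → E, IsTrajectory p γ ∧ γ 0 = x ∧ (∀ t, γ t ∈ sphere) ∧
        ∀ γ' : ℝ → E, IsTrajectory p γ' → γ' 0 = x → γ' = γ) ∧
      SphereIsGlobalAttractor p ∧
      omega p 0 = {0} ∧
      (∀ x ∈ octant \ {0}, (omega p x).Nonempty ∧ omega p x ⊆ sphere)) ∧
    -- Exactly six topological phase portraits, determined by the signs of `α + dᵢ`.
    (∀ p : Params, ∃! k : Fin 6, SignClass p k) ∧
    (∀ p : Params, ∀ k : Fin 6, ListedCase p k → SignClass p k) ∧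
    (∀ k : Fin 6, ∃ p : Params, ListedCase p k) ∧
    (∀ p q : Params, TopEquiv p q ↔ ∃ k : Fin 6, SignClass p k ∧ SignClass q k) ∧
    -- Case (i)
    (∀ p : Params, 0 < p.m 0 → 0 < p.m 1 → 0 < p.m 2 →
      equilibria p = {0, e 0, e 1, e 2, Qstar p} ∧
      sphere = (⋃ h ∈ Ioi (hstar p), Gam p h) ∪ {Qstar p} ∪ bdSphere ∧
      (∀ h, hstar p < h → IsPeriodicOrbit p (Gam p h) ∧ Surrounds (Gam p h) (Qstar p)) ∧
      IsCenterOnSphere p (Qstar p) ∧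
      bdSphere = {e 0, e 1, e 2} ∪ (openArc 0 1 ∪ openArc 1 2 ∪ openArc 0 2) ∧
      IsHeteroclinicOrbit p (openArc 0 1) (e 0) (e 1) ∧
      IsHeteroclinicOrbit p (openArc 1 2) (e 1) (e 2) ∧
      IsHeteroclinicOrbit p (openArc 0 2) (e 2) (e 0) ∧
      intOctant = (⋃ h ∈ Ioi (hstar p), cone p h) ∪ ray (Qstar p) ∧
      (∀ h, hstar p < h → ∀ x ∈ cone p h, omega p x = Gam p h) ∧
      (∀ x ∈ ray (Qstar p), omega p x = {Qstar p}) ∧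
      (∀ x ∈ bdOctant \ {0}, ∃ i, omega p x = {e i})) ∧
    -- Case (ii)
    (∀ p : Params, p.m 0 < 0 → 0 < p.m 1 → p.m 2 < 0 →
      equilibria p = {0, e 0, e 1, e 2} ∧
      IsStableNode p (e 0) ∧ IsSaddle p (e 1) ∧ IsUnstableNode p (e 2) ∧
      IsHeteroclinicOrbit p (openArc 1 2) (e 2) (e 1) ∧
      IsHeteroclinicOrbit p (openArc 0 1) (e 1) (e 0) ∧
      (∀ x ∈ sphere \ (arc 0 1 ∪ arc 1 2),
        ∃ C, x ∈ C ∧ C ⊆ sphere ∧ IsHeteroclinicOrbit p C (e 2) (e 0)) ∧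
      (∀ x ∈ intOctant, omega p x = {e 0}) ∧
      (∀ x ∈ bdOctant \ {0}, ∃ i, omega p x = {e i})) ∧
    -- Case (iii.a)
    (∀ p : Params, p.m 0 = 0 → 0 < p.m 1 → 0 < p.m 2 →
      equilibria p = {0, e 2} ∪ arc 0 1 ∧
      (∀ x ∈ intSphere, ∃ C, ∃ P ∈ arcMinus p, ∃ Q ∈ arcPlus p,
        x ∈ C ∧ C ⊆ intSphere ∧ IsHeteroclinicOrbit p C P Q) ∧
      {C : Set E | C ⊆ intSphere ∧ ∃ P Q, IsHeteroclinicOrbit p C P Q}.Infinite ∧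
      IsHeteroclinicOrbit p (openArc 1 2) (e 1) (e 2) ∧
      IsHeteroclinicOrbit p (openArc 0 2) (e 2) (e 0) ∧
      (∀ x ∈ intOctant, ∃ Q ∈ arcPlus p, omega p x = {Q}) ∧
      (∀ x ∈ bdOctant \ {0}, ∃ Q ∈ {e 2} ∪ arc 0 1, omega p x = {Q})) ∧
    -- Case (iii.b)
    (∀ p : Params, 0 < p.m 0 → p.m 1 = 0 → p.m 2 < 0 →
      equilibria p = {0, e 1} ∪ arc 0 2 ∧
      IsStableNode p (e 1) ∧
      (∀ x ∈ sphere \ arc 0 2, omega p x = {e 1}) ∧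
      (∀ x ∈ sphere \ ({e 1} ∪ arc 0 2), ∃ C, ∃ P ∈ arc 0 2,
        x ∈ C ∧ C ⊆ sphere ∧ IsHeteroclinicOrbit p C P (e 1)) ∧
      (∀ x ∈ intOctant, omega p x = {e 1}) ∧
      (∀ x ∈ bdOctant \ {0}, ∃ Q ∈ {e 1} ∪ arc 0 2, omega p x = {Q})) ∧
    -- Case (iv)
    (∀ p : Params, p.m 0 = 0 → p.m 1 = 0 → p.m 2 < 0 →
      equilibria p = {0} ∪ arc 0 1 ∪ arc 0 2 ∧
      (∀ x ∈ intSphere, ∃ C, ∃ P ∈ arc 0 2, ∃ Q ∈ arc 0 1,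
        x ∈ C ∧ C ⊆ intSphere ∧ IsHeteroclinicOrbit p C P Q) ∧
      IsHeteroclinicOrbit p (openArc 1 2) (e 2) (e 1) ∧
      (∀ x ∈ intOctant, ∃ Q ∈ arc 0 1, omega p x = {Q}) ∧
      (∀ x ∈ bdOctant \ {0}, ∃ Q ∈ arc 0 1 ∪ arc 0 2, omega p x = {Q})) ∧
    -- Case (v)
    (∀ p : Params, p.m 0 = 0 → p.m 1 = 0 → p.m 2 = 0 →
      equilibria p = {0} ∪ sphere ∧
      (∀ x ∈ octant \ {0}, ∃ Q, ray x ∩ sphere = {Q} ∧ omega p x = {Q})) := by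
  refine ⟨fun p => ⟨fun x hx => exists_forwardSolution p hx, fun x hx => ?_,
    sphereIsGlobalAttractor p, omega_zero p, fun x hx => omega_nonempty_subset p hx⟩,
    existsUnique_signClass, fun p k => ListedCase.signClass, exists_listedCase,
    topEquiv_iff_signClass, fun p => center_case, fun p => node_case, fun p => saddle_case,
    fun p => star_case, fun p => strip_case, fun p => zero_case⟩
  obtain ⟨γ, hγ, h0⟩ := exists_isSphereCurve p.m hx
  have h := isSphereCurve_iff.1 hγ
  exact ⟨γ, h.1, h0, h.2, fun δ hδ hδ0 => hδ.eq_of_eq h.1 (s := 0) (hδ0.trans h0.symm)⟩
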